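/- Let $G=\mathrm{GL}_3(\mathbb R)$ and $H=\mathrm{GL}_2(\mathbb R)$, embedded in $G$ by $h\mapsto\mathrm{diag}(h,1)$, and let $P_G,P_H$ be the subgroups of upper triangular matrices. For $\xi\in(\mathbb Z/2\mathbb Z)^m$, $\lambda\in\mathbb C^m$, the smooth principal series of $\mathrm{GL}_m(\mathbb R)$ is the left regular representation on the space of $f\in C^\infty(\mathrm{GL}_m(\mathbb R))$ with $f(gp)=\prod_{i=1}^m \operatorname{sgn}(p_{ii})^{\xi_i}|p_{ii}|^{-\lambda_i-\frac{m+1-2i}{2}}f(g)$ for all upper triangular $p$; it is denoted $\pi_{\xi,\lambda}$ for $G$ and $\tau_{\eta,\nu}$ for $H$. Let $$x_0=\begin{pmatrix}0&1&0\\0&0&1\\1&0&0\end{pmatrix},\qquad p_0:H/P_H\to G/P_G,\quad hP_H\mapsto hx_0P_G,\qquad (\mathrm{rest}_0f)(h)=f(hx_0),$$ and let $\mathrm{DSBO}_0(\pi_{\xi,\lambda},\tau_{\eta,\nu})$ be the space of continuous $H$-intertwining linear maps $T:\pi_{\xi,\lambda}\to\tau_{\eta,\nu}$ with $p_0(\operatorname{supp}Tf)\subset\operatorname{supp}f$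 for all $f$ (supports of sections over the flag varieties). Put $\varepsilon^{i,j}f(g)=\sum_k g_{ki}\,\partial_{kj}f(g)$ on $G$, and let $\varepsilon_H^{2,1}$ be the operator given by the same formula (for $i=2$, $j=1$) on $H$. With $\Phi_j(g)=g_{3,j}$ (acting by multiplication) and $\lambda_{i,j}=\lambda_i-\lambda_j-1$, let $$\mathcal D_2(\lambda)=\det\begin{pmatrix}\Phi_1&\lambda_{2,1}\\ \Phi_2&\varepsilon^{2,1}\end{pmatrix},\qquad \mathcal D_3(\lambda)=\det\begin{pmatrix}\Phi_1&\lambda_{3,1}&0\\ \Phi_2&\varepsilon^{2,1}&\lambda_{3,2}\\ \Phi_3&\varepsilon^{3,1}&\varepsilon^{3,2}\end{pmatrix},$$ where in each term of the determinant the factors are composed in the order of the columns. Put $\mathcal D_i^{\alpha}=\mathcal D_i(\lambda-(\alpha-1)e_i)\circ\cdots\circ\mathcal D_i(\lambda)$ for $\alpha\in\mathbb N=\{0,1,2,\dots\}$, where $\lambda$ is the parameter of the principal series of $G$ on which the power acts; $\mathcal D_i$ lowers $\lambda_i$ by $1$. **Proposition.** Let $n_1:=\lambda_3-\nu_2-\tfrac12$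 and $n_2:=\lambda_2+\lambda_3-\nu_1-\nu_2-1$. Suppose that $n_1,n_2\in\mathbb N$ and that, in $\mathbb Z/2\mathbb Z$, $$\eta_1=\xi_2+n_1+n_2,\qquad \eta_2=\xi_3+n_1 .$$ 1. If $n_1\le n_2$, then a basis of $\mathrm{DSBO}_0(\pi_{\xi,\lambda},\tau_{\eta,\nu})$ is given by the single operator $\mathrm{rest}_0\circ\mathcal D_2^{\,n_2-n_1}\circ\mathcal D_3^{\,n_1}$. 2. If $n_1>n_2$ and there is an integer $0\le k_0\le n_2$ with $\lambda_3-\lambda_2-n_1+k_0=0$, then a basis of $\mathrm{DSBO}_0(\pi_{\xi,\lambda},\tau_{\eta,\nu})$ is given by the single operator $(\varepsilon_H^{2,1})^{\,n_1-n_2+k_0}\circ\mathrm{rest}_0\circ\mathcal D_2^{\,k_0}\circ\mathcal D_3^{\,n_2-k_0}$. -/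

import Mathlib

open Matrix
open scoped ContDiff

attribute [local instance] Matrix.normedAddCommGroup Matrix.normedSpace

noncomputable section

namespace SymBreak

/-! ### Smooth functions on `GL m ℝ`, an open subset of the space of real `m × m` matrices -/

/-- A function on `GL m ℝ`, extended by zero to all matrices. -/
def toMat {m : ℕ} (f : GL (Fin m) ℝ → ℂ) : Matrix (Fin m) (Fin m) ℝ → ℂ :=
  Function.extend Units.val f 0

/-- Smoothness on `GL m ℝ`. -/
def IsSmooth {m : ℕ} (f : GL (Fin m) ℝ → ℂ) : Prop :=
  ∀ g : GL (Fin m) ℝ, ContDiffAt ℝ ∞ (toMat f) (g : Matrix (Fin m) (Fin m) ℝ)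

lemma toMat_coe {m : ℕ} (f : GL (Fin m) ℝ → ℂ) (g : GL (Fin m) ℝ) :
    toMat f (g : Matrix (Fin m) (Fin m) ℝ) = f g :=
  Units.val_injective.extend_apply f 0 g

lemma toMat_add {m : ℕ} (f₁ f₂ : GL (Fin m) ℝ → ℂ) : toMat (f₁ + f₂) = toMat f₁ + toMat f₂ := by
  funext A
  by_cases hA : ∃ g : GL (Fin m) ℝ, (g : Matrix (Fin m) (Fin m) ℝ) = A
  · obtain ⟨g, rfl⟩ := hA
    simp only [Pi.add_apply, toMat_coe]
  · simp [toMat, Function.extend_apply' _ _ _ hA]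

lemma toMat_smul {m : ℕ} (c : ℂ) (f : GL (Fin m) ℝ → ℂ) : toMat (c • f) = c • toMat f := by
  funext A
  by_cases hA : ∃ g : GL (Fin m) ℝ, (g : Matrix (Fin m) (Fin m) ℝ) = A
  · obtain ⟨g, rfl⟩ := hA
    simp only [Pi.smul_apply, toMat_coe]
  · simp [toMat, Function.extend_apply' _ _ _ hA]

lemma toMat_zero {m : ℕ} : toMat (0 : GL (Fin m) ℝ → ℂ) = 0 := by
  simpa using toMat_smul 0 (0 : GL (Fin m) ℝ → ℂ)

lemma toMat_translate {m : ℕ} (h : GL (Fin m) ℝ) (f : GL (Fin m) ℝ → ℂ) :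
    toMat (fun g => f (h * g)) =
      fun A : Matrix (Fin m) (Fin m) ℝ => toMat f ((h : Matrix (Fin m) (Fin m) ℝ) * A) := by
  funext A
  by_cases hA : ∃ g : GL (Fin m) ℝ, (g : Matrix (Fin m) (Fin m) ℝ) = A
  · obtain ⟨g, rfl⟩ := hA
    rw [toMat_coe, ← Units.val_mul, toMat_coe]
  · have hB : ¬ ∃ g : GL (Fin m) ℝ, (g : Matrix (Fin m) (Fin m) ℝ) =
        (h : Matrix (Fin m) (Fin m) ℝ) * A := by
      rintro ⟨g, hg⟩
      exact hA ⟨h⁻¹ * g, by rw [Units.val_mul, hg, Units.inv_mul_cancel_left]⟩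
    simp [toMat, Function.extend_apply' _ _ _ hA, Function.extend_apply' _ _ _ hB]

lemma IsSmooth.translate {m : ℕ} {f : GL (Fin m) ℝ → ℂ} (hf : IsSmooth f) (h : GL (Fin m) ℝ) :
    IsSmooth (fun g => f (h * g)) := by
  intro g
  rw [toMat_translate]
  have h1 : ContDiffAt ℝ ∞ (toMat f)
      (LinearMap.toContinuousLinearMap
        (LinearMap.mulLeft ℝ (h : Matrix (Fin m) (Fin m) ℝ)) g) := by
    simpa using hf (h * g)
  exact h1.comp (g : Matrix (Fin m) (Fin m) ℝ)
    (LinearMap.toContinuousLinearMap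
        (LinearMap.mulLeft ℝ (h : Matrix (Fin m) (Fin m) ℝ))).contDiff.contDiffAt

/-! ### Principal series -/

/-- The minimal parabolic subgroup of upper triangular matrices in `GL m ℝ`. -/
def borel (m : ℕ) : Subgroup (GL (Fin m) ℝ) where
  carrier := {p | ∀ i j : Fin m, j < i → (p : Matrix (Fin m) (Fin m) ℝ) i j = 0}
  one_mem' := by
    intro i j hij
    simp [Matrix.one_apply_ne hij.ne']
  mul_mem' := by
    intro a b ha hb
    have h1 : Matrix.BlockTriangular (a : Matrix (Fin m) (Fin m) ℝ) id := fun i j h => ha i j h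
    have h2 : Matrix.BlockTriangular (b : Matrix (Fin m) (Fin m) ℝ) id := fun i j h => hb i j h
    exact fun i j h => (h1.mul h2) h
  inv_mem' := by
    intro a ha
    have h1 : Matrix.BlockTriangular (a : Matrix (Fin m) (Fin m) ℝ) id := fun i j h => ha i j h
    let _ := a.invertible
    have h2 := Matrix.blockTriangular_inv_of_blockTriangular h1
    intro i j h
    rw [Matrix.coe_units_inv]
    exact h2 h

/-- `|x|_ξ^s = sgn(x)^ξ |x|^s` for real `x ≠ 0`. -/
def sgnPow (ξ : ZMod 2) (s : ℂ) (x : ℝ) : ℂ :=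
  ((Real.sign x : ℝ) : ℂ) ^ ξ.val * ((|x| : ℝ) : ℂ) ^ s

/-- The half sum of positive roots `ρ = ½ (m - 1, m - 3, …, 1 - m)` of `GL m ℝ`. -/
def rho (m : ℕ) (i : Fin m) : ℂ := ((m : ℂ) - 1 - 2 * (i : ℕ)) / 2

/-- The factor `∏ᵢ |pᵢᵢ|_{ξᵢ}^{-λᵢ-ρᵢ}`; for upper triangular `p = m a n` the diagonal entries
of `p` are those of `m a`, so this is `ξ(m)⁻¹ a^{-λ-ρ}`. -/
def inducingFactor {m : ℕ} (ξ : Fin m → ZMod 2) (lam : Fin m → ℂ) (p : GL (Fin m) ℝ) : ℂ :=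
  ∏ i, sgnPow (ξ i) (-lam i - rho m i) ((p : Matrix (Fin m) (Fin m) ℝ) i i)

/-- The space of the smooth normalized principal series `Ind_P^G (ξ ⊗ e^λ ⊗ 1)`,
`G = GL m ℝ`. -/
def principalSeries {m : ℕ} (ξ : Fin m → ZMod 2) (lam : Fin m → ℂ) :
    Submodule ℂ (GL (Fin m) ℝ → ℂ) where
  carrier := {f | IsSmooth f ∧
    ∀ g : GL (Fin m) ℝ, ∀ p ∈ borel m, f (g * p) = inducingFactor ξ lam p * f g}
  zero_mem' := by
    refine ⟨fun g => ?_, fun g p _ => by simp⟩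
    rw [toMat_zero]
    exact contDiffAt_const
  add_mem' := by
    rintro a b ⟨ha, ha'⟩ ⟨hb, hb'⟩
    refine ⟨fun g => ?_, fun g p hp => ?_⟩
    · rw [toMat_add]
      exact (ha g).add (hb g)
    · simp only [Pi.add_apply, ha' g p hp, hb' g p hp]
      ring
  smul_mem' := by
    rintro c a ⟨ha, ha'⟩
    refine ⟨fun g => ?_, fun g p hp => ?_⟩
    · rw [toMat_smul]
      exact (ha g).const_smul c
    · simp only [Pi.smul_apply, ha' g p hp, smul_eq_mul]
      ring

/-- The left regular action `(π(h) f)(g) = f(h⁻¹ g)` on the principal series. -/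
def leftRegular {m : ℕ} (ξ : Fin m → ZMod 2) (lam : Fin m → ℂ) :
    Representation ℂ (GL (Fin m) ℝ) (principalSeries ξ lam) where
  toFun h :=
    { toFun := fun f => ⟨fun g => f.1 (h⁻¹ * g), f.2.1.translate h⁻¹, fun g p hp => by
        simp only [← mul_assoc]; exact f.2.2 (h⁻¹ * g) p hp⟩
      map_add' := fun _ _ => rfl
      map_smul' := fun _ _ => rfl }
  map_one' := by
    ext f g
    simp
  map_mul' h₁ h₂ := by
    ext f g
    simp [mul_assoc]

/-- The support, in the flag variety `G / P`, of a section (given by an equivariant function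
on `G`). -/
def sectionSupport {m : ℕ} (f : GL (Fin m) ℝ → ℂ) : Set (GL (Fin m) ℝ ⧸ borel m) :=
  closure ((fun g : GL (Fin m) ℝ => (g : GL (Fin m) ℝ ⧸ borel m)) '' Function.support f)

/-- Continuity of a linear map between principal series, for their Fréchet topologies (uniform
convergence of all derivatives on compact sets, i.e. the topologies given by the seminorms
`f ↦ max_{j ≤ N} sup_{g ∈ K} ‖D^j f (g)‖`, `K` compact). -/
def IsContinuous {m m' : ℕ} {ξ : Fin m → ZMod 2} {lam : Fin m → ℂ}
    {η : Fin m' → ZMod 2} {ν : Fin m' → ℂ}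
    (T : principalSeries ξ lam →ₗ[ℂ] principalSeries η ν) : Prop :=
  ∀ L : Set (GL (Fin m') ℝ), IsCompact L → ∀ n : ℕ,
    ∃ K : Set (GL (Fin m) ℝ), IsCompact K ∧ ∃ N : ℕ, ∃ C : ℝ, 0 ≤ C ∧
      ∀ f : principalSeries ξ lam, ∀ B : ℝ, 0 ≤ B →
        (∀ j ≤ N, ∀ g ∈ K,
          ‖iteratedFDeriv ℝ j (toMat f.1) (g : Matrix (Fin m) (Fin m) ℝ)‖ ≤ B) →
        ∀ h ∈ L, ‖iteratedFDeriv ℝ n (toMat (T f).1) (h : Matrix (Fin m') (Fin m') ℝ)‖ ≤ C * B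

/-! ### The pair `(GL (n+1) ℝ, GL n ℝ)` and differential symmetry breaking operators -/

/-- The embedding `h ↦ diag(h, 1)` of `GL n ℝ` into `GL (n+1) ℝ`. -/
def embed (n : ℕ) : GL (Fin n) ℝ →* GL (Fin (n + 1)) ℝ :=
  Units.map
    { toFun := fun A : Matrix (Fin n) (Fin n) ℝ =>
        Matrix.reindex finSumFinEquiv finSumFinEquiv
          (Matrix.fromBlocks A 0 0 (1 : Matrix (Fin 1) (Fin 1) ℝ))
      map_one' := by simp [Matrix.fromBlocks_one]
      map_mul' := fun A B => by
        simp [Matrix.submatrix_mul_equiv, Matrix.fromBlocks_multiply] }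

/-- The permutation `0, …, n-1 ↦ 0, …, k-1, k+1, …, n` and `n ↦ k`. -/
def basePerm {n : ℕ} (k : Fin (n + 1)) : Equiv.Perm (Fin (n + 1)) :=
  finSuccEquivLast.trans (finSuccEquiv' k).symm

/-- The base points `x_k`: the permutation matrix with a `1` at the places
`(i, basePerm k i)`. -/
def basePoint {n : ℕ} (k : Fin (n + 1)) : GL (Fin (n + 1)) ℝ where
  val := (basePerm k).permMatrix ℝ
  inv := (basePerm k)⁻¹.permMatrix ℝ
  val_inv := by rw [← Matrix.permMatrix_mul]; simp
  inv_val := by rw [← Matrix.permMatrix_mul]; simp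

lemma embed_entries {n : ℕ} (h : GL (Fin n) ℝ) :
    (∀ i j : Fin n, (embed n h : Matrix (Fin (n + 1)) (Fin (n + 1)) ℝ) i.castSucc j.castSucc =
      (h : Matrix (Fin n) (Fin n) ℝ) i j) ∧
    (∀ i : Fin n, (embed n h : Matrix (Fin (n + 1)) (Fin (n + 1)) ℝ) i.castSucc (Fin.last n) = 0) ∧
    (∀ j : Fin n, (embed n h : Matrix (Fin (n + 1)) (Fin (n + 1)) ℝ) (Fin.last n) j.castSucc = 0) ∧
    (embed n h : Matrix (Fin (n + 1)) (Fin (n + 1)) ℝ) (Fin.last n) (Fin.last n) = 1 := by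
  have e1 : ∀ i : Fin n, finSumFinEquiv.symm i.castSucc = (Sum.inl i : Fin n ⊕ Fin 1) :=
    fun i => finSumFinEquiv_symm_apply_castAdd i
  have e2 : finSumFinEquiv.symm (Fin.last n) = (Sum.inr 0 : Fin n ⊕ Fin 1) :=
    finSumFinEquiv_symm_last
  refine ⟨fun i j => ?_, fun i => ?_, fun j => ?_, ?_⟩ <;>
    simp [embed, e1, e2]

lemma basePoint_conj_mem {n : ℕ} (k : Fin (n + 1)) {p : GL (Fin n) ℝ} (hp : p ∈ borel n) :
    (basePoint k)⁻¹ * embed n p * basePoint k ∈ borel (n + 1) := by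
  have key : ∀ a b : Fin (n + 1),
      (((basePoint k)⁻¹ * embed n p * basePoint k : GL (Fin (n + 1)) ℝ) :
        Matrix (Fin (n + 1)) (Fin (n + 1)) ℝ) (basePerm k a) (basePerm k b) =
      (embed n p : Matrix (Fin (n + 1)) (Fin (n + 1)) ℝ) a b := by
    intro a b
    change (((basePerm k)⁻¹.permMatrix ℝ) *
      (embed n p : Matrix (Fin (n + 1)) (Fin (n + 1)) ℝ) *
      ((basePerm k).permMatrix ℝ) : Matrix (Fin (n + 1)) (Fin (n + 1)) ℝ)
        (basePerm k a) (basePerm k b) = _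
    simp [Equiv.Perm.permMatrix, PEquiv.toMatrix_toPEquiv_mul, PEquiv.mul_toMatrix_toPEquiv]
  intro i j hij
  obtain ⟨a, rfl⟩ := (basePerm k).surjective i
  obtain ⟨b, rfl⟩ := (basePerm k).surjective j
  rw [key]
  induction a using Fin.lastCases with
  | last =>
    induction b using Fin.lastCases with
    | last => exact absurd hij (lt_irrefl _)
    | cast b => exact (embed_entries p).2.2.1 b
  | cast a =>
    induction b using Fin.lastCases with
    | last => exact (embed_entries p).2.1 a
    | cast b =>
      rw [(embed_entries p).1]
      refine hp a b ?_
      simpa [basePerm] using hij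

/-- The map `p_k : H / P_H → G / P_G`, `h P_H ↦ h x_k P_G`. -/
def flagMap {n : ℕ} (k : Fin (n + 1)) :
    GL (Fin n) ℝ ⧸ borel n → GL (Fin (n + 1)) ℝ ⧸ borel (n + 1) := fun q =>
  Quotient.liftOn' q
    (fun h => ((embed n h * basePoint k : GL (Fin (n + 1)) ℝ) :
      GL (Fin (n + 1)) ℝ ⧸ borel (n + 1)))
    (by
      intro a b hab
      rw [QuotientGroup.leftRel_apply] at hab
      rw [QuotientGroup.eq]
      have h := basePoint_conj_mem k hab
      have e : (embed n a * basePoint k)⁻¹ * (embed n b * basePoint k) =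
          (basePoint k)⁻¹ * embed n (a⁻¹ * b) * basePoint k := by
        rw [map_mul, map_inv]; group
      rw [e]
      exact h)

/-- The `p_k`-differential symmetry breaking operators from the principal series of
`GL (n+1) ℝ` to the one of `GL n ℝ`: continuous linear maps that intertwine the action of
`GL n ℝ` and satisfy `p_k (supp T f) ⊆ supp f` for all `f`. -/
def DSBO {n : ℕ} (k : Fin (n + 1)) (ξ : Fin (n + 1) → ZMod 2) (lam : Fin (n + 1) → ℂ)
    (η : Fin n → ZMod 2) (ν : Fin n → ℂ) :
    Submodule ℂ (principalSeries ξ lam →ₗ[ℂ] principalSeries η ν) where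
  carrier := {T | IsContinuous T ∧
    (∀ (h : GL (Fin n) ℝ) (f : principalSeries ξ lam),
      T (leftRegular ξ lam (embed n h) f) = leftRegular η ν h (T f)) ∧
    ∀ f : principalSeries ξ lam,
      flagMap k '' sectionSupport (T f).1 ⊆ sectionSupport f.1}
  zero_mem' := by
    refine ⟨fun L _ n => ⟨∅, isCompact_empty, 0, 0, le_rfl, fun f B _ _ h _ => ?_⟩,
      fun h f => by simp, fun f => by simp [sectionSupport]⟩
    simp [toMat_zero]
  add_mem' := by
    rintro S T ⟨hS, hS', hS''⟩ ⟨hT, hT', hT''⟩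
    refine ⟨fun L hL r => ?_, fun h f => by simp [hS', hT'], fun f => ?_⟩
    · obtain ⟨K₁, hK₁, N₁, C₁, hC₁, h₁⟩ := hS L hL r
      obtain ⟨K₂, hK₂, N₂, C₂, hC₂, h₂⟩ := hT L hL r
      refine ⟨K₁ ∪ K₂, hK₁.union hK₂, max N₁ N₂, C₁ + C₂, add_nonneg hC₁ hC₂,
        fun f B hB hf h hh => ?_⟩
      have e₁ := h₁ f B hB (fun j hj g hg => hf j (hj.trans (le_max_left _ _)) g (Or.inl hg)) h hh
      have e₂ := h₂ f B hB (fun j hj g hg => hf j (hj.trans (le_max_right _ _)) g (Or.inr hg)) h hh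
      have e : toMat ((S + T) f).1 = toMat (S f).1 + toMat (T f).1 := toMat_add _ _
      rw [e, iteratedFDeriv_add_apply (((S f).2.1 h).of_le (by exact_mod_cast le_top))
        (((T f).2.1 h).of_le (by exact_mod_cast le_top)), add_mul]
      exact (norm_add_le _ _).trans (add_le_add e₁ e₂)
    · refine subset_trans ?_ (Set.union_subset (hS'' f) (hT'' f))
      rw [← Set.image_union]
      refine Set.image_mono ?_
      rw [sectionSupport, sectionSupport, sectionSupport, ← closure_union, ← Set.image_union]
      exact closure_mono (Set.image_mono (Function.support_add _ _))
  smul_mem' := by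
    rintro c T ⟨hT, hT', hT''⟩
    refine ⟨fun L hL r => ?_, fun h f => by simp [hT'], fun f => ?_⟩
    · obtain ⟨K, hK, N, C, hC, h₁⟩ := hT L hL r
      refine ⟨K, hK, N, ‖c‖ * C, mul_nonneg (norm_nonneg _) hC, fun f B hB hf h hh => ?_⟩
      have e : toMat ((c • T) f).1 = c • toMat (T f).1 := toMat_smul _ _
      rw [e, iteratedFDeriv_const_smul_apply (((T f).2.1 h).of_le (by exact_mod_cast le_top)),
        norm_smul, mul_assoc]
      exact mul_le_mul_of_nonneg_left (h₁ f B hB hf h hh) (norm_nonneg _)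
    · refine subset_trans (Set.image_mono ?_) (hT'' f)
      exact closure_mono (Set.image_mono (Function.support_const_smul_subset _ _))

/-! ### The explicit operators -/

/-- The restriction `(rest_k f)(h) = f(h x_k)`. -/
def rest {n : ℕ} (k : Fin (n + 1)) (f : GL (Fin (n + 1)) ℝ → ℂ) : GL (Fin n) ℝ → ℂ :=
  fun h => f (embed n h * basePoint k)

/-- The infinitesimal right regular action of the matrix unit `E i j`: the derivative of `f` at
`g` in the direction `g * E i j`, i.e. `∑ₖ gₖᵢ ∂ₖⱼ f (g)`. -/
def eps {m : ℕ} (i j : Fin m) (f : GL (Fin m) ℝ → ℂ) : GL (Fin m) ℝ → ℂ :=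
  fun g => fderiv ℝ (toMat f) (g : Matrix (Fin m) (Fin m) ℝ)
    ((g : Matrix (Fin m) (Fin m) ℝ) * Matrix.single i j 1)

/-- Multiplication by `Φ_j (g) = g_{n+1, j}` (the entries of the last row). -/
def mulPhi {n : ℕ} (j : Fin (n + 1)) (f : GL (Fin (n + 1)) ℝ → ℂ) : GL (Fin (n + 1)) ℝ → ℂ :=
  fun g => (((g : Matrix (Fin (n + 1)) (Fin (n + 1)) ℝ) (Fin.last n) j : ℝ) : ℂ) * f g

/-- The determinant of a square matrix of operators on functions `X → ℂ`, expanded such that in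
each term the factors come in the same order as the columns. -/
def opDet {X : Type*} {r : ℕ} (M : Matrix (Fin r) (Fin r) ((X → ℂ) → (X → ℂ))) :
    (X → ℂ) → (X → ℂ) :=
  ∑ σ : Equiv.Perm (Fin r),
    (Equiv.Perm.sign σ : ℤ) • (List.ofFn fun c => M (σ c) c).foldr (fun A F => A ∘ F) id

/-- The source operator `𝒟_{i+1}(λ)` (indices of `Fin` start at `0`): the determinant of the
matrix with first column `Φ_1, …, Φ_{i+1}`, with entry `λ_{i+1} - λ_c - 1` in row `c` and column
`c + 1`, and with entry `ε^{r,c}` in row `r` and column `c + 1` for `c < r` (`1`-based). -/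
def calD {n : ℕ} (i : Fin (n + 1)) (lam : Fin (n + 1) → ℂ) :
    (GL (Fin (n + 1)) ℝ → ℂ) → (GL (Fin (n + 1)) ℝ → ℂ) :=
  let emb : Fin (i + 1) → Fin (n + 1) := Fin.castLE i.isLt
  opDet (Matrix.of fun r c : Fin (i + 1) =>
    Fin.cases (motive := fun _ => (GL (Fin (n + 1)) ℝ → ℂ) → (GL (Fin (n + 1)) ℝ → ℂ))
      (mulPhi (emb r))
      (fun c' : Fin i =>
        if c'.castSucc < r then eps (emb r) (emb c'.castSucc)
        else if r = c'.castSucc then fun f => (lam i - lam (emb c'.castSucc) - 1) • f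
        else 0)
      c)

/-- The power `𝒟_i^α = 𝒟_i(λ - (α-1) e_i) ∘ ⋯ ∘ 𝒟_i(λ)`. -/
def calDPow {n : ℕ} (i : Fin (n + 1)) (lam : Fin (n + 1) → ℂ) :
    ℕ → (GL (Fin (n + 1)) ℝ → ℂ) → (GL (Fin (n + 1)) ℝ → ℂ)
  | 0 => id
  | α + 1 => calD i (lam - (α : ℂ) • Pi.single i 1) ∘ calDPow i lam α

end SymBreak

end

/-! Uniqueness. By `H`-equivariance an operator `T` in `DSBO` is determined by the functional `f ↦
(T f)(1)`, and by the support condition this functional sees only the germ of `f` at the base point.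
In the coordinates `(x, y, z)` of the big cell it becomes a functional `U` on smooth functions that
depends only on germs at the origin. The diagonal torus of `H` acts by the dilations `(sx, sty,
tz)`, and the conditions on `ν` and `η` say exactly that `U` has degree `n₂` in `s` and `n₁` in `t`;
hence only monomials `x^a y^b z^c` with `a + b = n₂` and `b + c = n₁` can matter. The upper
unipotent element sends `x` to `x + y` and `z` to `z / (1 + z)`, up to a multiplier in `z`; by
induction on `b` this propagates vanishing at `x^n₂ z^n₁` to all these monomials. So the space has
dimension at most one (`IsHomogeneous.eq_zero`, `DSBO_eq_zero`). Distributions supported at a point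
need not be classified: Hadamard's lemma, dilations with `t → 0` and boundedness of `U` on smooth
families suffice.

Existence. Restriction at `x₀` only involves matrices with last row `(1, 0, 0)`. There `𝒟₂` is
`ε^{21}` and `𝒟₃` is `ε^{21} ε^{32} - λ_{3,2} ε^{31}`, and these derivatives are tangent to this
slice, so powers of the `𝒟ᵢ` become left-invariant operators. A restriction lies in the principal
series of `H` if the function is a torus weight vector of the right weight killed by `ε^{23}`
(`IsSingular.rest_mem`). Elements of the source are such singular vectors; `ε^{21}` and the
simplified `𝒟₃` preserve singularity, and a power `(ε^{32})^N` does so when `N` is one more than the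
weight difference. The integer `k₀` of the second case is chosen for that, and `ε_H^{21} ∘ rest₀ =
rest₀ ∘ ε^{32}` translates the result.

Basis. On a section equal to `x^n₂ z^n₁` near the base point the operators take products of
descending factorials as values at `1`. These are nonzero, so the operators span
(`exists_basis_DSBO`). -/

noncomputable section

namespace SymBreak

open Filter Topology

/-! ### Calculus on `GL m ℝ` -/

section Calculus

/-- Square matrices as a plain function space, with its canonical normed structure. -/
abbrev Mat (m : ℕ) : Type := Fin m → Fin m → ℝ

variable {m : ℕ}

/-- The entries of an invertible matrix. -/
def entries (g : GL (Fin m) ℝ) : Mat m := (g : Matrix (Fin m) (Fin m) ℝ)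

/-- The extension by zero of a function on `GL m ℝ`, as a function of the matrix entries. -/
def ext0 (f : GL (Fin m) ℝ → ℂ) : Mat m → ℂ := fun A => toMat f (Matrix.of A)

lemma ext0_entries (f : GL (Fin m) ℝ → ℂ) (g : GL (Fin m) ℝ) : ext0 f (entries g) = f g :=
  toMat_coe f g

lemma ext0_add (f f' : GL (Fin m) ℝ → ℂ) : ext0 (f + f') = ext0 f + ext0 f' := toMat_add f f'

lemma ext0_smul (c : ℂ) (f : GL (Fin m) ℝ → ℂ) : ext0 (c • f) = c • ext0 f := toMat_smul c f

lemma ext0_zero : ext0 (0 : GL (Fin m) ℝ → ℂ) = 0 := toMat_zero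

lemma isSmooth_iff {f : GL (Fin m) ℝ → ℂ} :
    IsSmooth f ↔ ∀ g, ContDiffAt ℝ ∞ (ext0 f) (entries g) := Iff.rfl

/-- Left multiplication by a matrix as a continuous linear map. -/
def mulLeftL (X : Matrix (Fin m) (Fin m) ℝ) : Mat m →L[ℝ] Mat m :=
  LinearMap.toContinuousLinearMap (E := Mat m) (F' := Mat m)
    { toFun := fun A => (X * Matrix.of A : Matrix (Fin m) (Fin m) ℝ)
      map_add' := fun A B => Matrix.mul_add X (Matrix.of A) (Matrix.of B)
      map_smul' := fun c A => Matrix.mul_smul X c (Matrix.of A) }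

/-- Right multiplication by a matrix as a continuous linear map. -/
def mulRightL (X : Matrix (Fin m) (Fin m) ℝ) : Mat m →L[ℝ] Mat m :=
  LinearMap.toContinuousLinearMap (E := Mat m) (F' := Mat m)
    { toFun := fun A => (Matrix.of A * X : Matrix (Fin m) (Fin m) ℝ)
      map_add' := fun A B => Matrix.add_mul (Matrix.of A) (Matrix.of B) X
      map_smul' := fun c A => Matrix.smul_mul c (Matrix.of A) X }

lemma mulRightL_mulRightL (X Y : Matrix (Fin m) (Fin m) ℝ) (A : Mat m) :
    mulRightL X (mulRightL Y A) = mulRightL (Y * X) A := Matrix.mul_assoc (Matrix.of A) Y X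

lemma mulRightL_mulLeftL (X Y : Matrix (Fin m) (Fin m) ℝ) (A : Mat m) :
    mulRightL X (mulLeftL Y A) = mulLeftL Y (mulRightL X A) := Matrix.mul_assoc Y (Matrix.of A) X

lemma mulLeftL_entries (h g : GL (Fin m) ℝ) : mulLeftL h (entries g) = entries (h * g) := rfl

lemma mulRightL_entries (h g : GL (Fin m) ℝ) : mulRightL h (entries g) = entries (g * h) := rfl

lemma mulRightL_smul (c : ℝ) (X : Matrix (Fin m) (Fin m) ℝ) (A : Mat m) :
    mulRightL (c • X) A = c • mulRightL X A := Matrix.mul_smul (Matrix.of A) c X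

lemma mulRightL_add (X Y : Matrix (Fin m) (Fin m) ℝ) (A : Mat m) :
    mulRightL (X + Y) A = mulRightL X A + mulRightL Y A := Matrix.mul_add (Matrix.of A) X Y

lemma mulRightL_one (A : Mat m) : mulRightL 1 A = A := Matrix.mul_one (Matrix.of A)

lemma mulRightL_zero (A : Mat m) : mulRightL 0 A = 0 := Matrix.mul_zero (Matrix.of A)

lemma eps_apply (i j : Fin m) (f : GL (Fin m) ℝ → ℂ) (g : GL (Fin m) ℝ) :
    eps i j f g = fderiv ℝ (ext0 f) (entries g) (mulRightL (Matrix.single i j 1) (entries g)) :=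
  rfl

/-- The topology on units also records the inverse, so the embedding property needs continuity of
inversion where `det ≠ 0`; this comes from the adjugate formula. -/
lemma isOpenEmbedding_entries : IsOpenEmbedding (entries : GL (Fin m) ℝ → Mat m) := by
  have hset : {A : Matrix (Fin m) (Fin m) ℝ | IsUnit A} = {A | A.det ≠ 0} := by
    ext A
    simp [Matrix.isUnit_iff_isUnit_det]
  have hdet : Continuous fun A : Matrix (Fin m) (Fin m) ℝ => A.det := continuous_id.matrix_det
  have key : IsOpenEmbedding (Units.val : GL (Fin m) ℝ → Matrix (Fin m) (Fin m) ℝ) := by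
    refine ⟨Units.isEmbedding_val_mk' (f := fun A => A⁻¹) ?_
      fun u => (Matrix.coe_units_inv u).symm, ?_⟩
    · rw [hset]
      have : ∀ A : Matrix (Fin m) (Fin m) ℝ, A⁻¹ = (A.det)⁻¹ • A.adjugate := fun A => by
        rw [Matrix.inv_def, Ring.inverse_eq_inv']
      simp only [this]
      exact (hdet.continuousOn.inv₀ fun A hA => hA).smul
        (continuous_id.matrix_adjugate).continuousOn
    · have : Set.range (Units.val : GL (Fin m) ℝ → Matrix (Fin m) (Fin m) ℝ) =
          {A | IsUnit A} := rfl
      rw [this, hset]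
      exact isOpen_ne_fun hdet continuous_const
  exact key

lemma continuous_entries : Continuous (entries : GL (Fin m) ℝ → Mat m) :=
  isOpenEmbedding_entries.continuous

lemma eventually_nhds_entries {g : GL (Fin m) ℝ} {p : Mat m → Prop} :
    (∀ᶠ A in 𝓝 (entries g), p A) ↔ ∀ᶠ g' in 𝓝 g, p (entries g') := by
  rw [← isOpenEmbedding_entries.map_nhds_eq g, eventually_map]

lemma ext0_eventuallyEq {f f' : GL (Fin m) ℝ → ℂ} {g : GL (Fin m) ℝ} (h : f =ᶠ[𝓝 g] f') :
    ext0 f =ᶠ[𝓝 (entries g)] ext0 f' := by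
  have : ∀ᶠ A in 𝓝 (entries g), ext0 f A = ext0 f' A := by
    refine eventually_nhds_entries.2 ?_
    refine Eventually.mono h fun g' hg' => ?_
    rw [ext0_entries, ext0_entries, hg']
  exact this

lemma IsSmooth.contDiffAt {f : GL (Fin m) ℝ → ℂ} (hf : IsSmooth f) (g : GL (Fin m) ℝ) :
    ContDiffAt ℝ ∞ (ext0 f) (entries g) := hf g

lemma IsSmooth.differentiableAt {f : GL (Fin m) ℝ → ℂ} (hf : IsSmooth f) (g : GL (Fin m) ℝ) :
    DifferentiableAt ℝ (ext0 f) (entries g) :=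
  (hf.contDiffAt g).differentiableAt (by simp)

lemma IsSmooth.add {f f' : GL (Fin m) ℝ → ℂ} (hf : IsSmooth f) (hf' : IsSmooth f') :
    IsSmooth (f + f') := isSmooth_iff.2 fun g => by
  rw [ext0_add]
  exact (hf.contDiffAt g).add (hf'.contDiffAt g)

lemma IsSmooth.smul {f : GL (Fin m) ℝ → ℂ} (c : ℂ) (hf : IsSmooth f) : IsSmooth (c • f) :=
  isSmooth_iff.2 fun g => by
  rw [ext0_smul]
  exact (hf.contDiffAt g).const_smul c

lemma IsSmooth.sub {f f' : GL (Fin m) ℝ → ℂ} (hf : IsSmooth f) (hf' : IsSmooth f') :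
    IsSmooth (f - f') := by
  have := hf.add (hf'.smul (-1))
  rwa [neg_one_smul, ← sub_eq_add_neg] at this

lemma ext0_eps_eventuallyEq (i j : Fin m) (f : GL (Fin m) ℝ → ℂ) (g : GL (Fin m) ℝ) :
    ext0 (eps i j f) =ᶠ[𝓝 (entries g)]
      fun A => fderiv ℝ (ext0 f) A (mulRightL (Matrix.single i j 1) A) := by
  have : ∀ᶠ A in 𝓝 (entries g), ext0 (eps i j f) A =
      fderiv ℝ (ext0 f) A (mulRightL (Matrix.single i j 1) A) := by
    refine eventually_nhds_entries.2 (Eventually.of_forall fun g' => ?_)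
    rw [ext0_entries, eps_apply]
  exact this

lemma IsSmooth.contDiffAt_fderiv {f : GL (Fin m) ℝ → ℂ} (hf : IsSmooth f) (g : GL (Fin m) ℝ) :
    ContDiffAt ℝ ∞ (fderiv ℝ (ext0 f)) (entries g) :=
  (hf.contDiffAt g).fderiv_right (by simp)

lemma IsSmooth.eps {f : GL (Fin m) ℝ → ℂ} (hf : IsSmooth f) (i j : Fin m) :
    IsSmooth (SymBreak.eps i j f) := isSmooth_iff.2 fun g => by
  refine ContDiffAt.congr_of_eventuallyEq ?_ (ext0_eps_eventuallyEq i j f g)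
  exact (hf.contDiffAt_fderiv g).clm_apply (mulRightL _).contDiff.contDiffAt

lemma eps_add {f f' : GL (Fin m) ℝ → ℂ} (hf : IsSmooth f) (hf' : IsSmooth f') (i j : Fin m) :
    eps i j (f + f') = eps i j f + eps i j f' := by
  funext g
  simp only [eps_apply, ext0_add, Pi.add_apply]
  rw [fderiv_add (hf.differentiableAt g) (hf'.differentiableAt g)]
  rfl

lemma eps_smul {f : GL (Fin m) ℝ → ℂ} (hf : IsSmooth f) (c : ℂ) (i j : Fin m) :
    eps i j (c • f) = c • eps i j f := by
  funext g
  simp only [eps_apply, ext0_smul, Pi.smul_apply]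
  rw [fderiv_const_smul (hf.differentiableAt g)]
  rfl

lemma eps_zero (i j : Fin m) : eps i j (0 : GL (Fin m) ℝ → ℂ) = 0 := by
  funext g
  simp [eps_apply, ext0_zero]

lemma ext0_translate (h : GL (Fin m) ℝ) (f : GL (Fin m) ℝ → ℂ) :
    ext0 (fun g => f (h * g)) = ext0 f ∘ mulLeftL h := toMat_translate h f

lemma eps_translate {f : GL (Fin m) ℝ → ℂ} (hf : IsSmooth f) (h : GL (Fin m) ℝ) (i j : Fin m) :
    eps i j (fun g => f (h * g)) = fun g => eps i j f (h * g) := by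
  funext g
  have h1 : HasFDerivAt (ext0 f) (fderiv ℝ (ext0 f) (entries (h * g)))
      (mulLeftL h (entries g)) := (hf.differentiableAt (h * g)).hasFDerivAt
  have h2 := h1.comp (entries g) (mulLeftL (h : Matrix (Fin m) (Fin m) ℝ)).hasFDerivAt
  rw [eps_apply, eps_apply, ext0_translate, h2.fderiv, ← mulLeftL_entries, mulRightL_mulLeftL]
  rfl

lemma eps_congr {f f' : GL (Fin m) ℝ → ℂ} {g : GL (Fin m) ℝ} (h : f =ᶠ[𝓝 g] f') (i j : Fin m) :
    eps i j f g = eps i j f' g := by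
  simp only [eps_apply, (ext0_eventuallyEq h).fderiv_eq]

lemma eps_eventuallyEq {f f' : GL (Fin m) ℝ → ℂ} {g : GL (Fin m) ℝ} (h : f =ᶠ[𝓝 g] f')
    (i j : Fin m) : eps i j f =ᶠ[𝓝 g] eps i j f' :=
  (eventually_eventually_nhds.2 h).mono fun _ hg' => eps_congr hg' i j

/-- The derivative of `f` along a curve in `GL m ℝ`. -/
lemma IsSmooth.hasDerivAt_comp {f : GL (Fin m) ℝ → ℂ} (hf : IsSmooth f) {g : GL (Fin m) ℝ}
    {c : ℝ → Mat m} {X : Mat m} {t : ℝ} (hct : c t = entries g) (hc : HasDerivAt c X t) :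
    HasDerivAt (fun s => ext0 f (c s)) (fderiv ℝ (ext0 f) (entries g) X) t := by
  have h1 := (hf.differentiableAt g).hasFDerivAt
  rw [← hct] at h1 ⊢
  exact h1.comp_hasDerivAt t hc

lemma hasDerivAt_mulRightL (A : Mat m) (X : Matrix (Fin m) (Fin m) ℝ) (t : ℝ) :
    HasDerivAt (fun s : ℝ => mulRightL (1 + s • X) A) (mulRightL X A) t := by
  simp only [mulRightL_add, mulRightL_smul, mulRightL_one]
  simpa using ((hasDerivAt_id t).smul_const (mulRightL X A)).const_add A

lemma eps_eps {f : GL (Fin m) ℝ → ℂ} (hf : IsSmooth f) (i j k l : Fin m) (g : GL (Fin m) ℝ) :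
    eps i j (eps k l f) g =
      fderiv ℝ (fderiv ℝ (ext0 f)) (entries g)
        (mulRightL (Matrix.single i j 1) (entries g))
        (mulRightL (Matrix.single k l 1) (entries g)) +
      fderiv ℝ (ext0 f) (entries g)
        (mulRightL (Matrix.single i j 1 * Matrix.single k l 1) (entries g)) := by
  have h1 : HasFDerivAt (fderiv ℝ (ext0 f)) _ (entries g) :=
    ((hf.contDiffAt_fderiv g).differentiableAt (by simp)).hasFDerivAt
  have h2 := h1.clm_apply (mulRightL (Matrix.single k l (1 : ℝ))).hasFDerivAt
  rw [eps_apply, (ext0_eps_eventuallyEq k l f g).fderiv_eq, h2.fderiv]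
  simp [add_comm, mulRightL_mulRightL]

/-- The commutation relations of the right regular action of matrix units. -/
lemma eps_comm {f : GL (Fin m) ℝ → ℂ} (hf : IsSmooth f) (i j k l : Fin m) :
    eps i j (eps k l f) = eps k l (eps i j f) + (if j = k then eps i l f else 0) -
      (if l = i then eps k j f else 0) := by
  funext g
  -- Symmetry of the second derivative cancels the second-order parts of `eps_eps`; the remaining
  -- first-order parts form the commutator of the matrix units.
  have hs : IsSymmSndFDerivAt ℝ (ext0 f) (entries g) :=
    (hf.contDiffAt g).isSymmSndFDerivAt (by simp; exact WithTop.coe_le_coe.2 le_top)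
  have e : ∀ (a b c d : Fin m), fderiv ℝ (ext0 f) (entries g)
      (mulRightL (Matrix.single a b 1 * Matrix.single c d 1) (entries g)) =
      (if b = c then eps a d f else 0) g := by
    intro a b c d
    split_ifs with h
    · subst h
      simp [eps_apply]
    · simp [Matrix.single_mul_single_of_ne _ _ _ _ h, mulRightL_zero]
  simp only [Pi.add_apply, Pi.sub_apply, eps_eps hf, e]
  rw [hs.eq]
  ring

end Calculus

/-! ### Derivatives along affine maps -/

/-- The map is a linear map followed by a translation. Since `f` is smooth only near one point, the
chain rule for the linear part is applied within an open set on which `f` is `C^j`. -/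
lemma norm_iteratedFDeriv_comp_affine_le {E F G : Type*} [NormedAddCommGroup E] [NormedSpace ℝ E]
    [NormedAddCommGroup F] [NormedSpace ℝ F] [NormedAddCommGroup G] [NormedSpace ℝ G]
    {f : F → G} (l : E →L[ℝ] F) (c : F) {x : E} (hf : ContDiffAt ℝ ∞ f (l x + c)) (j : ℕ) :
    ‖iteratedFDeriv ℝ j (fun y => f (l y + c)) x‖ ≤
      ‖iteratedFDeriv ℝ j f (l x + c)‖ * ‖l‖ ^ j := by
  have hj : ContDiffAt ℝ j f (l x + c) := hf.of_le (by exact_mod_cast le_top)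
  obtain ⟨s, hs, hso, hxs⟩ := _root_.eventually_nhds_iff.1 (hj.eventually (by simp))
  have hso' : IsOpen ((fun y => y + c) ⁻¹' s) := hso.preimage (continuous_id.add continuous_const)
  have hlo : IsOpen (l ⁻¹' ((fun y => y + c) ⁻¹' s)) := hso'.preimage l.continuous
  have hfc : ContDiffOn ℝ j (fun y => f (y + c)) ((fun y => y + c) ⁻¹' s) := fun y hy =>
    ((hs (y + c) hy).comp y (contDiff_id.add contDiff_const).contDiffAt).contDiffWithinAt
  have key := l.iteratedFDerivWithin_comp_right hfc hso'.uniqueDiffOn hlo.uniqueDiffOn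
    (x := x) hxs (i := j) le_rfl
  rw [iteratedFDerivWithin_of_isOpen j hso' hxs, iteratedFDerivWithin_of_isOpen j hlo hxs,
    iteratedFDeriv_comp_add_right] at key
  have e : (fun y => f (l y + c)) = (fun y => f (y + c)) ∘ l := rfl
  rw [e, key]
  refine (ContinuousMultilinearMap.norm_compContinuousLinearMap_le _ _).trans ?_
  simp

/-! ### Left-invariant differential operators -/

section InvDiffOp

variable {m : ℕ}

/-- `f` and its derivatives up to order `N` are bounded by `B` on `L`. -/
def BoundedBy (f : GL (Fin m) ℝ → ℂ) (L : Set (GL (Fin m) ℝ)) (N : ℕ) (B : ℝ) : Prop :=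
  ∀ j ≤ N, ∀ g ∈ L, ‖iteratedFDeriv ℝ j (ext0 f) (entries g)‖ ≤ B

lemma BoundedBy.mono {f : GL (Fin m) ℝ → ℂ} {L : Set (GL (Fin m) ℝ)} {N N' : ℕ} {B B' : ℝ}
    (h : BoundedBy f L N B) (hN : N' ≤ N) (hB : B ≤ B') : BoundedBy f L N' B' :=
  fun j hj g hg => (h j (hj.trans hN) g hg).trans hB

lemma BoundedBy.add {f f' : GL (Fin m) ℝ → ℂ} {L : Set (GL (Fin m) ℝ)} {N : ℕ} {B B' : ℝ}
    (hf : IsSmooth f) (hf' : IsSmooth f') (h : BoundedBy f L N B) (h' : BoundedBy f' L N B') :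
    BoundedBy (f + f') L N (B + B') := fun j hj g hg => by
  rw [ext0_add, iteratedFDeriv_add_apply ((hf.contDiffAt g).of_le (by exact_mod_cast le_top))
    ((hf'.contDiffAt g).of_le (by exact_mod_cast le_top))]
  exact (norm_add_le _ _).trans (add_le_add (h j hj g hg) (h' j hj g hg))

lemma BoundedBy.smul {f : GL (Fin m) ℝ → ℂ} {L : Set (GL (Fin m) ℝ)} {N : ℕ} {B : ℝ}
    (hf : IsSmooth f) (h : BoundedBy f L N B) (c : ℂ) : BoundedBy (c • f) L N (‖c‖ * B) :=
  fun j hj g hg => by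
  rw [ext0_smul, iteratedFDeriv_const_smul_apply
    ((hf.contDiffAt g).of_le (by exact_mod_cast le_top)), norm_smul]
  exact mul_le_mul_of_nonneg_left (h j hj g hg) (norm_nonneg _)

/-- Operators on smooth functions on `GL m ℝ` which are linear, local, left-invariant, and continuous
for uniform convergence of derivatives on compact sets. -/
structure IsInvDiffOp (D : (GL (Fin m) ℝ → ℂ) → GL (Fin m) ℝ → ℂ) : Prop where
  smooth : ∀ {f}, IsSmooth f → IsSmooth (D f)
  add : ∀ {f f'}, IsSmooth f → IsSmooth f' → D (f + f') = D f + D f'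
  smul : ∀ {f} (c : ℂ), IsSmooth f → D (c • f) = c • D f
  translate : ∀ {f} (h : GL (Fin m) ℝ), IsSmooth f →
    D (fun g => f (h * g)) = fun g => D f (h * g)
  congr : ∀ {f f' : GL (Fin m) ℝ → ℂ} {g : GL (Fin m) ℝ}, f =ᶠ[𝓝 g] f' → D f =ᶠ[𝓝 g] D f'
  bound : ∀ L : Set (GL (Fin m) ℝ), IsCompact L → ∀ n : ℕ, ∃ N : ℕ, ∃ C : ℝ, 0 ≤ C ∧
    ∀ f, IsSmooth f → ∀ B, 0 ≤ B → BoundedBy f L N B → BoundedBy (D f) L n (C * B)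

namespace IsInvDiffOp

variable {D D' : (GL (Fin m) ℝ → ℂ) → GL (Fin m) ℝ → ℂ}

protected lemma id : IsInvDiffOp (id : (GL (Fin m) ℝ → ℂ) → GL (Fin m) ℝ → ℂ) where
  smooth h := h
  add _ _ := rfl
  smul _ _ := rfl
  translate _ _ := rfl
  congr h := h
  bound L _ n := ⟨n, 1, zero_le_one, fun f _ B _ h => by simpa using h⟩

protected lemma comp (h : IsInvDiffOp D) (h' : IsInvDiffOp D') : IsInvDiffOp (D ∘ D') where
  smooth hf := h.smooth (h'.smooth hf)
  add hf hf' := by simp only [Function.comp_apply, h'.add hf hf', h.add (h'.smooth hf) (h'.smooth hf')]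
  smul c hf := by simp only [Function.comp_apply, h'.smul c hf, h.smul c (h'.smooth hf)]
  translate x hf := by
    simp only [Function.comp_apply, h'.translate x hf, h.translate x (h'.smooth hf)]
  congr hf := h.congr (h'.congr hf)
  bound L hL n := by
    obtain ⟨N, C, hC, hb⟩ := h.bound L hL n
    obtain ⟨N', C', hC', hb'⟩ := h'.bound L hL N
    refine ⟨N', C * C', mul_nonneg hC hC', fun f hf B hB hfB => ?_⟩
    rw [mul_assoc]
    exact hb _ (h'.smooth hf) _ (mul_nonneg hC' hB) (hb' f hf B hB hfB)

protected lemma iterate (h : IsInvDiffOp D) (n : ℕ) : IsInvDiffOp D^[n] := by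
  induction n with
  | zero => exact IsInvDiffOp.id
  | succ n ih => exact ih.comp h

protected lemma sub_smul (h : IsInvDiffOp D) (h' : IsInvDiffOp D') (c : ℂ) :
    IsInvDiffOp (fun f => D f - c • D' f) where
  smooth hf := (h.smooth hf).sub ((h'.smooth hf).smul c)
  add hf hf' := by rw [h.add hf hf', h'.add hf hf', smul_add]; abel
  smul a hf := by rw [h.smul a hf, h'.smul a hf, smul_sub, smul_comm]
  translate x hf := by rw [h.translate x hf, h'.translate x hf]; rfl
  congr hf := (h.congr hf).sub ((h'.congr hf).const_smul c)
  bound L hL n := by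
    obtain ⟨N, C, hC, hb⟩ := h.bound L hL n
    obtain ⟨N', C', hC', hb'⟩ := h'.bound L hL n
    refine ⟨max N N', C + ‖-c‖ * C', by positivity, fun f hf B hB hfB => ?_⟩
    have h1 := hb f hf B hB (hfB.mono (le_max_left _ _) le_rfl)
    have h2 := hb' f hf B hB (hfB.mono (le_max_right _ _) le_rfl)
    have := h1.add (h.smooth hf) ((h'.smooth hf).smul (-c)) (h2.smul (h'.smooth hf) (-c))
    rw [neg_smul, ← sub_eq_add_neg] at this
    refine this.mono le_rfl (le_of_eq ?_)
    ring

protected lemma eps (i j : Fin m) : IsInvDiffOp (SymBreak.eps i j) where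
  smooth hf := hf.eps i j
  add hf hf' := eps_add hf hf' i j
  smul c hf := eps_smul hf c i j
  translate h hf := eps_translate hf h i j
  congr h := eps_eventuallyEq h i j
  bound L hL n := by
    set l : Mat m →L[ℝ] Mat m := mulRightL (Matrix.single i j (1 : ℝ)) with hl
    have hK : IsCompact (entries '' L) := hL.image continuous_entries
    have hb : ∀ k : ℕ, ∃ C : ℝ, ∀ A ∈ entries '' L, ‖iteratedFDeriv ℝ k l A‖ ≤ C := fun k =>
      hK.exists_bound_of_continuousOn
        (l.contDiff.continuous_iteratedFDeriv (m := k) (n := ⊤) le_top).continuousOn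
    choose C hC using hb
    have hCk : ∀ k ≤ n, ∀ A ∈ entries '' L,
        ‖iteratedFDeriv ℝ k l A‖ ≤ ∑ k ∈ Finset.range (n + 1), |C k| := fun k hk A hA =>
      ((hC k A hA).trans (le_abs_self _)).trans
        (Finset.single_le_sum (f := fun k => |C k|) (fun _ _ => abs_nonneg _)
          (Finset.mem_range_succ_iff.2 hk))
    set C₀ := ∑ k ∈ Finset.range (n + 1), |C k| with hC₀
    have hC₀' : 0 ≤ C₀ := Finset.sum_nonneg fun _ _ => abs_nonneg _
    -- One derivative is lost to `ε`. By the Leibniz rule for `fderiv f` applied to the linear map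
    -- `l`, with `C₀` bounding the derivatives of `l` on `L`, the binomial coefficients add up to at
    -- most `2 ^ n`.
    refine ⟨n + 1, 2 ^ n * C₀, by positivity, fun f hf B hB hfB r hr g hg => ?_⟩
    have ho : IsOpen (Set.range (entries : GL (Fin m) ℝ → Mat m)) :=
      isOpenEmbedding_entries.isOpen_range
    have hgr : entries g ∈ Set.range (entries : GL (Fin m) ℝ → Mat m) := ⟨g, rfl⟩
    have h1 : ContDiffOn ℝ ∞ (fderiv ℝ (ext0 f)) (Set.range entries) := by
      rintro _ ⟨g', rfl⟩
      exact (hf.contDiffAt_fderiv g').contDiffWithinAt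
    have h2 : ContDiffOn ℝ ∞ l (Set.range entries) := l.contDiff.contDiffOn
    rw [(ext0_eps_eventuallyEq i j f g).iteratedFDeriv ℝ r |>.eq_of_nhds, ← hl]
    have key := norm_iteratedFDerivWithin_clm_apply h1 h2 ho.uniqueDiffOn hgr (n := r)
      (by exact_mod_cast le_top)
    simp only [iteratedFDerivWithin_of_isOpen _ ho hgr] at key
    refine key.trans ?_
    calc ∑ i ∈ Finset.range (r + 1), (r.choose i : ℝ) *
          ‖iteratedFDeriv ℝ i (fderiv ℝ (ext0 f)) (entries g)‖ *
          ‖iteratedFDeriv ℝ (r - i) l (entries g)‖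
        ≤ ∑ i ∈ Finset.range (r + 1), (r.choose i : ℝ) * B * C₀ := by
          refine Finset.sum_le_sum fun i hi => ?_
          rw [Finset.mem_range_succ_iff] at hi
          have e1 := hfB (i + 1) (by omega) g hg
          rw [← norm_iteratedFDeriv_fderiv] at e1
          have e2 := hCk (r - i) (by omega) (entries g) ⟨g, hg, rfl⟩
          gcongr
      _ = 2 ^ r * (C₀ * B) := by
          rw [← Finset.sum_mul, ← Finset.sum_mul]
          have : ∑ i ∈ Finset.range (r + 1), (r.choose i : ℝ) = 2 ^ r := by
            exact_mod_cast Nat.sum_range_choose r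
          rw [this]
          ring
      _ ≤ 2 ^ n * (C₀ * B) := by
          gcongr
          norm_num
      _ = 2 ^ n * C₀ * B := by ring

end IsInvDiffOp

end InvDiffOp

/-! ### Restriction -/

section Restriction

variable {n : ℕ}

/-- Linear part of the affine map `h ↦ diag(h, 1) x_k` on matrix entries. -/
def restL (k : Fin (n + 1)) : Mat n →L[ℝ] Mat (n + 1) :=
  (mulRightL (basePoint k : Matrix (Fin (n + 1)) (Fin (n + 1)) ℝ)).comp <|
    LinearMap.toContinuousLinearMap (E := Mat n) (F' := Mat (n + 1))
    { toFun := fun A => Matrix.reindex finSumFinEquiv finSumFinEquiv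
        (Matrix.fromBlocks (Matrix.of A) 0 0 (0 : Matrix (Fin 1) (Fin 1) ℝ))
      map_add' := fun A B => by
        have : (Matrix.fromBlocks (Matrix.of (A + B)) 0 0 0 : Matrix (Fin n ⊕ Fin 1) (Fin n ⊕ Fin 1) ℝ) =
            Matrix.fromBlocks (Matrix.of A) 0 0 0 + Matrix.fromBlocks (Matrix.of B) 0 0 0 := by
          rw [Matrix.fromBlocks_add]; simp
        rw [this]
        rfl
      map_smul' := fun c A => by
        have : (Matrix.fromBlocks (Matrix.of (c • A)) 0 0 0 : Matrix (Fin n ⊕ Fin 1) (Fin n ⊕ Fin 1) ℝ) =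
            c • Matrix.fromBlocks (Matrix.of A) 0 0 0 := by
          rw [Matrix.fromBlocks_smul]; simp
        rw [this]
        rfl }

/-- Constant part of the affine map `h ↦ diag(h, 1) x_k` on matrix entries. -/
def restC (k : Fin (n + 1)) : Mat (n + 1) :=
  mulRightL (basePoint k : Matrix (Fin (n + 1)) (Fin (n + 1)) ℝ)
    (Matrix.reindex finSumFinEquiv finSumFinEquiv
      (Matrix.fromBlocks (0 : Matrix (Fin n) (Fin n) ℝ) 0 0 (1 : Matrix (Fin 1) (Fin 1) ℝ)) :
      Matrix (Fin (n + 1)) (Fin (n + 1)) ℝ)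

lemma restL_add_restC (k : Fin (n + 1)) (h : GL (Fin n) ℝ) :
    restL k (entries h) + restC k = entries (embed n h * basePoint k) := by
  refine ((mulRightL (basePoint k : Matrix (Fin (n + 1)) (Fin (n + 1)) ℝ)).map_add _ _).symm.trans
    (congrArg (mulRightL (basePoint k : Matrix (Fin (n + 1)) (Fin (n + 1)) ℝ)) ?_)
  have : (Matrix.fromBlocks (h : Matrix (Fin n) (Fin n) ℝ) 0 0 1 : Matrix (Fin n ⊕ Fin 1) (Fin n ⊕ Fin 1) ℝ) =
      Matrix.fromBlocks (h : Matrix (Fin n) (Fin n) ℝ) 0 0 0 + Matrix.fromBlocks 0 0 0 1 := by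
    rw [Matrix.fromBlocks_add]; simp
  exact (congrArg (Matrix.reindex finSumFinEquiv finSumFinEquiv) this).symm

lemma continuous_embed_mul (k : Fin (n + 1)) :
    Continuous fun h : GL (Fin n) ℝ => embed n h * basePoint k := by
  refine isOpenEmbedding_entries.isInducing.continuous_iff.2 ?_
  have : (entries ∘ fun h : GL (Fin n) ℝ => embed n h * basePoint k) =
      fun h => restL k (entries h) + restC k := by
    funext h
    exact (restL_add_restC k h).symm
  rw [this]
  exact ((restL k).continuous.comp continuous_entries).add continuous_const

lemma ext0_rest_eventuallyEq (k : Fin (n + 1)) (f : GL (Fin (n + 1)) ℝ → ℂ) (h : GL (Fin n) ℝ) :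
    ext0 (rest k f) =ᶠ[𝓝 (entries h)] fun A => ext0 f (restL k A + restC k) := by
  have : ∀ᶠ A in 𝓝 (entries h), ext0 (rest k f) A = ext0 f (restL k A + restC k) := by
    refine eventually_nhds_entries.2 (Eventually.of_forall fun h' => ?_)
    rw [ext0_entries, restL_add_restC, ext0_entries]
    rfl
  exact this

lemma IsSmooth.rest {f : GL (Fin (n + 1)) ℝ → ℂ} (hf : IsSmooth f) (k : Fin (n + 1)) :
    IsSmooth (SymBreak.rest k f) := isSmooth_iff.2 fun h => by
  refine ContDiffAt.congr_of_eventuallyEq ?_ (ext0_rest_eventuallyEq k f h)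
  have h1 := hf.contDiffAt (embed n h * basePoint k)
  rw [← restL_add_restC] at h1
  have h2 : ContDiff ℝ ∞ fun A => restL k A + restC k := (restL k).contDiff.add contDiff_const
  exact ContDiffAt.comp (F := Mat (n + 1)) (g := ext0 f) (entries h) h1 h2.contDiffAt

lemma rest_bound (k : Fin (n + 1)) (N : ℕ) : ∃ C : ℝ, 0 ≤ C ∧
    ∀ f, IsSmooth f → ∀ (L : Set (GL (Fin n) ℝ)) (B : ℝ), 0 ≤ B →
      BoundedBy f ((fun h => embed n h * basePoint k) '' L) N B →
      BoundedBy (rest k f) L N (C * B) := by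
  -- Adding `1` to the norm makes a single power dominate `‖restL k‖ ^ j` for all `j ≤ N`.
  refine ⟨(1 + ‖restL k‖) ^ N, by positivity, fun f hf L B hB hfB j hj h hh => ?_⟩
  rw [(ext0_rest_eventuallyEq k f h).iteratedFDeriv ℝ j |>.eq_of_nhds]
  have h1 := hf.contDiffAt (embed n h * basePoint k)
  rw [← restL_add_restC] at h1
  refine (norm_iteratedFDeriv_comp_affine_le (restL k) (restC k) h1 j).trans ?_
  have h2 := hfB j hj _ ⟨h, hh, rfl⟩
  rw [← restL_add_restC] at h2
  rw [mul_comm]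
  have h3 : ‖restL k‖ ^ j ≤ (1 + ‖restL k‖) ^ N :=
    (pow_le_pow_left₀ (norm_nonneg _) (by linarith) j).trans
      (pow_le_pow_right₀ (by linarith [norm_nonneg (restL k)]) hj)
  exact mul_le_mul h3 h2 (norm_nonneg _) (by positivity)

lemma continuous_flagMap (k : Fin (n + 1)) : Continuous (flagMap k : GL (Fin n) ℝ ⧸ borel n → _) :=
  continuous_quot_lift _ (QuotientGroup.continuous_mk.comp (continuous_embed_mul k))

/-- A left-invariant differential operator followed by restriction is a differential symmetry breaking
operator as soon as it maps one principal series into the other. -/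
lemma exists_mem_DSBO {D : (GL (Fin (n + 1)) ℝ → ℂ) → GL (Fin (n + 1)) ℝ → ℂ} (hD : IsInvDiffOp D)
    (k : Fin (n + 1)) {ξ : Fin (n + 1) → ZMod 2} {lam : Fin (n + 1) → ℂ} {η : Fin n → ZMod 2}
    {ν : Fin n → ℂ}
    (hmem : ∀ f ∈ principalSeries ξ lam, rest k (D f) ∈ principalSeries η ν) :
    ∃ T : DSBO k ξ lam η ν, ∀ f, (T.1 f).1 = rest k (D f.1) := by
  let T : principalSeries ξ lam →ₗ[ℂ] principalSeries η ν :=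
    { toFun := fun f => ⟨rest k (D f.1), hmem f.1 f.2⟩
      map_add' := fun f f' => Subtype.ext (by
        change rest k (D (f.1 + f'.1)) = rest k (D f.1) + rest k (D f'.1)
        rw [hD.add f.2.1 f'.2.1]; rfl)
      map_smul' := fun c f => Subtype.ext (by
        change rest k (D (c • f.1)) = c • rest k (D f.1)
        rw [hD.smul c f.2.1]; rfl) }
  refine ⟨⟨T, ?_, ?_, ?_⟩, fun f => rfl⟩
  · intro L hL r
    have hK := hL.image (continuous_embed_mul k)
    obtain ⟨C, hC, hb⟩ := rest_bound k r
    obtain ⟨N, C', hC', hb'⟩ := hD.bound _ hK r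
    refine ⟨_, hK, N, C * C', mul_nonneg hC hC', fun f B hB hfB h hh => ?_⟩
    rw [mul_assoc]
    exact hb _ (hD.smooth f.2.1) L _ (mul_nonneg hC' hB) (hb' f.1 f.2.1 B hB hfB) r le_rfl h hh
  · intro h f
    apply Subtype.ext
    change rest k (D fun g => f.1 ((embed n h)⁻¹ * g)) = fun g => rest k (D f.1) (h⁻¹ * g)
    rw [hD.translate _ f.2.1]
    funext g
    simp only [rest, map_mul, map_inv, mul_assoc]
  · intro f
    refine (image_closure_subset_closure_image (continuous_flagMap k)).trans ?_
    refine closure_minimal ?_ isClosed_closure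
    rintro _ ⟨_, ⟨h, hh, rfl⟩, rfl⟩
    have hcl : embed n h * basePoint k ∈ closure (Function.support f.1) := by
      by_contra hcon
      refine hh ?_
      rw [mem_closure_iff_frequently, Filter.not_frequently] at hcon
      -- The zero germ is written as `0 • f`, so that homogeneity of `D` on the smooth function `f`
      -- gives the value zero.
      have h0 : f.1 =ᶠ[𝓝 (embed n h * basePoint k)] (0 : ℂ) • f.1 := by
        refine Eventually.mono hcon fun g hg => ?_
        simpa using hg
      have := (hD.congr h0).eq_of_nhds
      rw [hD.smul 0 f.2.1] at this
      rw [zero_smul] at this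
      exact this
    exact image_closure_subset_closure_image QuotientGroup.continuous_mk
      (Set.mem_image_of_mem _ hcl)

end Restriction

/-! ### The characters `|x|_ξ^s` -/

section SgnPow

lemma sgnPow_mul (ξ : ZMod 2) (s : ℂ) (x y : ℝ) :
    sgnPow ξ s (x * y) = sgnPow ξ s x * sgnPow ξ s y := by
  have h1 : Real.sign (x * y) = Real.sign x * Real.sign y := by
    rcases lt_trichotomy x 0 with hx | hx | hx <;> rcases lt_trichotomy y 0 with hy | hy | hy <;>
      simp [hx, hy, Real.sign_of_neg, Real.sign_of_pos, mul_pos_of_neg_of_neg, mul_neg_of_neg_of_pos,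
        mul_neg_of_pos_of_neg]
  have h2 : ((|x * y| : ℝ) : ℂ) ^ s = ((|x| : ℝ) : ℂ) ^ s * ((|y| : ℝ) : ℂ) ^ s := by
    rw [abs_mul, Complex.ofReal_mul, Complex.mul_cpow_ofReal_nonneg (abs_nonneg _) (abs_nonneg _)]
  simp only [sgnPow, h1, h2, Complex.ofReal_mul, mul_pow]
  ring

@[simp] lemma sgnPow_one (ξ : ZMod 2) (s : ℂ) : sgnPow ξ s 1 = 1 := by
  simp [sgnPow]

/-- Since `x = sgn(x) |x|`, shifting parity and exponent together costs a factor `x`. This is how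
matching parities turn quotients of characters into honest monomials. -/
lemma sgnPow_add_one (ξ : ZMod 2) (s : ℂ) {x : ℝ} (hx : x ≠ 0) :
    sgnPow (ξ + 1) (s + 1) x = x * sgnPow ξ s x := by
  have h0 : ((|x| : ℝ) : ℂ) ≠ 0 := by simpa using hx
  have h1 : ((|x| : ℝ) : ℂ) ^ (s + 1) = ((|x| : ℝ) : ℂ) ^ s * ((|x| : ℝ) : ℂ) := by
    rw [Complex.cpow_add _ _ h0, Complex.cpow_one]
  have h2 : ((Real.sign x : ℝ) : ℂ) * ((|x| : ℝ) : ℂ) = x := by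
    rw [← Complex.ofReal_mul, mul_comm]
    congr 1
    rcases lt_or_gt_of_ne hx with h | h
    · simp [Real.sign_of_neg h, abs_of_neg h]
    · simp [Real.sign_of_pos h, abs_of_pos h]
  have h3 : ((Real.sign x : ℝ) : ℂ) * ((Real.sign x : ℝ) : ℂ) = 1 := by
    rcases lt_or_gt_of_ne hx with h | h
    · simp [Real.sign_of_neg h]
    · simp [Real.sign_of_pos h]
  have h4 : ((Real.sign x : ℝ) : ℂ) ^ (ξ + 1).val =
      ((Real.sign x : ℝ) : ℂ) ^ ξ.val * ((Real.sign x : ℝ) : ℂ) := by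
    have : ξ = 0 ∨ ξ = 1 := by
      revert ξ
      decide
    rcases this with rfl | rfl
    · have e : ((0 : ZMod 2) + 1).val = 1 := rfl
      have e' : (0 : ZMod 2).val = 0 := rfl
      rw [e, e', pow_one, pow_zero, one_mul]
    · have e : ((1 : ZMod 2) + 1).val = 0 := rfl
      have e' : (1 : ZMod 2).val = 1 := rfl
      rw [e, e', pow_one, pow_zero, h3]
  simp only [sgnPow, h1, h4]
  rw [← h2]
  ring

lemma sgnPow_add_natCast (ξ : ZMod 2) (s : ℂ) (n : ℕ) {x : ℝ} (hx : x ≠ 0) :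
    sgnPow (ξ + n) (s + n) x = x ^ n * sgnPow ξ s x := by
  induction n with
  | zero => simp
  | succ n ih =>
    push_cast
    rw [← add_assoc, ← add_assoc, sgnPow_add_one _ _ hx, ih]
    ring

lemma sgnPow_sub_one (ξ : ZMod 2) (s : ℂ) {x : ℝ} (hx : x ≠ 0) :
    sgnPow (ξ - 1) (s - 1) x = (x : ℂ)⁻¹ * sgnPow ξ s x := by
  have h := sgnPow_add_one (ξ - 1) (s - 1) hx
  rw [sub_add_cancel, sub_add_cancel] at h
  rw [h, inv_mul_cancel_left₀ (by exact_mod_cast hx)]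

/-- The sign is locally constant and `Real.log` ignores it, so the calculus of these characters
reduces to that of `exp (s log y)`. -/
lemma sgnPow_eventuallyEq (ξ : ZMod 2) (s : ℂ) {x : ℝ} (hx : x ≠ 0) :
    sgnPow ξ s =ᶠ[𝓝 x] fun y => ((Real.sign x : ℝ) : ℂ) ^ ξ.val *
      Complex.exp (s * ((Real.log y : ℝ) : ℂ)) := by
  have h : ∀ᶠ y in 𝓝 x, 0 < y * x := by
    have : 0 < x * x := mul_self_pos.2 hx
    exact (continuous_id.mul continuous_const).continuousAt.eventually (lt_mem_nhds this)
  filter_upwards [h] with y hy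
  have hy0 : y ≠ 0 := by rintro rfl; simp at hy
  have h1 : Real.sign y = Real.sign x := by
    rcases pos_and_pos_or_neg_and_neg_of_mul_pos hy with ⟨h1, h2⟩ | ⟨h1, h2⟩
    · rw [Real.sign_of_pos h1, Real.sign_of_pos h2]
    · rw [Real.sign_of_neg h1, Real.sign_of_neg h2]
  have h0 : ((|y| : ℝ) : ℂ) ≠ 0 := by simpa using hy0
  rw [sgnPow, h1, Complex.cpow_def_of_ne_zero h0, ← Complex.ofReal_log (abs_nonneg _),
    Real.log_abs, mul_comm s]

lemma contDiffAt_sgnPow (ξ : ZMod 2) (s : ℂ) {x : ℝ} (hx : x ≠ 0) :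
    ContDiffAt ℝ ∞ (sgnPow ξ s) x := by
  refine ContDiffAt.congr_of_eventuallyEq ?_ (sgnPow_eventuallyEq ξ s hx)
  have h1 : ContDiffAt ℝ ∞ (fun y : ℝ => ((Real.log y : ℝ) : ℂ)) x :=
    Complex.ofRealCLM.contDiff.contDiffAt.comp x (Real.contDiffAt_log.2 hx)
  exact contDiffAt_const.mul (contDiffAt_const.mul h1).cexp

lemma hasDerivAt_sgnPow_one (ξ : ZMod 2) (s : ℂ) : HasDerivAt (sgnPow ξ s) s 1 := by
  refine HasDerivAt.congr_of_eventuallyEq ?_ (sgnPow_eventuallyEq ξ s one_ne_zero)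
  have h1 : HasDerivAt (fun y : ℝ => s * ((Real.log y : ℝ) : ℂ)) (s * ((1⁻¹ : ℝ) : ℂ)) 1 :=
    (Real.hasDerivAt_log one_ne_zero).ofReal_comp.const_mul s
  have h2 := (h1.cexp).const_mul (((Real.sign 1 : ℝ) : ℂ) ^ ξ.val)
  have h3 : ((Real.sign 1 : ℝ) : ℂ) ^ ξ.val * (Complex.exp (s * ((Real.log 1 : ℝ) : ℂ)) *
      (s * ((1⁻¹ : ℝ) : ℂ))) = s := by
    simp
  rwa [h3] at h2

end SgnPow

/-! ### One-parameter subgroups -/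

section OneParameter

variable {m : ℕ}

/-- The elementary matrix `1 + t E i j`. -/
def elemGL {i j : Fin m} (hij : i ≠ j) (t : ℝ) : GL (Fin m) ℝ where
  val := Matrix.transvection i j t
  inv := Matrix.transvection i j (-t)
  val_inv := by rw [Matrix.transvection_mul_transvection_same _ _ hij]; simp
  inv_val := by rw [Matrix.transvection_mul_transvection_same _ _ hij]; simp

lemma coe_elemGL {i j : Fin m} (hij : i ≠ j) (t : ℝ) :
    (elemGL hij t : Matrix (Fin m) (Fin m) ℝ) = 1 + t • Matrix.single i j 1 := by
  rw [Matrix.smul_single, smul_eq_mul, mul_one]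
  rfl

lemma elemGL_zero {i j : Fin m} (hij : i ≠ j) : elemGL hij 0 = (1 : GL (Fin m) ℝ) := by
  apply Units.ext
  simp [coe_elemGL]

lemma IsSmooth.hasDerivAt_mul_elemGL {f : GL (Fin m) ℝ → ℂ} (hf : IsSmooth f) {i j : Fin m}
    (hij : i ≠ j) (g : GL (Fin m) ℝ) (t : ℝ) :
    HasDerivAt (fun s => f (g * elemGL hij s)) (SymBreak.eps i j f (g * elemGL hij t)) t := by
  have e : ∀ s, entries (g * elemGL hij s) =
      mulRightL (1 + s • Matrix.single i j 1) (entries g) := fun s => by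
    rw [← coe_elemGL hij]
    rfl
  have h := hf.hasDerivAt_comp (e t).symm (hasDerivAt_mulRightL (entries g) (Matrix.single i j 1) t)
  simp only [← e, ext0_entries] at h
  convert h using 1
  rw [eps_apply, e, mulRightL_mulRightL]
  congr 2
  -- `E i j` squares to zero for `i ≠ j`, so the velocity of the curve at time `t` is again the
  -- left-invariant direction at the moved point.
  rw [add_mul, one_mul, smul_mul_assoc, Matrix.single_mul_single_of_ne _ _ _ _ hij.symm, smul_zero,
    add_zero]

lemma IsSmooth.hasDerivAt_zero_mul_elemGL {f : GL (Fin m) ℝ → ℂ} (hf : IsSmooth f) {i j : Fin m}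
    (hij : i ≠ j) (g : GL (Fin m) ℝ) :
    HasDerivAt (fun s => f (g * elemGL hij s)) (SymBreak.eps i j f g) 0 := by
  simpa [elemGL_zero] using hf.hasDerivAt_mul_elemGL hij g 0

/-- Integrates infinitesimal invariance: the derivative vanishes along the entire one-parameter
subgroup. -/
lemma IsSmooth.mul_elemGL_of_eps_eq_zero {f : GL (Fin m) ℝ → ℂ} (hf : IsSmooth f) {i j : Fin m}
    (hij : i ≠ j) (h0 : SymBreak.eps i j f = 0) (g : GL (Fin m) ℝ) (t : ℝ) : f (g * elemGL hij t) = f g := by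
  have h := is_const_of_deriv_eq_zero (f := fun s => f (g * elemGL hij s))
    (fun s => (hf.hasDerivAt_mul_elemGL hij g s).differentiableAt)
    (fun s => by rw [(hf.hasDerivAt_mul_elemGL hij g s).deriv, h0]; rfl) t 0
  simpa [elemGL_zero] using h

/-- The hypothesis `hr` says that conjugation by `t` multiplies `E i j` by `r`; the formula follows
by differentiating `g ↦ f (g * t)`. -/
lemma eps_mul_of_semiconj {f : GL (Fin m) ℝ → ℂ} (hf : IsSmooth f) {t : GL (Fin m) ℝ} {c : ℂ}
    (hc : ∀ g, f (g * t) = c * f g) {i j : Fin m} {r : ℝ}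
    (hr : (t : Matrix (Fin m) (Fin m) ℝ) * Matrix.single i j 1 =
      r • (Matrix.single i j 1 * (t : Matrix (Fin m) (Fin m) ℝ))) (g : GL (Fin m) ℝ) :
    eps i j f (g * t) = r * c * eps i j f g := by
  have h1 : HasFDerivAt (ext0 f) (fderiv ℝ (ext0 f) (entries (g * t)))
      (mulRightL t (entries g)) := (hf.differentiableAt (g * t)).hasFDerivAt
  have h2 := (h1.comp (entries g) (mulRightL (t : Matrix (Fin m) (Fin m) ℝ)).hasFDerivAt).fderiv
  have h3 : ext0 f ∘ mulRightL (t : Matrix (Fin m) (Fin m) ℝ) =ᶠ[𝓝 (entries g)] c • ext0 f := by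
    have : ∀ᶠ A in 𝓝 (entries g), ext0 f (mulRightL (t : Matrix (Fin m) (Fin m) ℝ) A) =
        c * ext0 f A := by
      refine eventually_nhds_entries.2 (Eventually.of_forall fun g' => ?_)
      rw [mulRightL_entries, ext0_entries, ext0_entries, hc]
    exact this
  rw [h3.fderiv_eq, fderiv_const_smul (hf.differentiableAt g)] at h2
  rw [eps_apply, eps_apply, ← mulRightL_entries, mulRightL_mulRightL, hr, mulRightL_smul,
    ← mulRightL_mulRightL, map_smul, mulRightL_entries]
  have h4 := congrArg (fun l => l (mulRightL (Matrix.single i j 1) (entries g))) h2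
  simp only [ContinuousLinearMap.comp_apply, _root_.smul_apply, smul_eq_mul] at h4
  rw [← h4, Complex.real_smul, mul_assoc]

end OneParameter

/-! ### Singular vectors for the stabilizer of the base point -/

section Singular

/-- The diagonal matrix `diag(1, a, b)`. -/
def torus (a b : ℝˣ) : GL (Fin 3) ℝ where
  val := Matrix.diagonal ![1, a, b]
  inv := Matrix.diagonal ![1, (a⁻¹ : ℝˣ), (b⁻¹ : ℝˣ)]
  val_inv := by
    rw [Matrix.diagonal_mul_diagonal, ← Matrix.diagonal_one]
    congr 1; funext i; fin_cases i <;> simp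
  inv_val := by
    rw [Matrix.diagonal_mul_diagonal, ← Matrix.diagonal_one]
    congr 1; funext i; fin_cases i <;> simp

/-- Smooth functions transforming by a character under `diag(1, a, b)` from the right. -/
structure IsWeight (ζ₁ ζ₂ : ZMod 2) (s₁ s₂ : ℂ) (w : GL (Fin 3) ℝ → ℂ) : Prop where
  smooth : IsSmooth w
  torus : ∀ (g : GL (Fin 3) ℝ) (a b : ℝˣ),
    w (g * torus a b) = sgnPow ζ₁ s₁ a * sgnPow ζ₂ s₂ b * w g

variable {ζ₁ ζ₂ : ZMod 2} {s₁ s₂ : ℂ} {w : GL (Fin 3) ℝ → ℂ}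

/-- Conjugation by the torus scales `E i j` by the root character `tᵢ / tⱼ`. -/
lemma IsWeight.eps (hw : IsWeight ζ₁ ζ₂ s₁ s₂ w) (i j : Fin 3) (g : GL (Fin 3) ℝ) (a b : ℝˣ) :
    SymBreak.eps i j w (g * SymBreak.torus a b) =
      (((![1, (a : ℝ), b] i / ![1, (a : ℝ), b] j : ℝ) : ℂ)) *
        (sgnPow ζ₁ s₁ a * sgnPow ζ₂ s₂ b) * SymBreak.eps i j w g := by
  refine eps_mul_of_semiconj hw.smooth (fun g => hw.torus g a b) ?_ g
  have hj : (![1, (a : ℝ), b] : Fin 3 → ℝ) j ≠ 0 := by fin_cases j <;> simp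
  change Matrix.diagonal _ * _ = _ • (_ * Matrix.diagonal _)
  ext k l
  rw [Matrix.diagonal_mul, Matrix.smul_apply, Matrix.mul_diagonal, Matrix.single_apply]
  split_ifs with h
  · rw [← h.1, ← h.2, smul_eq_mul, one_mul, mul_one, div_mul_cancel₀ _ hj]
  · simp

lemma IsWeight.eps_one_zero (hw : IsWeight ζ₁ ζ₂ s₁ s₂ w) :
    IsWeight (ζ₁ + 1) ζ₂ (s₁ + 1) s₂ (SymBreak.eps 1 0 w) :=
  ⟨hw.smooth.eps 1 0, fun g a b => by
    have e : (![1, (a : ℝ), b] : Fin 3 → ℝ) 1 / (![1, (a : ℝ), b] : Fin 3 → ℝ) 0 = a := by simp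
    rw [hw.eps, sgnPow_add_one _ _ a.ne_zero, e]
    ring⟩

lemma IsWeight.eps_two_zero (hw : IsWeight ζ₁ ζ₂ s₁ s₂ w) :
    IsWeight ζ₁ (ζ₂ + 1) s₁ (s₂ + 1) (SymBreak.eps 2 0 w) :=
  ⟨hw.smooth.eps 2 0, fun g a b => by
    have e : (![1, (a : ℝ), b] : Fin 3 → ℝ) 2 / (![1, (a : ℝ), b] : Fin 3 → ℝ) 0 = b := by simp
    rw [hw.eps, sgnPow_add_one _ _ b.ne_zero, e]
    ring⟩

lemma IsWeight.eps_two_one (hw : IsWeight ζ₁ ζ₂ s₁ s₂ w) :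
    IsWeight (ζ₁ - 1) (ζ₂ + 1) (s₁ - 1) (s₂ + 1) (SymBreak.eps 2 1 w) :=
  ⟨hw.smooth.eps 2 1, fun g a b => by
    have e : (![1, (a : ℝ), b] : Fin 3 → ℝ) 2 / (![1, (a : ℝ), b] : Fin 3 → ℝ) 1 = b / a := by simp
    rw [hw.eps, sgnPow_add_one _ _ b.ne_zero, sgnPow_sub_one _ _ a.ne_zero, e, Complex.ofReal_div]
    ring⟩

lemma IsWeight.sub_smul {w' : GL (Fin 3) ℝ → ℂ} (hw : IsWeight ζ₁ ζ₂ s₁ s₂ w)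
    (hw' : IsWeight ζ₁ ζ₂ s₁ s₂ w') (c : ℂ) : IsWeight ζ₁ ζ₂ s₁ s₂ (w - c • w') :=
  ⟨hw.smooth.sub (hw'.smooth.smul c), fun g a b => by
    simp only [Pi.sub_apply, Pi.smul_apply, hw.torus, hw'.torus, smul_eq_mul]
    ring⟩

lemma IsWeight.iterate_eps_two_one (hw : IsWeight ζ₁ ζ₂ s₁ s₂ w) (N : ℕ) :
    IsWeight (ζ₁ - N) (ζ₂ + N) (s₁ - N) (s₂ + N) ((SymBreak.eps 2 1)^[N] w) := by
  induction N with
  | zero => simpa using hw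
  | succ N ih =>
    rw [Function.iterate_succ_apply']
    have := ih.eps_two_one
    push_cast
    simpa only [sub_sub, add_assoc] using this

/-- Differentiating the character at the identity gives its exponent; the parity is invisible there.
-/
lemma IsWeight.eps_diag (hw : IsWeight ζ₁ ζ₂ s₁ s₂ w) :
    SymBreak.eps 1 1 w = s₁ • w ∧ SymBreak.eps 2 2 w = s₂ • w := by
  have key : ∀ (i : Fin 3) (ζ : ZMod 2) (s : ℂ) (T : ℝˣ → GL (Fin 3) ℝ),
      (∀ a, (T a : Matrix (Fin 3) (Fin 3) ℝ) = 1 + ((a : ℝ) - 1) • Matrix.single i i 1) →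
      (∀ g a, w (g * T a) = sgnPow ζ s a * w g) → SymBreak.eps i i w = s • w := by
    intro i ζ s T hT hwT
    funext g
    have h1 := hw.smooth.hasDerivAt_comp (g := g) (t := 0)
      (c := fun t => mulRightL (1 + t • Matrix.single i i 1) (entries g))
      (by simp [mulRightL_one]) (hasDerivAt_mulRightL (entries g) (Matrix.single i i 1) 0)
    have h2 : HasDerivAt (fun t : ℝ => sgnPow ζ s (1 + t) * w g) (s * w g) 0 := by
      have h3 : HasDerivAt (fun t : ℝ => sgnPow ζ s (1 + t)) s 0 := by
        have h4 : HasDerivAt (sgnPow ζ s) s (1 + 0) := by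
          rw [add_zero]; exact hasDerivAt_sgnPow_one ζ s
        exact h4.comp_const_add 1 0
      exact h3.mul_const (w g)
    refine h1.unique (h2.congr_of_eventuallyEq ?_)
    -- For small `t` the line `1 + t E i i` stays in the torus, where the weight condition applies.
    have h5 : ∀ᶠ t : ℝ in 𝓝 0, 1 + t ≠ 0 := by
      have : ContinuousAt (fun t : ℝ => 1 + t) 0 := by fun_prop
      exact this.eventually_ne (by simp)
    filter_upwards [h5] with t ht
    have h6 : mulRightL (1 + t • Matrix.single i i 1) (entries g) =
        entries (g * T (Units.mk0 (1 + t) ht)) := by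
      rw [← mulRightL_entries, hT]
      simp
    rw [h6, ext0_entries, hwT]
    simp
  refine ⟨key 1 ζ₁ s₁ (fun a => SymBreak.torus a 1) (fun a => ?_) (fun g a => ?_),
    key 2 ζ₂ s₂ (fun b => SymBreak.torus 1 b) (fun b => ?_) (fun g b => ?_)⟩
  · ext i j
    fin_cases i <;> fin_cases j <;> simp [SymBreak.torus, Matrix.single]
  · simp [hw.torus]
  · ext i j
    fin_cases i <;> fin_cases j <;> simp [SymBreak.torus, Matrix.single]
  · simp [hw.torus]

/-- Weight vectors annihilated by the upper triangular direction `E 1 2`. -/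
structure IsSingular (ζ₁ ζ₂ : ZMod 2) (s₁ s₂ : ℂ) (w : GL (Fin 3) ℝ → ℂ) : Prop
    extends IsWeight ζ₁ ζ₂ s₁ s₂ w where
  eps_one_two : SymBreak.eps 1 2 w = 0

/-- `E 1 2` and `E 1 0` commute. -/
lemma IsSingular.eps_one_zero (hw : IsSingular ζ₁ ζ₂ s₁ s₂ w) :
    IsSingular (ζ₁ + 1) ζ₂ (s₁ + 1) s₂ (SymBreak.eps 1 0 w) where
  toIsWeight := hw.toIsWeight.eps_one_zero
  eps_one_two := by
    rw [eps_comm hw.smooth, hw.eps_one_two, eps_zero]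
    simp

/-- The operator `ε^{21} ε^{32} - μ ε^{31}`, which is `𝒟₃` along the orbit of the base point. -/
def stepOp (μ : ℂ) (f : GL (Fin 3) ℝ → ℂ) : GL (Fin 3) ℝ → ℂ :=
  eps 1 0 (eps 2 1 f) - μ • eps 2 0 f

lemma isInvDiffOp_stepOp (μ : ℂ) : IsInvDiffOp (stepOp μ) :=
  ((IsInvDiffOp.eps 1 0).comp (IsInvDiffOp.eps 2 1)).sub_smul (IsInvDiffOp.eps 2 0) μ

/-- Moving `ε 1 2` through produces `(s₁ - s₂) ε 1 0 w` from the second-order term and `ε 1 0 w`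
from `ε 2 0 w`; the given `μ` is the value at which they cancel. -/
lemma IsSingular.stepOp (hw : IsSingular ζ₁ ζ₂ s₁ s₂ w) {μ : ℂ} (hμ : μ = s₁ - s₂) :
    IsSingular ζ₁ (ζ₂ + 1) s₁ (s₂ + 1) (stepOp μ w) where
  toIsWeight := by
    have := hw.toIsWeight.eps_two_one.eps_one_zero
    rw [sub_add_cancel, sub_add_cancel] at this
    exact this.sub_smul hw.toIsWeight.eps_two_zero μ
  eps_one_two := by
    have hs := hw.smooth
    have hd := hw.eps_diag
    have h1 : SymBreak.eps 1 2 (SymBreak.eps 2 1 w) = (s₁ - s₂) • w := by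
      rw [eps_comm hs, hw.eps_one_two, eps_zero, hd.1, hd.2, sub_smul]
      simp
    have h2 : SymBreak.eps 1 2 (SymBreak.eps 2 0 w) = SymBreak.eps 1 0 w := by
      rw [eps_comm hs, hw.eps_one_two, eps_zero]
      simp
    have h3 : SymBreak.eps 1 2 (SymBreak.eps 1 0 (SymBreak.eps 2 1 w)) =
        (s₁ - s₂) • SymBreak.eps 1 0 w := by
      rw [eps_comm (hs.eps 2 1), h1, eps_smul hs]
      simp
    rw [SymBreak.stepOp, sub_eq_add_neg, ← neg_smul,
      eps_add ((hs.eps 2 1).eps 1 0) ((hs.eps 2 0).smul _), eps_smul (hs.eps 2 0), h3, h2, hμ]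
    module

/-- This is the `sl₂` identity `e f^(N+1) v = (N+1)(h - N) f^N v` for a highest weight vector, with
`e = ε 1 2`, `f = ε 2 1` and `h = ε 1 1 - ε 2 2`. -/
lemma IsSingular.eps_one_two_iterate (hw : IsSingular ζ₁ ζ₂ s₁ s₂ w) (N : ℕ) :
    SymBreak.eps 1 2 ((SymBreak.eps 2 1)^[N + 1] w) =
      ((N + 1 : ℂ) * (s₁ - s₂ - N)) • (SymBreak.eps 2 1)^[N] w := by
  induction N with
  | zero =>
    have hd := hw.eps_diag
    simp only [zero_add, Function.iterate_one, Function.iterate_zero, id]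
    rw [eps_comm hw.smooth, hw.eps_one_two, eps_zero, hd.1, hd.2]
    simp [sub_smul]
  | succ N ih =>
    have hN := hw.toIsWeight.iterate_eps_two_one (N + 1)
    have hN' := hw.toIsWeight.iterate_eps_two_one N
    have hd := hN.eps_diag
    rw [Function.iterate_succ_apply' _ (N + 1), eps_comm hN.smooth, ih, eps_smul hN'.smooth,
      ← Function.iterate_succ_apply' (SymBreak.eps 2 1) N w, hd.1, hd.2]
    simp only [if_true, ← add_smul, ← sub_smul]
    congr 1
    push_cast
    ring

/-- For this `N` the coefficient in `eps_one_two_iterate` vanishes, as for the singular vector of a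
reducible `sl₂` Verma module. It is the source of the operators of the second case. -/
lemma IsSingular.iterate_eps_two_one (hw : IsSingular ζ₁ ζ₂ s₁ s₂ w) {N : ℕ}
    (hN : (N : ℂ) = s₁ - s₂ + 1) :
    IsSingular (ζ₁ - N) (ζ₂ + N) (s₁ - N) (s₂ + N) ((SymBreak.eps 2 1)^[N] w) where
  toIsWeight := hw.toIsWeight.iterate_eps_two_one N
  eps_one_two := by
    cases N with
    | zero => simpa using hw.eps_one_two
    | succ N =>
      rw [hw.eps_one_two_iterate N]
      have : s₁ - s₂ - N = 0 := by
        push_cast at hN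
        linear_combination -hN
      rw [this]
      simp

lemma IsSingular.iterate_eps_one_zero (hw : IsSingular ζ₁ ζ₂ s₁ s₂ w) (N : ℕ) :
    IsSingular (ζ₁ + N) ζ₂ (s₁ + N) s₂ ((SymBreak.eps 1 0)^[N] w) := by
  induction N with
  | zero => simpa using hw
  | succ N ih =>
    rw [Function.iterate_succ_apply']
    have := ih.eps_one_zero
    push_cast
    simpa only [add_assoc] using this

/-- The composition of `n` operators `stepOp` with parameters `μ, μ - 1, …`, the first one acting
first. -/
def stepPow (μ : ℂ) : ℕ → (GL (Fin 3) ℝ → ℂ) → GL (Fin 3) ℝ → ℂ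
  | 0 => id
  | n + 1 => stepOp (μ - n) ∘ stepPow μ n

lemma isInvDiffOp_stepPow (μ : ℂ) (n : ℕ) : IsInvDiffOp (stepPow μ n) := by
  induction n with
  | zero => exact IsInvDiffOp.id
  | succ n ih => exact (isInvDiffOp_stepOp _).comp ih

lemma IsSingular.stepPow (hw : IsSingular ζ₁ ζ₂ s₁ s₂ w) {μ : ℂ} (hμ : μ = s₁ - s₂) (n : ℕ) :
    IsSingular ζ₁ (ζ₂ + n) s₁ (s₂ + n) (stepPow μ n w) := by
  induction n with
  | zero => simpa [SymBreak.stepPow] using hw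
  | succ n ih =>
    have := ih.stepOp (μ := μ - n) (by rw [hμ]; ring)
    push_cast
    rw [← add_assoc, ← add_assoc]
    exact this

end Singular

/-! ### The operators along the slice of matrices with last row `(1, 0, 0)` -/

section Slice

/-- The matrices with last row `(1, 0, 0)`. -/
def slice : Set (GL (Fin 3) ℝ) :=
  {g | (g : Matrix (Fin 3) (Fin 3) ℝ) 2 = ![1, 0, 0]}

lemma coe_basePoint_zero : ((basePoint (0 : Fin 3) : GL (Fin 3) ℝ) : Matrix (Fin 3) (Fin 3) ℝ) =
    !![0, 1, 0; 0, 0, 1; 1, 0, 0] := by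
  have h : ∀ i, basePerm (0 : Fin 3) i = ![1, 2, 0] i := by decide
  change (basePerm (0 : Fin 3)).permMatrix ℝ = _
  ext i j
  rw [Equiv.Perm.permMatrix, PEquiv.toMatrix_apply]
  simp only [Equiv.toPEquiv_apply, h]
  fin_cases i <;> fin_cases j <;> simp

lemma coe_embed (h : GL (Fin 2) ℝ) : (embed 2 h : Matrix (Fin 3) (Fin 3) ℝ) =
    !![h 0 0, h 0 1, 0; h 1 0, h 1 1, 0; 0, 0, 1] := by
  obtain ⟨h1, h2, h3, h4⟩ := embed_entries h
  ext i j
  fin_cases i <;> fin_cases j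
  exacts [h1 0 0, h1 0 1, h2 0, h1 1 0, h1 1 1, h2 1, h3 0, h3 1, h4]

lemma coe_embed_mul_basePoint (h : GL (Fin 2) ℝ) :
    ((embed 2 h * basePoint (0 : Fin 3) : GL (Fin 3) ℝ) : Matrix (Fin 3) (Fin 3) ℝ) =
    !![0, h 0 0, h 0 1; 0, h 1 0, h 1 1; 1, 0, 0] := by
  rw [Units.val_mul, coe_embed, coe_basePoint_zero]
  ext i j
  fin_cases i <;> fin_cases j <;> simp [Matrix.mul_apply, Fin.sum_univ_three]

lemma embed_mul_basePoint_mem_slice (h : GL (Fin 2) ℝ) :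
    embed 2 h * basePoint (0 : Fin 3) ∈ slice := by
  change ((embed 2 h * basePoint (0 : Fin 3) : GL (Fin 3) ℝ) : Matrix (Fin 3) (Fin 3) ℝ) 2 = _
  rw [coe_embed_mul_basePoint]
  rfl

/-- Right multiplication adds `t` times column `i` to column `j`, and for `i ≠ 0` column `i` has
last entry zero. -/
lemma mul_elemGL_mem_slice {g : GL (Fin 3) ℝ} (hg : g ∈ slice) {i j : Fin 3} (hij : i ≠ j)
    (hi : i ≠ 0) (t : ℝ) : g * elemGL hij t ∈ slice := by
  change ((g : Matrix (Fin 3) (Fin 3) ℝ) * (elemGL hij t : Matrix (Fin 3) (Fin 3) ℝ)) 2 = _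
  have hg' : (g : Matrix (Fin 3) (Fin 3) ℝ) 2 = ![1, 0, 0] := hg
  have h0 : (g : Matrix (Fin 3) (Fin 3) ℝ) 2 i = 0 := by
    rw [hg']
    fin_cases i <;> simp at hi ⊢
  rw [coe_elemGL, mul_add, mul_one, Matrix.mul_smul]
  funext k
  rw [Matrix.add_apply, Matrix.smul_apply]
  by_cases hk : k = j
  · rw [hk, Matrix.mul_single_apply_same, h0, hg']
    simp
  · rw [Matrix.mul_single_apply_of_ne (hbj := hk), hg']
    simp

/-- The derivative is taken along a curve inside `slice`, so it depends only on the values there.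
Operators can therefore be simplified on `slice` before differentiating further. -/
lemma eps_eqOn_slice {f f' : GL (Fin 3) ℝ → ℂ} (hf : IsSmooth f) (hf' : IsSmooth f')
    (h : Set.EqOn f f' slice) {i j : Fin 3} (hij : i ≠ j) (hi : i ≠ 0) :
    Set.EqOn (eps i j f) (eps i j f') slice := fun g hg => by
  have h1 := hf.hasDerivAt_zero_mul_elemGL hij g
  have h2 := hf'.hasDerivAt_zero_mul_elemGL hij g
  have e : (fun s => f (g * elemGL hij s)) = fun s => f' (g * elemGL hij s) :=
    funext fun s => h (mul_elemGL_mem_slice hg hij hi s)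
  rw [e] at h1
  exact h1.unique h2

lemma IsSmooth.mulPhi {n : ℕ} {f : GL (Fin (n + 1)) ℝ → ℂ} (hf : IsSmooth f) (j : Fin (n + 1)) :
    IsSmooth (SymBreak.mulPhi j f) := isSmooth_iff.2 fun g => by
  have h1 : ext0 (SymBreak.mulPhi j f) =ᶠ[𝓝 (entries g)]
      fun A => ((A (Fin.last n) j : ℝ) : ℂ) * ext0 f A := by
    have : ∀ᶠ A in 𝓝 (entries g), ext0 (SymBreak.mulPhi j f) A =
        ((A (Fin.last n) j : ℝ) : ℂ) * ext0 f A := by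
      refine eventually_nhds_entries.2 (Eventually.of_forall fun g' => ?_)
      rw [ext0_entries, ext0_entries]
      rfl
    exact this
  refine ContDiffAt.congr_of_eventuallyEq ?_ h1
  have h2 : ContDiff ℝ ∞ fun A : Mat (n + 1) => ((A (Fin.last n) j : ℝ) : ℂ) :=
    Complex.ofRealCLM.contDiff.comp (contDiff_apply_apply ℝ ℝ (Fin.last n) j)
  exact h2.contDiffAt.mul (hf.contDiffAt g)

lemma calD_one (lam : Fin 3 → ℂ) (f : GL (Fin 3) ℝ → ℂ) :
    calD (1 : Fin 3) lam f = mulPhi 0 (eps 1 0 f) -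
      mulPhi 1 ((lam 1 - lam 0 - 1) • f) := by
  have hu : (Finset.univ : Finset (Equiv.Perm (Fin 2))) = {1, Equiv.swap 0 1} := by decide
  funext g
  simp only [calD]
  -- The matrix size `(1 : Fin 3) + 1` reduces to `2`, which makes the explicit list of permutations
  -- applicable.
  change opDet (r := 2) _ f g = _
  rw [opDet, hu, Finset.sum_insert (by decide), Finset.sum_singleton]
  have s1 : Equiv.Perm.sign (Equiv.swap (0 : Fin 2) 1) = -1 := by decide
  simp [s1, List.ofFn_succ, mulPhi]
  ring

lemma calD_two (lam : Fin 3 → ℂ) (f : GL (Fin 3) ℝ → ℂ) :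
    calD (2 : Fin 3) lam f = mulPhi 0 (eps 1 0 (eps 2 1 f)) -
      mulPhi 0 (eps 2 0 ((lam 2 - lam 1 - 1) • f)) - mulPhi 1 ((lam 2 - lam 0 - 1) • eps 2 1 f) +
      mulPhi 2 ((lam 2 - lam 0 - 1) • (lam 2 - lam 1 - 1) • f) := by
  have hu : (Finset.univ : Finset (Equiv.Perm (Fin 3))) =
    {1, Equiv.swap 0 1, Equiv.swap 0 2, Equiv.swap 1 2, finRotate 3, (finRotate 3)⁻¹} := by decide
  funext g
  simp only [calD]
  change opDet (r := 3) _ f g = _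
  rw [opDet, hu]
  repeat rw [Finset.sum_insert (by decide)]
  rw [Finset.sum_singleton]
  have e1 : Equiv.swap (0 : Fin 3) 1 2 = 2 := by decide
  have e2 : Equiv.swap (0 : Fin 3) 2 1 = 1 := by decide
  have e3 : Equiv.swap (1 : Fin 3) 2 0 = 0 := by decide
  have e4 : (-1 : Fin 3) = 2 := by decide
  -- The upper right entry is zero, so only four of the six permutations contribute.
  simp [List.ofFn_succ, mulPhi, e1, e2, e3, e4, eps_zero]
  ring

lemma mulPhi_of_mem_slice {g : GL (Fin 3) ℝ} (hg : g ∈ slice) (j : Fin 3)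
    (f : GL (Fin 3) ℝ → ℂ) : mulPhi j f g = if j = 0 then f g else 0 := by
  have hg' : (g : Matrix (Fin 3) (Fin 3) ℝ) (Fin.last 2) = ![1, 0, 0] := hg
  rw [mulPhi, hg']
  fin_cases j <;> simp

lemma IsSmooth.calD_one {f : GL (Fin 3) ℝ → ℂ} (hf : IsSmooth f) (lam : Fin 3 → ℂ) :
    IsSmooth (calD (1 : Fin 3) lam f) := by
  rw [SymBreak.calD_one]
  exact ((hf.eps 1 0).mulPhi 0).sub ((hf.smul _).mulPhi 1)

lemma IsSmooth.calD_two {f : GL (Fin 3) ℝ → ℂ} (hf : IsSmooth f) (lam : Fin 3 → ℂ) :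
    IsSmooth (calD (2 : Fin 3) lam f) := by
  rw [SymBreak.calD_two]
  exact (((((hf.eps 2 1).eps 1 0).mulPhi 0).sub (((hf.smul _).eps 2 0).mulPhi 0)).sub
    (((hf.eps 2 1).smul _).mulPhi 1)).add (((hf.smul _).smul _).mulPhi 2)

lemma calD_one_eqOn_slice (lam : Fin 3 → ℂ) (f : GL (Fin 3) ℝ → ℂ) :
    Set.EqOn (calD (1 : Fin 3) lam f) (eps 1 0 f) slice := fun g hg => by
  rw [calD_one]
  simp [mulPhi_of_mem_slice hg]

lemma calD_two_eqOn_slice {f : GL (Fin 3) ℝ → ℂ} (hf : IsSmooth f) (lam : Fin 3 → ℂ) :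
    Set.EqOn (calD (2 : Fin 3) lam f) (stepOp (lam 2 - lam 1 - 1) f) slice := fun g hg => by
  rw [calD_two, eps_smul hf, stepOp]
  simp [mulPhi_of_mem_slice hg]

/-- The parameter enters only through a multiple of `Φ₂`, which vanishes on `slice`; this is why
`lam` leaves no trace in the result. -/
lemma calDPow_one_eqOn_slice {f f' : GL (Fin 3) ℝ → ℂ} (hf : IsSmooth f) (hf' : IsSmooth f')
    (h : Set.EqOn f f' slice) (lam : Fin 3 → ℂ) (n : ℕ) :
    IsSmooth (calDPow (1 : Fin 3) lam n f) ∧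
      Set.EqOn (calDPow (1 : Fin 3) lam n f) ((eps 1 0)^[n] f') slice := by
  induction n with
  | zero => exact ⟨hf, h⟩
  | succ n ih =>
    refine ⟨ih.1.calD_one _, ?_⟩
    rw [Function.iterate_succ_apply']
    exact (calD_one_eqOn_slice _ _).trans
      (eps_eqOn_slice ih.1 (((IsInvDiffOp.eps 1 0).iterate n).smooth hf') ih.2 (by decide)
        (by decide))

/-- Each factor lowers `λ₃`, hence also `λ_{3,2} = λ₃ - λ₂ - 1`, by one; this is the shift built
into `stepPow`. -/
lemma calDPow_two_eqOn_slice {f : GL (Fin 3) ℝ → ℂ} (hf : IsSmooth f) (lam : Fin 3 → ℂ) (n : ℕ) :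
    IsSmooth (calDPow (2 : Fin 3) lam n f) ∧
      Set.EqOn (calDPow (2 : Fin 3) lam n f) (stepPow (lam 2 - lam 1 - 1) n f) slice := by
  induction n with
  | zero => exact ⟨hf, fun g _ => rfl⟩
  | succ n ih =>
    refine ⟨ih.1.calD_two _, ?_⟩
    have hs := (isInvDiffOp_stepPow (lam 2 - lam 1 - 1) n).smooth hf
    have h1 := calD_two_eqOn_slice ih.1 (lam - (n : ℂ) • Pi.single 2 1)
    have e : (lam - (n : ℂ) • Pi.single 2 1 : Fin 3 → ℂ) 2 -
        (lam - (n : ℂ) • Pi.single 2 1 : Fin 3 → ℂ) 1 - 1 = lam 2 - lam 1 - 1 - n := by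
      simp
      ring
    rw [e] at h1
    refine h1.trans fun g hg => ?_
    have h2 := eps_eqOn_slice (ih.1.eps 2 1) (hs.eps 2 1)
      (eps_eqOn_slice ih.1 hs ih.2 (i := 2) (j := 1) (by decide) (by decide))
      (i := 1) (j := 0) (by decide) (by decide) hg
    have h3 := eps_eqOn_slice ih.1 hs ih.2 (i := 2) (j := 0) (by decide) (by decide) hg
    simp only [stepPow, Function.comp_apply, stepOp, Pi.sub_apply, Pi.smul_apply, h2, h3]

lemma rest_congr_of_eqOn_slice {f f' : GL (Fin 3) ℝ → ℂ} (h : Set.EqOn f f' slice) :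
    rest (0 : Fin 3) f = rest (0 : Fin 3) f' :=
  funext fun x => h (embed_mul_basePoint_mem_slice x)

/-- Conjugation by the base point carries the embedded subgroup `1 + s E 1 0` of `GL 2` to `1 + s E
2 1` in `GL 3`. -/
lemma eps_rest {f : GL (Fin 3) ℝ → ℂ} (hf : IsSmooth f) :
    eps (1 : Fin 2) 0 (rest (0 : Fin 3) f) = rest (0 : Fin 3) (eps 2 1 f) := by
  funext h
  have h1 := (hf.rest 0).hasDerivAt_zero_mul_elemGL (i := (1 : Fin 2)) (j := 0) (by decide) h
  have h2 := hf.hasDerivAt_zero_mul_elemGL (i := (2 : Fin 3)) (j := 1) (by decide)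
    (embed 2 h * basePoint (0 : Fin 3))
  have e : ∀ s, embed 2 (h * elemGL (i := (1 : Fin 2)) (j := 0) (by decide) s) *
      basePoint (0 : Fin 3) = embed 2 h * basePoint (0 : Fin 3) *
        elemGL (i := (2 : Fin 3)) (j := 1) (by decide) s := by
    intro s
    apply Units.ext
    rw [Units.val_mul _ (elemGL _ s), coe_embed_mul_basePoint, coe_embed_mul_basePoint, coe_elemGL,
      Units.val_mul, coe_elemGL]
    ext i j
    fin_cases i <;> fin_cases j <;>
      simp [Matrix.mul_apply, Fin.sum_univ_three, Fin.sum_univ_two, Matrix.single]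
  simp only [rest, e] at h1
  exact h1.unique h2

lemma iterate_eps_rest {f : GL (Fin 3) ℝ → ℂ} (hf : IsSmooth f) (N : ℕ) :
    (eps (1 : Fin 2) 0)^[N] (rest (0 : Fin 3) f) = rest (0 : Fin 3) ((eps 2 1)^[N] f) := by
  induction N with
  | zero => rfl
  | succ N ih =>
    rw [Function.iterate_succ_apply', Function.iterate_succ_apply', ih,
      eps_rest (((IsInvDiffOp.eps 2 1).iterate N).smooth hf)]

lemma coe_torus (a b : ℝˣ) : (torus a b : Matrix (Fin 3) (Fin 3) ℝ) =
    !![1, 0, 0; 0, (a : ℝ), 0; 0, 0, (b : ℝ)] := by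
  change Matrix.diagonal _ = _
  ext i j
  fin_cases i <;> fin_cases j <;> simp

/-- Singular vectors of the correct weight restrict to elements of the principal series. -/
lemma IsSingular.rest_mem {ζ₁ ζ₂ : ZMod 2} {s₁ s₂ : ℂ} {w : GL (Fin 3) ℝ → ℂ}
    (hw : IsSingular ζ₁ ζ₂ s₁ s₂ w) {η : Fin 2 → ZMod 2} {ν : Fin 2 → ℂ}
    (h1 : ∀ x : ℝ, x ≠ 0 → sgnPow ζ₁ s₁ x = sgnPow (η 0) (-ν 0 - 1 / 2) x)
    (h2 : ∀ x : ℝ, x ≠ 0 → sgnPow ζ₂ s₂ x = sgnPow (η 1) (-ν 1 + 1 / 2) x) :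
    rest (0 : Fin 3) w ∈ principalSeries η ν := by
  refine ⟨hw.smooth.rest 0, fun h p hp => ?_⟩
  have hp10 : (p : Matrix (Fin 2) (Fin 2) ℝ) 1 0 = 0 := hp 1 0 (by decide)
  have hdet : (p : Matrix (Fin 2) (Fin 2) ℝ).det ≠ 0 :=
    (Matrix.isUnit_iff_isUnit_det _).1 p.isUnit |>.ne_zero
  rw [Matrix.det_fin_two, hp10, mul_zero, sub_zero] at hdet
  have hp0 := left_ne_zero_of_mul hdet
  have hp1 := right_ne_zero_of_mul hdet
  set a := Units.mk0 _ hp0 with ha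
  set b := Units.mk0 _ hp1 with hb
  -- Conjugating `diag(p, 1)` by the base point gives `diag(1, p)`, which factors as a torus element
  -- times an elementary matrix in direction `E 1 2`.
  have e : embed 2 (h * p) * basePoint (0 : Fin 3) =
      embed 2 h * basePoint (0 : Fin 3) * torus a b *
        elemGL (i := (1 : Fin 3)) (j := 2) (by decide)
          ((p : Matrix (Fin 2) (Fin 2) ℝ) 0 1 / (p : Matrix (Fin 2) (Fin 2) ℝ) 0 0) := by
    apply Units.ext
    rw [Units.val_mul _ (elemGL _ _), Units.val_mul _ (torus a b), coe_embed_mul_basePoint,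
      coe_embed_mul_basePoint, coe_elemGL, Units.val_mul, coe_torus]
    ext i j
    fin_cases i <;> fin_cases j <;>
      simp [Matrix.mul_apply, Fin.sum_univ_three, Fin.sum_univ_two, Matrix.single, hp10, ha,
        hb] <;> field_simp
  have e' : rest (0 : Fin 3) w (h * p) = sgnPow ζ₁ s₁ a * sgnPow ζ₂ s₂ b * rest (0 : Fin 3) w h := by
    rw [rest, e, hw.smooth.mul_elemGL_of_eps_eq_zero _ hw.eps_one_two, hw.torus]
    rfl
  rw [e', h1 _ a.ne_zero, h2 _ b.ne_zero, inducingFactor, Fin.prod_univ_two]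
  have r0 : rho 2 0 = 1 / 2 := by simp [rho]; norm_num
  have r1 : rho 2 1 = -(1 / 2) := by simp [rho]; norm_num
  rw [r0, r1, sub_neg_eq_add]
  rfl

/-- Elements of the principal series are singular vectors. -/
lemma isSingular_of_mem_principalSeries {ξ : Fin 3 → ZMod 2} {lam : Fin 3 → ℂ}
    {f : GL (Fin 3) ℝ → ℂ} (hf : f ∈ principalSeries ξ lam) :
    IsSingular (ξ 1) (ξ 2) (-lam 1) (-lam 2 + 1) f where
  smooth := hf.1
  torus g a b := by
    have hT : torus a b ∈ borel 3 := by
      intro i j hij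
      exact Matrix.diagonal_apply_ne _ hij.ne'
    rw [hf.2 g _ hT, inducingFactor, Fin.prod_univ_three]
    have r1 : rho 3 1 = 0 := by simp [rho]; norm_num
    have r2 : rho 3 2 = -1 := by simp [rho]; norm_num
    rw [r1, r2, sub_zero, sub_neg_eq_add]
    simp [torus]
  eps_one_two := by
    funext g
    have h1 := hf.1.hasDerivAt_zero_mul_elemGL (i := (1 : Fin 3)) (j := 2) (by decide) g
    have e : (fun s => f (g * elemGL (i := (1 : Fin 3)) (j := 2) (by decide) s)) =
        fun _ => f g := by
      funext s
      have hU : elemGL (i := (1 : Fin 3)) (j := 2) (by decide) s ∈ borel 3 := by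
        intro i j hij
        rw [coe_elemGL]
        fin_cases i <;> fin_cases j <;> simp [Matrix.single] at hij ⊢
      rw [hf.2 g _ hU, inducingFactor, Fin.prod_univ_three, coe_elemGL]
      simp [Matrix.single]
    rw [e] at h1
    exact h1.unique (hasDerivAt_const _ _)

end Slice

/-! ### The big cell around the base point -/

section Chart

/-- The chart `(x, y, z) ↦ x₀ n` of the flag variety around the base point, with `n` lower triangular
unipotent. -/
def chart (v : ℝ × ℝ × ℝ) : GL (Fin 3) ℝ :=
  Matrix.GeneralLinearGroup.mkOfDetNeZero !![v.1, 1, 0; v.2.1, v.2.2, 1; 1, 0, 0]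
    (by simp [Matrix.det_fin_three])

lemma coe_chart (v : ℝ × ℝ × ℝ) : (chart v : Matrix (Fin 3) (Fin 3) ℝ) =
    !![v.1, 1, 0; v.2.1, v.2.2, 1; 1, 0, 0] := rfl

lemma chart_zero : chart 0 = embed 2 1 * basePoint (0 : Fin 3) := by
  apply Units.ext
  rw [coe_embed_mul_basePoint, coe_chart]
  simp

/-- Right multiplication by lower unipotents preserves the chart: here and in the next two lemmas `ε
2 1`, `ε 2 0` and `ε 1 0` are identified with `∂_z`, `∂_y` and `∂_x + z ∂_y`. -/
lemma chart_mul_elemGL_two_one (v : ℝ × ℝ × ℝ) (t : ℝ) :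
    chart v * elemGL (i := (2 : Fin 3)) (j := 1) (by decide) t = chart (v + (0, 0, t)) := by
  apply Units.ext
  rw [Units.val_mul, coe_elemGL, coe_chart, coe_chart]
  ext i j
  fin_cases i <;> fin_cases j <;> simp [Matrix.mul_apply, Fin.sum_univ_three, Matrix.single]

lemma chart_mul_elemGL_two_zero (v : ℝ × ℝ × ℝ) (t : ℝ) :
    chart v * elemGL (i := (2 : Fin 3)) (j := 0) (by decide) t = chart (v + (0, t, 0)) := by
  apply Units.ext
  rw [Units.val_mul, coe_elemGL, coe_chart, coe_chart]
  ext i j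
  fin_cases i <;> fin_cases j <;> simp [Matrix.mul_apply, Fin.sum_univ_three, Matrix.single]

lemma chart_mul_elemGL_one_zero (v : ℝ × ℝ × ℝ) (t : ℝ) :
    chart v * elemGL (i := (1 : Fin 3)) (j := 0) (by decide) t =
      chart (v + (t, t * v.2.2, 0)) := by
  apply Units.ext
  rw [Units.val_mul, coe_elemGL, coe_chart, coe_chart]
  ext i j
  fin_cases i <;> fin_cases j <;>
    simp [Matrix.mul_apply, Fin.sum_univ_three, Matrix.single, mul_comm]

/-- Smooth functions that are `C x^a z^b` in the chart near the base point. -/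
structure IsMonomial (a b : ℕ) (C : ℂ) (w : GL (Fin 3) ℝ → ℂ) : Prop where
  smooth : IsSmooth w
  eq : ∀ᶠ v : ℝ × ℝ × ℝ in 𝓝 0, w (chart v) = C * v.1 ^ a * v.2.2 ^ b

variable {a b : ℕ} {C : ℂ} {w : GL (Fin 3) ℝ → ℂ}

/-- Differentiating at `v` needs the monomial formula on a neighbourhood of `v`, hence the passage
to an iterated eventual statement. -/
lemma IsMonomial.hasDerivAt (hw : IsMonomial a b C w) {i j : Fin 3} (hij : i ≠ j)
    {d : ℝ × ℝ × ℝ → ℝ → ℝ × ℝ × ℝ} (hd : ∀ v, Continuous (d v)) (hd0 : ∀ v, d v 0 = 0)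
    (h : ∀ v t, chart v * elemGL hij t = chart (v + d v t)) :
    ∀ᶠ v : ℝ × ℝ × ℝ in 𝓝 0, HasDerivAt
      (fun t => C * ((v + d v t).1 : ℂ) ^ a * ((v + d v t).2.2 : ℂ) ^ b)
      (eps i j w (chart v)) 0 := by
  filter_upwards [eventually_eventually_nhds.2 hw.eq] with v hv
  refine (hw.smooth.hasDerivAt_zero_mul_elemGL hij (chart v)).congr_of_eventuallyEq ?_
  have hc : Tendsto (fun t => v + d v t) (𝓝 0) (𝓝 v) := by
    have : Continuous fun t => v + d v t := continuous_const.add (hd v)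
    simpa [hd0] using this.tendsto 0
  filter_upwards [hc.eventually hv] with t ht
  rw [h, ht]

lemma IsMonomial.eps_two_zero (hw : IsMonomial a b C w) : IsMonomial a b 0 (eps 2 0 w) where
  smooth := hw.smooth.eps 2 0
  eq := by
    filter_upwards [hw.hasDerivAt (i := 2) (j := 0) (by decide) (d := fun _ t => (0, t, 0))
      (fun _ => by fun_prop) (fun _ => rfl) chart_mul_elemGL_two_zero] with v hv
    simp only [Prod.fst_add, Prod.snd_add, add_zero] at hv
    rw [hv.unique (hasDerivAt_const _ _)]
    simp

/-- The truncated exponent at `b = 0` is harmless, since the coefficient is then zero; likewise for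
`eps_one_zero`. -/
lemma IsMonomial.eps_two_one (hw : IsMonomial a b C w) :
    IsMonomial a (b - 1) (C * b) (eps 2 1 w) where
  smooth := hw.smooth.eps 2 1
  eq := by
    filter_upwards [hw.hasDerivAt (i := 2) (j := 1) (by decide) (d := fun _ t => (0, 0, t))
      (fun _ => by fun_prop) (fun _ => rfl) chart_mul_elemGL_two_one] with v hv
    simp only [Prod.fst_add, Prod.snd_add, add_zero] at hv
    have h1 : HasDerivAt (fun t : ℝ => ((v.2.2 + t : ℝ) : ℂ)) 1 0 := by
      simpa using ((hasDerivAt_id (0 : ℝ)).const_add v.2.2).ofReal_comp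
    rw [hv.unique ((h1.pow b).const_mul (C * (v.1 : ℂ) ^ a))]
    simp
    ring

lemma IsMonomial.eps_one_zero (hw : IsMonomial a b C w) :
    IsMonomial (a - 1) b (C * a) (eps 1 0 w) where
  smooth := hw.smooth.eps 1 0
  eq := by
    filter_upwards [hw.hasDerivAt (i := 1) (j := 0) (by decide) (d := fun v t => (t, t * v.2.2, 0))
      (fun _ => by fun_prop) (fun _ => by simp) chart_mul_elemGL_one_zero] with v hv
    simp only [Prod.fst_add, Prod.snd_add, add_zero] at hv
    have h1 : HasDerivAt (fun t : ℝ => ((v.1 + t : ℝ) : ℂ)) 1 0 := by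
      simpa using ((hasDerivAt_id (0 : ℝ)).const_add v.1).ofReal_comp
    rw [hv.unique (((h1.pow a).const_mul C).mul_const ((v.2.2 : ℂ) ^ b)), add_zero]
    ring

/-- The term with `μ` is `∂_y` of a function without `y`, so it drops out and the coefficient does
not depend on `μ`. -/
lemma IsMonomial.stepOp (hw : IsMonomial a b C w) (μ : ℂ) :
    IsMonomial (a - 1) (b - 1) (C * b * a) (stepOp μ w) where
  smooth := (isInvDiffOp_stepOp μ).smooth hw.smooth
  eq := by
    filter_upwards [hw.eps_two_one.eps_one_zero.eq, hw.eps_two_zero.eq] with v h1 h2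
    rw [SymBreak.stepOp, Pi.sub_apply, Pi.smul_apply, h1, h2]
    simp

lemma IsMonomial.iterate_eps_two_one (hw : IsMonomial a b C w) (N : ℕ) :
    IsMonomial a (b - N) (C * b.descFactorial N) ((eps 2 1)^[N] w) := by
  induction N with
  | zero => simpa using hw
  | succ N ih =>
    rw [Function.iterate_succ_apply']
    have := ih.eps_two_one
    rwa [Nat.sub_sub, mul_assoc, ← Nat.cast_mul, mul_comm (b.descFactorial N),
      ← Nat.descFactorial_succ] at this

lemma IsMonomial.iterate_eps_one_zero (hw : IsMonomial a b C w) (N : ℕ) :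
    IsMonomial (a - N) b (C * a.descFactorial N) ((eps 1 0)^[N] w) := by
  induction N with
  | zero => simpa using hw
  | succ N ih =>
    rw [Function.iterate_succ_apply']
    have := ih.eps_one_zero
    rwa [Nat.sub_sub, mul_assoc, ← Nat.cast_mul, mul_comm (a.descFactorial N),
      ← Nat.descFactorial_succ] at this

lemma IsMonomial.stepPow (hw : IsMonomial a b C w) (μ : ℂ) (N : ℕ) :
    IsMonomial (a - N) (b - N) (C * (b.descFactorial N * a.descFactorial N : ℕ))
      (stepPow μ N w) := by
  induction N with
  | zero => simpa [SymBreak.stepPow] using hw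
  | succ N ih =>
    have := ih.stepOp (μ - N)
    rw [Nat.sub_sub, Nat.sub_sub, mul_assoc, mul_assoc, ← Nat.cast_mul, ← Nat.cast_mul] at this
    rw [Nat.descFactorial_succ, Nat.descFactorial_succ]
    have e : (b - N) * b.descFactorial N * ((a - N) * a.descFactorial N) =
        b.descFactorial N * a.descFactorial N * ((b - N) * (a - N)) := by ring
    rw [e]
    exact this

lemma IsMonomial.rest_one (hw : IsMonomial 0 0 C w) : rest (0 : Fin 3) w 1 = C := by
  have := hw.eq.self_of_nhds
  rw [chart_zero] at this
  simpa [rest] using this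

end Chart

/-! ### Existence of the symmetry breaking operators -/

section Existence

variable {ξ : Fin 3 → ZMod 2} {lam : Fin 3 → ℂ} {η : Fin 2 → ZMod 2} {ν : Fin 2 → ℂ} {n₁ n₂ : ℕ}

lemma natCast_add_self_zmod_two (n : ℕ) : (n : ZMod 2) + n = 0 := by
  rw [← two_mul]
  have : (2 : ZMod 2) = 0 := rfl
  rw [this, zero_mul]

/-- The operator of the first case. -/
lemma exists_DSBO_of_le (hn₁ : (n₁ : ℂ) = lam 2 - ν 1 - 1 / 2)
    (hn₂ : (n₂ : ℂ) = lam 1 + lam 2 - ν 0 - ν 1 - 1)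
    (hη₁ : η 0 = ξ 1 + ((n₁ + n₂ : ℕ) : ZMod 2)) (hη₂ : η 1 = ξ 2 + (n₁ : ZMod 2))
    (h : n₁ ≤ n₂) :
    ∃ T : DSBO (0 : Fin 3) ξ lam η ν,
      (∀ f : principalSeries ξ lam, (T.1 f).1 =
        (rest (0 : Fin 3) ∘ calDPow (1 : Fin 3) (lam - (n₁ : ℂ) • Pi.single 2 1) (n₂ - n₁) ∘
          calDPow (2 : Fin 3) lam n₁) f.1) ∧
      ∀ f : principalSeries ξ lam, IsMonomial n₂ n₁ 1 f.1 → (T.1 f).1 1 ≠ 0 := by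
  obtain ⟨k, rfl⟩ := Nat.exists_eq_add_of_le h
  have hk : n₁ + k - n₁ = k := by omega
  set μ := lam 2 - lam 1 - 1 with hμ
  have hD : IsInvDiffOp ((eps (1 : Fin 3) 0)^[k] ∘ stepPow μ n₁) :=
    ((IsInvDiffOp.eps 1 0).iterate k).comp (isInvDiffOp_stepPow μ n₁)
  have hmem : ∀ f ∈ principalSeries ξ lam,
      rest (0 : Fin 3) (((eps (1 : Fin 3) 0)^[k] ∘ stepPow μ n₁) f) ∈ principalSeries η ν := by
    intro f hf
    have hw := ((isSingular_of_mem_principalSeries hf).stepPow (μ := μ)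
      (by rw [hμ]; ring) n₁).iterate_eps_one_zero k
    refine hw.rest_mem (fun x _ => ?_) (fun x _ => ?_)
    · congr 1
      · rw [hη₁]
        push_cast
        -- The parity needed is `n₂ - n₁`, while the hypothesis provides `n₁ + n₂`; they agree
        -- modulo `2`.
        linear_combination -natCast_add_self_zmod_two n₁
      · push_cast at hn₂
        linear_combination hn₂ - hn₁
    · congr 1
      · rw [hη₂]
      · linear_combination hn₁
  obtain ⟨T, hT⟩ := exists_mem_DSBO hD 0 hmem
  refine ⟨T, fun f => ?_, fun f hf => ?_⟩
  · rw [hT, hk]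
    have h2 := calDPow_two_eqOn_slice f.2.1 lam n₁
    have h1 := calDPow_one_eqOn_slice h2.1 ((isInvDiffOp_stepPow μ n₁).smooth f.2.1) h2.2
      (lam - (n₁ : ℂ) • Pi.single 2 1) k
    exact (rest_congr_of_eqOn_slice h1.2).symm
  · rw [hT]
    have hm := (hf.stepPow μ n₁).iterate_eps_one_zero k
    -- The operator uses up the exponents of `x^n₂ z^n₁` exactly, so a constant remains, a product
    -- of nonzero descending factorials.
    have e : n₁ + k - n₁ - k = 0 := by omega
    rw [e, Nat.sub_self] at hm
    rw [Function.comp_apply, hm.rest_one, one_mul, ← Nat.cast_mul, Nat.cast_ne_zero]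
    simp [Nat.descFactorial_eq_zero_iff_lt]

/-- The operator of the second case. -/
lemma exists_DSBO_of_lt (hn₁ : (n₁ : ℂ) = lam 2 - ν 1 - 1 / 2)
    (hn₂ : (n₂ : ℂ) = lam 1 + lam 2 - ν 0 - ν 1 - 1)
    (hη₁ : η 0 = ξ 1 + ((n₁ + n₂ : ℕ) : ZMod 2)) (hη₂ : η 1 = ξ 2 + (n₁ : ZMod 2))
    (h : n₂ < n₁) {k₀ : ℕ} (hk₀ : k₀ ≤ n₂) (hlam : lam 2 - lam 1 - (n₁ : ℂ) + (k₀ : ℂ) = 0) :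
    ∃ T : DSBO (0 : Fin 3) ξ lam η ν,
      (∀ f : principalSeries ξ lam, (T.1 f).1 =
        ((eps (1 : Fin 2) (0 : Fin 2))^[n₁ - n₂ + k₀] ∘ rest (0 : Fin 3) ∘
          calDPow (1 : Fin 3) (lam - ((n₂ - k₀ : ℕ) : ℂ) • Pi.single 2 1) k₀ ∘
          calDPow (2 : Fin 3) lam (n₂ - k₀)) f.1) ∧
      ∀ f : principalSeries ξ lam, IsMonomial n₂ n₁ 1 f.1 → (T.1 f).1 1 ≠ 0 := by
  obtain ⟨p, rfl⟩ := Nat.exists_eq_add_of_le hk₀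
  obtain ⟨q, rfl⟩ := Nat.exists_eq_add_of_le h.le
  have hp : k₀ + p - k₀ = p := by omega
  have hq : k₀ + p + q - (k₀ + p) + k₀ = q + k₀ := by omega
  rw [hp, hq]
  set μ := lam 2 - lam 1 - 1 with hμ
  have hD0 : IsInvDiffOp ((eps (1 : Fin 3) 0)^[k₀] ∘ stepPow μ p) :=
    ((IsInvDiffOp.eps 1 0).iterate k₀).comp (isInvDiffOp_stepPow μ p)
  have hD : IsInvDiffOp ((eps (2 : Fin 3) 1)^[q + k₀] ∘ ((eps (1 : Fin 3) 0)^[k₀] ∘ stepPow μ p)) :=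
    ((IsInvDiffOp.eps 2 1).iterate (q + k₀)).comp hD0
  have hmem : ∀ f ∈ principalSeries ξ lam,
      rest (0 : Fin 3) (((eps (2 : Fin 3) 1)^[q + k₀] ∘
        ((eps (1 : Fin 3) 0)^[k₀] ∘ stepPow μ p)) f) ∈ principalSeries η ν := by
    intro f hf
    -- After the first two operators the weight difference plus one is `λ₃ - λ₂ + k₀ - p`, which by
    -- `hlam` equals `q + k₀`, the exponent of `ε 2 1`.
    have hw := (((isSingular_of_mem_principalSeries hf).stepPow (μ := μ)
      (by rw [hμ]; ring) p).iterate_eps_one_zero k₀).iterate_eps_two_one (N := q + k₀)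
      (by push_cast at hlam ⊢; linear_combination -hlam)
    push_cast at hn₁ hn₂ hη₁ hη₂
    refine hw.rest_mem (fun x _ => ?_) (fun x _ => ?_)
    · congr 1
      · rw [hη₁]
        push_cast
        linear_combination -natCast_add_self_zmod_two k₀ - natCast_add_self_zmod_two p -
          natCast_add_self_zmod_two q
      · push_cast
        linear_combination hn₂ - hn₁
    · congr 1
      · rw [hη₂]
        push_cast
        ring
      · push_cast
        linear_combination hn₁
  obtain ⟨T, hT⟩ := exists_mem_DSBO hD 0 hmem
  refine ⟨T, fun f => ?_, fun f hf => ?_⟩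
  · rw [hT]
    have h2 := calDPow_two_eqOn_slice f.2.1 lam p
    have h1 := calDPow_one_eqOn_slice h2.1 ((isInvDiffOp_stepPow μ p).smooth f.2.1) h2.2
      (lam - (p : ℂ) • Pi.single 2 1) k₀
    have h3 := rest_congr_of_eqOn_slice h1.2
    simp only [Function.comp_apply]
    rw [h3]
    exact (iterate_eps_rest (hD0.smooth f.2.1) (q + k₀)).symm
  · rw [hT]
    have hm := ((hf.stepPow μ p).iterate_eps_one_zero k₀).iterate_eps_two_one (q + k₀)
    have e1 : k₀ + p - p - k₀ = 0 := by omega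
    have e2 : k₀ + p + q - p - (q + k₀) = 0 := by omega
    rw [e1, e2] at hm
    rw [Function.comp_apply, Function.comp_apply, hm.rest_one, one_mul, ← Nat.cast_mul,
      ← Nat.cast_mul, Nat.cast_ne_zero]
    simp only [ne_eq, mul_eq_zero, Nat.descFactorial_eq_zero_iff_lt]
    omega

end Existence

/-! ### Hadamard's lemma -/

section Hadamard

/-- Differentiation under the integral sign, by induction on the order. The target `F` stays general
because the derivative takes values in the operators from `E` to `F`. -/
lemma contDiff_nat_intervalIntegral {E : Type} [NormedAddCommGroup E] [NormedSpace ℝ E]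
    [FiniteDimensional ℝ E] (n : ℕ) : ∀ {F : Type} [NormedAddCommGroup F] [NormedSpace ℝ F]
    [CompleteSpace F] {Φ : E × ℝ → F}, ContDiff ℝ ∞ Φ →
      ContDiff ℝ n fun v => ∫ t in (0 : ℝ)..1, Φ (v, t) := by
  induction n with
  | zero =>
    intro F _ _ _ Φ hΦ
    refine contDiff_zero.2 ?_
    exact intervalIntegral.continuous_parametric_intervalIntegral_of_continuous'
      (f := fun v t => Φ (v, t)) hΦ.continuous 0 1
  | succ n ih =>
    intro F _ _ _ Φ hΦ
    have := FiniteDimensional.proper ℝ E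
    have hΦ' : ContDiff ℝ ∞ fun p : E × ℝ =>
        (fderiv ℝ Φ p).comp (ContinuousLinearMap.inl ℝ E ℝ) :=
      (hΦ.fderiv_right (m := ∞) (by simp)).clm_comp contDiff_const
    refine contDiff_succ_iff_hasFDerivAt.2 ⟨_, ih hΦ', fun v => ?_⟩
    -- Compactness supplies a constant as dominating function near `v`.
    have hK : IsCompact (Metric.closedBall v 1 ×ˢ Set.Icc (0 : ℝ) 1) :=
      (isCompact_closedBall v 1).prod isCompact_Icc
    obtain ⟨C, hC⟩ := hK.exists_bound_of_continuousOn hΦ'.continuous.continuousOn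
    refine intervalIntegral.hasFDerivAt_integral_of_dominated_of_fderiv_le (s := Metric.ball v 1)
      (F := fun v t => Φ (v, t)) (bound := fun _ => C)
      (F' := fun v t => (fderiv ℝ Φ (v, t)).comp (ContinuousLinearMap.inl ℝ E ℝ))
      (Metric.ball_mem_nhds v one_pos) (Eventually.of_forall fun x => ?_) ?_ ?_ ?_ ?_ ?_
    · exact (hΦ.continuous.comp (by fun_prop : Continuous fun t => (x, t))).aestronglyMeasurable
    · exact (hΦ.continuous.comp (by fun_prop : Continuous fun t => (v, t))).intervalIntegrable _ _
    · exact (hΦ'.continuous.comp (by fun_prop : Continuous fun t => (v, t))).aestronglyMeasurable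
    · refine Eventually.of_forall fun t ht x hx => hC (x, t) ⟨Metric.ball_subset_closedBall hx, ?_⟩
      rw [Set.uIoc_of_le zero_le_one] at ht
      exact ⟨ht.1.le, ht.2⟩
    · exact intervalIntegrable_const
    · refine Eventually.of_forall fun t _ x _ => ?_
      have h1 : HasFDerivAt Φ (fderiv ℝ Φ (x, t)) (x, t) :=
        (hΦ.differentiable (by simp) (x, t)).hasFDerivAt
      exact h1.comp x (hasFDerivAt_prodMk_left x t)

lemma contDiff_intervalIntegral {E F : Type} [NormedAddCommGroup E] [NormedSpace ℝ E]
    [FiniteDimensional ℝ E] [NormedAddCommGroup F] [NormedSpace ℝ F]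
    [CompleteSpace F] {Φ : E × ℝ → F} (hΦ : ContDiff ℝ ∞ Φ) :
    ContDiff ℝ ∞ fun v => ∫ t in (0 : ℝ)..1, Φ (v, t) :=
  contDiff_infty.2 fun n => contDiff_nat_intervalIntegral n hΦ

/-- **Hadamard's lemma** in three variables. -/
lemma exists_hadamard {G : ℝ × ℝ × ℝ → ℂ} (hG : ContDiff ℝ ∞ G) :
    ∃ G₁ G₂ G₃ : ℝ × ℝ × ℝ → ℂ, ContDiff ℝ ∞ G₁ ∧ ContDiff ℝ ∞ G₂ ∧ ContDiff ℝ ∞ G₃ ∧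
      ∀ v, G v = G 0 + v.1 * G₁ v + v.2.1 * G₂ v + v.2.2 * G₃ v := by
  have hs : ∀ e : ℝ × ℝ × ℝ, ContDiff ℝ ∞ fun p : (ℝ × ℝ × ℝ) × ℝ => fderiv ℝ G (p.2 • p.1) e :=
    fun e => ((hG.fderiv_right (m := ∞) (by simp)).comp
      (contDiff_snd.smul contDiff_fst)).clm_apply contDiff_const
  refine ⟨_, _, _, contDiff_intervalIntegral (hs (1, 0, 0)),
    contDiff_intervalIntegral (hs (0, 1, 0)), contDiff_intervalIntegral (hs (0, 0, 1)),
    fun v => ?_⟩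
  have hi : ∀ e : ℝ × ℝ × ℝ, IntervalIntegrable (fun t : ℝ => fderiv ℝ G (t • v) e)
      MeasureTheory.volume 0 1 := fun e =>
    ((hs e).continuous.comp (by fun_prop : Continuous fun t : ℝ => (v, t))).intervalIntegrable _ _
  -- The three factors arise by integrating the derivative of `G` along the segment from `0` to `v`.
  have hd : ∀ t ∈ Set.uIcc (0 : ℝ) 1,
      HasDerivAt (fun t : ℝ => G (t • v)) (fderiv ℝ G (t • v) v) t := fun t _ => by
    have h1 : HasFDerivAt G (fderiv ℝ G (t • v)) (t • v) :=
      (hG.differentiable (by simp) _).hasFDerivAt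
    have h2 : HasDerivAt (fun t : ℝ => t • v) v t := by
      simpa using (hasDerivAt_id t).smul_const v
    exact h1.comp_hasDerivAt t h2
  have key := intervalIntegral.integral_eq_sub_of_hasDerivAt hd (hi v)
  rw [one_smul, zero_smul] at key
  have hv : ∀ t : ℝ, fderiv ℝ G (t • v) v = v.1 * fderiv ℝ G (t • v) (1, 0, 0) +
      v.2.1 * fderiv ℝ G (t • v) (0, 1, 0) + v.2.2 * fderiv ℝ G (t • v) (0, 0, 1) := fun t => by
    have : v = v.1 • ((1, 0, 0) : ℝ × ℝ × ℝ) + v.2.1 • ((0, 1, 0) : ℝ × ℝ × ℝ) +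
        v.2.2 • ((0, 0, 1) : ℝ × ℝ × ℝ) := by
      ext <;> simp
    refine (congrArg (fderiv ℝ G (t • v)) this).trans ?_
    simp only [map_add, map_smul, Complex.real_smul]
  simp only [hv] at key
  rw [intervalIntegral.integral_add (((hi _).const_mul _).add ((hi _).const_mul _))
    ((hi _).const_mul _), intervalIntegral.integral_add ((hi _).const_mul _) ((hi _).const_mul _),
    intervalIntegral.integral_const_mul, intervalIntegral.integral_const_mul,
    intervalIntegral.integral_const_mul] at key
  linear_combination -key

end Hadamard

/-! ### Homogeneous functionals invariant under the shear -/

section Homogeneous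

/-- The function `x^a y^b z^c G`. -/
def monoMul (a b c : ℕ) (G : ℝ × ℝ × ℝ → ℂ) : ℝ × ℝ × ℝ → ℂ :=
  fun v => (v.1 : ℂ) ^ a * (v.2.1 : ℂ) ^ b * (v.2.2 : ℂ) ^ c * G v

lemma contDiff_ofReal_comp {E : Type*} [NormedAddCommGroup E] [NormedSpace ℝ E] {f : E → ℝ}
    (hf : ContDiff ℝ ∞ f) : ContDiff ℝ ∞ fun v => (f v : ℂ) := Complex.ofRealCLM.contDiff.comp hf

lemma contDiff_monoMul (a b c : ℕ) {G : ℝ × ℝ × ℝ → ℂ} (hG : ContDiff ℝ ∞ G) :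
    ContDiff ℝ ∞ (monoMul a b c G) :=
  ((((contDiff_ofReal_comp contDiff_fst).pow a).mul
    ((contDiff_ofReal_comp (contDiff_fst.comp contDiff_snd)).pow b)).mul
    ((contDiff_ofReal_comp (contDiff_snd.comp contDiff_snd)).pow c)).mul hG

/-- A linear functional which is homogeneous of bidegree `(n₂, n₁)` under the dilations
`(s x, s t y, t z)`, bounded on smooth families and invariant under the shear `x ↦ x + y` with a
multiplier depending on `z`. -/
structure IsHomogeneous (n₁ n₂ : ℕ) (U : (ℝ × ℝ × ℝ → ℂ) →ₗ[ℂ] ℂ) : Prop where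
  scale : ∀ s t : ℝ, s ≠ 0 → t ≠ 0 → ∀ F : ℝ × ℝ × ℝ → ℂ, ContDiff ℝ ∞ F →
    U (fun v => F (s * v.1, s * t * v.2.1, t * v.2.2)) = (s : ℂ) ^ n₂ * (t : ℂ) ^ n₁ * U F
  bounded : ∀ Γ : ℝ × ℝ × ℝ × ℝ → ℂ, ContDiff ℝ ∞ Γ →
    ∃ C, ∀ t ∈ Set.Icc (0 : ℝ) 1, ‖U fun v => Γ (t, v)‖ ≤ C
  shear : ∀ a b c : ℕ, ∃ H : ℝ → ℂ, ContDiff ℝ ∞ H ∧ H 0 = 1 ∧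
    U (fun v => ((v.1 : ℂ) + v.2.1) ^ a * (v.2.1 : ℂ) ^ b * (v.2.2 : ℂ) ^ c * H v.2.2) =
      U (monoMul a b c 1)

variable {n₁ n₂ : ℕ} {U : (ℝ × ℝ × ℝ → ℂ) →ₗ[ℂ] ℂ}

namespace IsHomogeneous

/-- Letting `t` tend to `0` from above, `t ^ k` goes to zero while the family stays bounded. -/
lemma eq_zero_of_family (hU : IsHomogeneous n₁ n₂ U) {F : ℝ × ℝ × ℝ → ℂ}
    {Γ : ℝ × ℝ × ℝ × ℝ → ℂ} (hΓ : ContDiff ℝ ∞ Γ) {k : ℕ} (hk : k ≠ 0)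
    (h : ∀ t : ℝ, t ≠ 0 → U F = (t : ℂ) ^ k * U fun v => Γ (t, v)) : U F = 0 := by
  obtain ⟨C, hC⟩ := hU.bounded Γ hΓ
  have h1 : ∀ᶠ t : ℝ in 𝓝[>] 0, ‖U F‖ ≤ t ^ k * C := by
    filter_upwards [Ioc_mem_nhdsGT (zero_lt_one' ℝ)] with t ht
    rw [h t ht.1.ne', norm_mul, norm_pow, Complex.norm_real, Real.norm_of_nonneg ht.1.le]
    exact mul_le_mul_of_nonneg_left (hC t ⟨ht.1.le, ht.2⟩) (pow_nonneg ht.1.le k)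
  have h2 : Tendsto (fun t : ℝ => t ^ k * C) (𝓝[>] 0) (𝓝 0) := by
    have : ContinuousAt (fun t : ℝ => t ^ k * C) 0 := by fun_prop
    have h3 := this.tendsto
    simp only [zero_pow hk, zero_mul] at h3
    exact h3.mono_left nhdsWithin_le_nhds
  exact norm_le_zero_iff.1 (ge_of_tendsto h2 h1)

/-- The dilation by `t` in `y` and `z` extracts `t ^ (b + c)` and leaves a family smooth up to `t =
0`; comparison with the degree `n₁` leaves a positive power of `t`. -/
lemma monoMul_eq_zero_of_lt_right (hU : IsHomogeneous n₁ n₂ U) {a b c : ℕ} (h : n₁ < b + c)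
    {G : ℝ × ℝ × ℝ → ℂ} (hG : ContDiff ℝ ∞ G) : U (monoMul a b c G) = 0 := by
  obtain ⟨k, hk⟩ := Nat.exists_eq_add_of_lt h
  refine hU.eq_zero_of_family (k := k + 1)
    (Γ := fun p => monoMul a b c (fun v => G (v.1, p.1 * v.2.1, p.1 * v.2.2)) p.2) ?_
    (Nat.succ_ne_zero k) fun t ht => ?_
  · have h1 : ContDiff ℝ ∞ fun p : ℝ × ℝ × ℝ × ℝ =>
        G (p.2.1, p.1 * p.2.2.1, p.1 * p.2.2.2) := hG.comp (by fun_prop)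
    have h2 := ((contDiff_monoMul a b c contDiff_const (G := fun _ => 1)).comp contDiff_snd).mul h1
    simpa only [monoMul, Function.comp_def, mul_one] using h2
  · have h1 := hU.scale 1 t one_ne_zero ht _ (contDiff_monoMul a b c hG)
    have h2 : (fun v : ℝ × ℝ × ℝ => monoMul a b c G (1 * v.1, 1 * t * v.2.1, t * v.2.2)) =
        ((t : ℂ) ^ (b + c)) •
          monoMul a b c (fun v => G (v.1, t * v.2.1, t * v.2.2)) := by
      funext v
      simp only [monoMul, one_mul, Pi.smul_apply, smul_eq_mul]
      push_cast
      ring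
    rw [h2, map_smul, smul_eq_mul, Complex.ofReal_one, one_pow, one_mul] at h1
    have h3 : (t : ℂ) ^ n₁ ≠ 0 := pow_ne_zero _ (by exact_mod_cast ht)
    apply mul_left_cancel₀ h3
    rw [← h1, hk, ← mul_assoc, ← pow_add, add_assoc]

lemma monoMul_eq_zero_of_lt_left (hU : IsHomogeneous n₁ n₂ U) {a b c : ℕ} (h : n₂ < a + b)
    {G : ℝ × ℝ × ℝ → ℂ} (hG : ContDiff ℝ ∞ G) : U (monoMul a b c G) = 0 := by
  obtain ⟨k, hk⟩ := Nat.exists_eq_add_of_lt h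
  refine hU.eq_zero_of_family (k := k + 1)
    (Γ := fun p => monoMul a b c (fun v => G (p.1 * v.1, p.1 * v.2.1, v.2.2)) p.2) ?_
    (Nat.succ_ne_zero k) fun t ht => ?_
  · have h1 : ContDiff ℝ ∞ fun p : ℝ × ℝ × ℝ × ℝ =>
        G (p.1 * p.2.1, p.1 * p.2.2.1, p.2.2.2) := hG.comp (by fun_prop)
    have h2 := ((contDiff_monoMul a b c contDiff_const (G := fun _ => 1)).comp contDiff_snd).mul h1
    simpa only [monoMul, Function.comp_def, mul_one] using h2
  · have h1 := hU.scale t 1 ht one_ne_zero _ (contDiff_monoMul a b c hG)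
    have h2 : (fun v : ℝ × ℝ × ℝ => monoMul a b c G (t * v.1, t * 1 * v.2.1, 1 * v.2.2)) =
        ((t : ℂ) ^ (a + b)) •
          monoMul a b c (fun v => G (t * v.1, t * v.2.1, v.2.2)) := by
      funext v
      simp only [monoMul, one_mul, mul_one, Pi.smul_apply, smul_eq_mul]
      push_cast
      ring
    rw [h2, map_smul, smul_eq_mul, Complex.ofReal_one, one_pow, mul_one] at h1
    have h3 : (t : ℂ) ^ n₂ ≠ 0 := pow_ne_zero _ (by exact_mod_cast ht)
    apply mul_left_cancel₀ h3
    rw [← h1, hk, ← mul_assoc, ← pow_add, add_assoc]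

/-- A pure monomial is an eigenvector of the dilation by `2`, with an eigenvalue other than the one
prescribed for `U`. -/
lemma monoMul_one_eq_zero_right (hU : IsHomogeneous n₁ n₂ U) {a b c : ℕ} (h : b + c ≠ n₁) :
    U (monoMul a b c 1) = 0 := by
  have h1 := hU.scale 1 2 one_ne_zero two_ne_zero _ (contDiff_monoMul a b c contDiff_const
    (G := fun _ => 1))
  have h2 : (fun v : ℝ × ℝ × ℝ => monoMul a b c (fun _ => 1) (1 * v.1, 1 * 2 * v.2.1, 2 * v.2.2)) =
      ((2 : ℂ) ^ (b + c)) • monoMul a b c (fun _ => 1) := by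
    funext v
    simp only [monoMul, one_mul, Pi.smul_apply, smul_eq_mul]
    push_cast
    ring
  rw [h2, map_smul, smul_eq_mul, Complex.ofReal_one, one_pow, one_mul] at h1
  push_cast at h1
  have h3 : (2 : ℂ) ^ (b + c) - (2 : ℂ) ^ n₁ ≠ 0 := by
    rw [sub_ne_zero]
    intro hcon
    have : (2 : ℕ) ^ (b + c) = 2 ^ n₁ := by exact_mod_cast hcon
    exact h (Nat.pow_right_injective le_rfl this)
  have h4 : ((2 : ℂ) ^ (b + c) - (2 : ℂ) ^ n₁) * U (monoMul a b c 1) = 0 := by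
    linear_combination h1
  exact (mul_eq_zero.1 h4).resolve_left h3

lemma monoMul_one_eq_zero_left (hU : IsHomogeneous n₁ n₂ U) {a b c : ℕ} (h : a + b ≠ n₂) :
    U (monoMul a b c 1) = 0 := by
  have h1 := hU.scale 2 1 two_ne_zero one_ne_zero _ (contDiff_monoMul a b c contDiff_const
    (G := fun _ => 1))
  have h2 : (fun v : ℝ × ℝ × ℝ => monoMul a b c (fun _ => 1) (2 * v.1, 2 * 1 * v.2.1, 1 * v.2.2)) =
      ((2 : ℂ) ^ (a + b)) • monoMul a b c (fun _ => 1) := by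
    funext v
    simp only [monoMul, one_mul, mul_one, Pi.smul_apply, smul_eq_mul]
    push_cast
    ring
  rw [h2, map_smul, smul_eq_mul, Complex.ofReal_one, one_pow, mul_one] at h1
  push_cast at h1
  have h3 : (2 : ℂ) ^ (a + b) - (2 : ℂ) ^ n₂ ≠ 0 := by
    rw [sub_ne_zero]
    intro hcon
    have : (2 : ℕ) ^ (a + b) = 2 ^ n₂ := by exact_mod_cast hcon
    exact h (Nat.pow_right_injective le_rfl this)
  have h4 : ((2 : ℂ) ^ (a + b) - (2 : ℂ) ^ n₂) * U (monoMul a b c 1) = 0 := by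
    linear_combination h1
  exact (mul_eq_zero.1 h4).resolve_left h3

end IsHomogeneous

lemma exists_monoMul_expansion {G : ℝ × ℝ × ℝ → ℂ} (hG : ContDiff ℝ ∞ G) :
    ∃ G₁ G₂ G₃ : ℝ × ℝ × ℝ → ℂ, ContDiff ℝ ∞ G₁ ∧ ContDiff ℝ ∞ G₂ ∧ ContDiff ℝ ∞ G₃ ∧
      ∀ a b c, monoMul a b c G = G 0 • monoMul a b c 1 + monoMul (a + 1) b c G₁ +
        monoMul a (b + 1) c G₂ + monoMul a b (c + 1) G₃ := by
  obtain ⟨G₁, G₂, G₃, h₁, h₂, h₃, h⟩ := exists_hadamard hG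
  refine ⟨G₁, G₂, G₃, h₁, h₂, h₃, fun a b c => funext fun v => ?_⟩
  simp only [monoMul, Pi.add_apply, Pi.smul_apply, smul_eq_mul, Pi.one_apply]
  rw [h v]
  ring

/-- Only the terms of order at most one in `y` matter in the shear argument; the rest is absorbed
into a smooth multiple of `y²`. -/
lemma exists_add_pow_expansion (a : ℕ) : ∃ P : ℝ × ℝ × ℝ → ℂ, ContDiff ℝ ∞ P ∧
    ∀ v : ℝ × ℝ × ℝ, ((v.1 : ℂ) + v.2.1) ^ (a + 1) =
      (v.1 : ℂ) ^ (a + 1) + (a + 1) * (v.1 : ℂ) ^ a * v.2.1 + (v.2.1 : ℂ) ^ 2 * P v := by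
  induction a with
  | zero => exact ⟨0, contDiff_const, fun v => by simp⟩
  | succ a ih =>
    obtain ⟨P, hP, h⟩ := ih
    have hx : ContDiff ℝ ∞ fun v : ℝ × ℝ × ℝ => (v.1 : ℂ) := contDiff_ofReal_comp contDiff_fst
    have hy : ContDiff ℝ ∞ fun v : ℝ × ℝ × ℝ => (v.2.1 : ℂ) :=
      contDiff_ofReal_comp (contDiff_fst.comp contDiff_snd)
    refine ⟨fun v => (a + 1) * (v.1 : ℂ) ^ a + ((v.1 : ℂ) + v.2.1) * P v,
      (contDiff_const.mul (hx.pow a)).add ((hx.add hy).mul hP), fun v => ?_⟩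
    rw [pow_succ, h v]
    push_cast
    ring

namespace IsHomogeneous

/-- Any further factor `x`, `y` or `z` exceeds one of the two degrees, so only the constant term of
`G` survives. -/
lemma monoMul_eq_of_critical (hU : IsHomogeneous n₁ n₂ U) {a b c : ℕ} (h₂ : a + b = n₂)
    (h₁ : b + c = n₁) {G : ℝ × ℝ × ℝ → ℂ} (hG : ContDiff ℝ ∞ G) :
    U (monoMul a b c G) = G 0 * U (monoMul a b c 1) := by
  obtain ⟨G₁, G₂, G₃, hG₁, hG₂, hG₃, h⟩ := exists_monoMul_expansion hG
  rw [h, map_add, map_add, map_add, map_smul, smul_eq_mul,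
    hU.monoMul_eq_zero_of_lt_left (by omega) hG₁, hU.monoMul_eq_zero_of_lt_left (by omega) hG₂,
    hU.monoMul_eq_zero_of_lt_right (by omega) hG₃]
  ring

/-- The shear is applied to `x^(a+1) y^b z^c`, whose degree in `t` is one short, so that `U`
vanishes on it. After expansion the term linear in `y` gives `(a + 1) U(x^a y^(b+1) z^c)`. The
first-order term of the multiplier `H` only contributes the critical monomial `x^(a+1) y^b z^(c+1)`,
which is covered by induction. -/
lemma critical_eq_zero (hU : IsHomogeneous n₁ n₂ U) (h0 : U (monoMul n₂ 0 n₁ 1) = 0) (b : ℕ) :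
    ∀ {a c : ℕ}, a + b = n₂ → b + c = n₁ → U (monoMul a b c 1) = 0 := by
  induction b with
  | zero =>
    intro a c ha hc
    obtain rfl : a = n₂ := by omega
    obtain rfl : c = n₁ := by omega
    exact h0
  | succ b ih =>
    intro a c ha hc
    obtain ⟨H, hH, hH0, hs⟩ := hU.shear (a + 1) b c
    obtain ⟨P, hP, hexp⟩ := exists_add_pow_expansion a
    have hH' : ContDiff ℝ ∞ fun v : ℝ × ℝ × ℝ => H v.2.2 :=
      hH.comp (contDiff_snd.comp contDiff_snd)
    have e : (fun v : ℝ × ℝ × ℝ => ((v.1 : ℂ) + v.2.1) ^ (a + 1) * (v.2.1 : ℂ) ^ b *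
        (v.2.2 : ℂ) ^ c * H v.2.2) = monoMul (a + 1) b c (fun v => H v.2.2) +
        (a + 1 : ℂ) • monoMul a (b + 1) c (fun v => H v.2.2) +
        monoMul 0 (b + 2) c (fun v => P v * H v.2.2) := by
      funext v
      simp only [monoMul, Pi.add_apply, Pi.smul_apply, smul_eq_mul]
      rw [hexp v]
      ring
    obtain ⟨G₁, G₂, G₃, hG₁, hG₂, hG₃, hexp'⟩ := exists_monoMul_expansion hH'
    rw [hU.monoMul_one_eq_zero_right (by omega), e, map_add, map_add, map_smul, smul_eq_mul,
      hU.monoMul_eq_zero_of_lt_right (by omega) (hP.mul hH'),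
      hU.monoMul_eq_of_critical ha hc hH', hexp', map_add, map_add, map_add, map_smul, smul_eq_mul,
      hU.monoMul_one_eq_zero_right (by omega), hU.monoMul_eq_zero_of_lt_left (by omega) hG₁,
      hU.monoMul_eq_zero_of_lt_left (by omega) hG₂,
      hU.monoMul_eq_of_critical (by omega) (by omega) hG₃, ih (by omega) (by omega)] at hs
    have ha0 : (a + 1 : ℂ) ≠ 0 := by exact_mod_cast Nat.succ_ne_zero a
    simp only [Prod.snd_zero, hH0, mul_zero, add_zero, zero_add, one_mul] at hs
    exact (mul_eq_zero.1 hs).resolve_left ha0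

/-- Taylor expansion by descending induction on `a + 2b + c = (a + b) + (b + c)`: once it exceeds
`n₁ + n₂`, one of the two degrees is too large. At each step Hadamard's lemma splits off a monomial
and raises this quantity. -/
lemma monoMul_eq_zero (hU : IsHomogeneous n₁ n₂ U) (h0 : U (monoMul n₂ 0 n₁ 1) = 0) (m : ℕ) :
    ∀ {a b c : ℕ}, n₁ + n₂ < a + 2 * b + c + m → ∀ {G : ℝ × ℝ × ℝ → ℂ}, ContDiff ℝ ∞ G →
      U (monoMul a b c G) = 0 := by
  induction m with
  | zero =>
    intro a b c h G hG
    by_cases h1 : n₁ < b + c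
    · exact hU.monoMul_eq_zero_of_lt_right h1 hG
    · exact hU.monoMul_eq_zero_of_lt_left (by omega) hG
  | succ m ih =>
    intro a b c h G hG
    obtain ⟨G₁, G₂, G₃, hG₁, hG₂, hG₃, hexp⟩ := exists_monoMul_expansion hG
    have h1 : U (monoMul a b c 1) = 0 := by
      by_cases h1 : b + c = n₁
      · by_cases h2 : a + b = n₂
        · exact hU.critical_eq_zero h0 b h2 h1
        · exact hU.monoMul_one_eq_zero_left h2
      · exact hU.monoMul_one_eq_zero_right h1
    rw [hexp, map_add, map_add, map_add, map_smul, h1, ih (by omega) hG₁, ih (by omega) hG₂,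
      ih (by omega) hG₃]
    simp

/-- A homogeneous shear-invariant functional is determined by its value at `x^{n₂} z^{n₁}`. -/
theorem eq_zero (hU : IsHomogeneous n₁ n₂ U) (h0 : U (monoMul n₂ 0 n₁ 1) = 0)
    {F : ℝ × ℝ × ℝ → ℂ} (hF : ContDiff ℝ ∞ F) : U F = 0 := by
  have h := hU.monoMul_eq_zero h0 (n₁ + n₂ + 1) (a := 0) (b := 0) (c := 0) (by omega) hF
  have e : monoMul 0 0 0 F = F := by
    funext v
    simp [monoMul]
  rwa [e] at h

end IsHomogeneous

end Homogeneous

/-! ### Sections supported in the big cell -/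

section BigCell

/-- The minor of the rows `2, 0` and the columns `0, 1`. -/
def minorA (A : Mat 3) : ℝ := A 2 0 * A 0 1 - A 2 1 * A 0 0

/-- The minor of the rows `2, 1` and the columns `0, 1`. -/
def minorB (A : Mat 3) : ℝ := A 2 0 * A 1 1 - A 2 1 * A 1 0

/-- The coordinates on the big cell. -/
def cellMap (A : Mat 3) : ℝ × ℝ × ℝ := (A 0 0 / A 2 0, A 1 0 / A 2 0, minorB A / minorA A)

/-- The big cell `x₀ N⁻ P`. -/
def bigCell : Set (Mat 3) := {A | A 2 0 ≠ 0 ∧ minorA A ≠ 0}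

/-- The equivariant function on the big cell with values `1` on the chart. -/
def cellFactor (ξ : Fin 3 → ZMod 2) (lam : Fin 3 → ℂ) (A : Mat 3) : ℂ :=
  sgnPow (ξ 0) (-lam 0 - 1) (A 2 0) * sgnPow (ξ 1) (-lam 1) (minorA A / A 2 0) *
    sgnPow (ξ 2) (-lam 2 + 1) ((Matrix.of A).det / minorA A)

open Classical in
/-- The function on matrices supported in the big cell given by a function in the chart. -/
def cellFun (ξ : Fin 3 → ZMod 2) (lam : Fin 3 → ℂ) (φ : ℝ × ℝ × ℝ → ℂ) (A : Mat 3) : ℂ :=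
  if A ∈ bigCell then cellFactor ξ lam A * φ (cellMap A) else 0

/-- The section of a principal series given by a function in the chart. -/
def cellSection (ξ : Fin 3 → ZMod 2) (lam : Fin 3 → ℂ) (φ : ℝ × ℝ × ℝ → ℂ) :
    GL (Fin 3) ℝ → ℂ := fun g => cellFun ξ lam φ (entries g)

variable {ξ : Fin 3 → ZMod 2} {lam : Fin 3 → ℂ}

lemma contDiff_minorA : ContDiff ℝ ∞ minorA := by
  unfold minorA
  fun_prop

lemma contDiff_minorB : ContDiff ℝ ∞ minorB := by
  unfold minorB
  fun_prop

lemma contDiff_det_of : ContDiff ℝ ∞ fun A : Mat 3 => (Matrix.of A).det := by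
  simp only [Matrix.det_fin_three, Matrix.of_apply]
  fun_prop

lemma isOpen_bigCell : IsOpen bigCell :=
  (isOpen_ne_fun (by fun_prop) continuous_const).inter
    (isOpen_ne_fun contDiff_minorA.continuous continuous_const)

lemma det_entries_ne_zero (g : GL (Fin 3) ℝ) : (Matrix.of (entries g)).det ≠ 0 :=
  ((Matrix.isUnit_iff_isUnit_det _).1 g.isUnit).ne_zero

lemma contDiffAt_cellMap {A : Mat 3} (hA : A ∈ bigCell) : ContDiffAt ℝ ∞ cellMap A := by
  have h1 : ContDiffAt ℝ ∞ (fun A : Mat 3 => A 0 0 / A 2 0) A :=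
    ContDiffAt.div (by fun_prop) (by fun_prop) hA.1
  have h2 : ContDiffAt ℝ ∞ (fun A : Mat 3 => A 1 0 / A 2 0) A :=
    ContDiffAt.div (by fun_prop) (by fun_prop) hA.1
  exact h1.prodMk (h2.prodMk
    (contDiff_minorB.contDiffAt.div contDiff_minorA.contDiffAt hA.2))

lemma contDiffAt_cellFactor {A : Mat 3} (hA : A ∈ bigCell) (hd : (Matrix.of A).det ≠ 0) :
    ContDiffAt ℝ ∞ (cellFactor ξ lam) A := by
  have h0 : ContDiffAt ℝ ∞ (fun A : Mat 3 => A 2 0) A := by fun_prop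
  have h1 := (contDiffAt_sgnPow (ξ 0) (-lam 0 - 1) hA.1).comp A h0
  have h2 := (contDiffAt_sgnPow (ξ 1) (-lam 1) (div_ne_zero hA.2 hA.1)).comp A
    (contDiff_minorA.contDiffAt.div h0 hA.1)
  have h3 := (contDiffAt_sgnPow (ξ 2) (-lam 2 + 1) (div_ne_zero hd hA.2)).comp A
    (contDiff_det_of.contDiffAt.div contDiff_minorA.contDiffAt hA.2)
  exact (h1.mul h2).mul h3

/-- Smoothness of the extension by zero, jointly with a parameter for later uniform bounds. The
bound `R` confines the support to the closed set `Z`, whose invertible elements all lie in the big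
cell. -/
lemma contDiffAt_cellFun {Φ : ℝ × ℝ × ℝ × ℝ → ℂ} (hΦ : ContDiff ℝ ∞ Φ) {R : ℝ}
    (hR : ∀ p, Φ p ≠ 0 → ‖p.2‖ ≤ R) (s : ℝ) (g : GL (Fin 3) ℝ) :
    ContDiffAt ℝ ∞ (fun q : ℝ × Mat 3 => cellFun ξ lam (fun v => Φ (q.1, v)) q.2)
      (s, entries g) := by
  by_cases hg : entries g ∈ bigCell
  · have h1 : ContDiffAt ℝ ∞ (fun q : ℝ × Mat 3 => cellFactor ξ lam q.2 * Φ (q.1, cellMap q.2))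
        (s, entries g) := by
      have e1 : ContDiffAt ℝ ∞ (fun q : ℝ × Mat 3 => cellFactor ξ lam q.2) (s, entries g) :=
        ContDiffAt.comp (s, entries g) (contDiffAt_cellFactor hg (det_entries_ne_zero g))
          contDiffAt_snd
      have e2 : ContDiffAt ℝ ∞ (fun q : ℝ × Mat 3 => cellMap q.2) (s, entries g) :=
        ContDiffAt.comp (s, entries g) (contDiffAt_cellMap hg) contDiffAt_snd
      exact e1.mul (hΦ.contDiffAt.comp (s, entries g) (contDiffAt_fst.prodMk e2))
    refine h1.congr_of_eventuallyEq ?_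
    have h2 : ∀ᶠ q : ℝ × Mat 3 in 𝓝 (s, entries g), q.2 ∈ bigCell :=
      continuous_snd.continuousAt.eventually (isOpen_bigCell.mem_nhds hg)
    filter_upwards [h2] with q hq
    rw [cellFun, if_pos hq]
  · set Z : Set (Mat 3) := {A | (|A 0 0| ≤ R * |A 2 0| ∧ |A 1 0| ≤ R * |A 2 0|) ∧
        |minorB A| ≤ R * |minorA A|} with hZdef
    have hZ : IsClosed Z := by
      have hA := contDiff_minorA.continuous
      have hB := contDiff_minorB.continuous
      have c1 : IsClosed {A : Mat 3 | |A 0 0| ≤ R * |A 2 0|} := isClosed_le (by fun_prop) (by fun_prop)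
      have c2 : IsClosed {A : Mat 3 | |A 1 0| ≤ R * |A 2 0|} := isClosed_le (by fun_prop) (by fun_prop)
      have c3 : IsClosed {A : Mat 3 | |minorB A| ≤ R * |minorA A|} :=
        isClosed_le (by fun_prop) (by fun_prop)
      exact (c1.inter c2).inter c3
    have hgZ : entries g ∉ Z := by
      rintro ⟨⟨h1, h2⟩, h3⟩
      refine hg ⟨fun h0 => det_entries_ne_zero g ?_, fun h0 => det_entries_ne_zero g ?_⟩
      · rw [h0, abs_zero, mul_zero, abs_nonpos_iff] at h1 h2
        rw [Matrix.det_fin_three]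
        simp only [Matrix.of_apply, h0, h1, h2]
        ring
      · rw [h0, abs_zero, mul_zero, abs_nonpos_iff] at h3
        by_cases h20 : entries g 2 0 = 0
        · rw [h20, abs_zero, mul_zero, abs_nonpos_iff] at h1 h2
          rw [Matrix.det_fin_three]
          simp only [Matrix.of_apply, h20, h1, h2]
          ring
        -- Condensation with pivot `A 2 0`: the pivot times the determinant is a combination of
        -- `minorA` and `minorB`, both of which vanish.
        · refine (mul_eq_zero.1 (?_ : entries g 2 0 * (Matrix.of (entries g)).det = 0)).resolve_left
            h20
          rw [Matrix.det_fin_three]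
          simp only [Matrix.of_apply]
          unfold minorA at h0
          unfold minorB at h3
          linear_combination
            (entries g 1 2 * entries g 2 0 - entries g 1 0 * entries g 2 2) * h0 -
              (entries g 0 2 * entries g 2 0 - entries g 0 0 * entries g 2 2) * h3
    have h2 : ∀ᶠ q : ℝ × Mat 3 in 𝓝 (s, entries g), q.2 ∈ Zᶜ :=
      continuous_snd.continuousAt.eventually (hZ.isOpen_compl.mem_nhds hgZ)
    refine (contDiffAt_const (c := (0 : ℂ))).congr_of_eventuallyEq ?_
    filter_upwards [h2] with q hq
    rw [cellFun]
    split_ifs with hc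
    · by_cases h0 : Φ (q.1, cellMap q.2) = 0
      · rw [h0, mul_zero]
      · refine absurd ?_ hq
        have h3 := hR _ h0
        simp only [cellMap, Prod.norm_def, sup_le_iff, Real.norm_eq_abs, abs_div] at h3
        rw [div_le_iff₀ (abs_pos.2 hc.1), div_le_iff₀ (abs_pos.2 hc.1),
          div_le_iff₀ (abs_pos.2 hc.2)] at h3
        exact ⟨⟨h3.1, h3.2.1⟩, h3.2.2⟩
    · rfl

lemma cellSection_mul (φ : ℝ × ℝ × ℝ → ℂ) (g : GL (Fin 3) ℝ) {p : GL (Fin 3) ℝ}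
    (hp : p ∈ borel 3) :
    cellSection ξ lam φ (g * p) = inducingFactor ξ lam p * cellSection ξ lam φ g := by
  have p10 : (p : Matrix (Fin 3) (Fin 3) ℝ) 1 0 = 0 := hp 1 0 (by decide)
  have p20 : (p : Matrix (Fin 3) (Fin 3) ℝ) 2 0 = 0 := hp 2 0 (by decide)
  have p21 : (p : Matrix (Fin 3) (Fin 3) ℝ) 2 1 = 0 := hp 2 1 (by decide)
  have hdet : (p : Matrix (Fin 3) (Fin 3) ℝ).det = (p : Matrix (Fin 3) (Fin 3) ℝ) 0 0 *
      (p : Matrix (Fin 3) (Fin 3) ℝ) 1 1 * (p : Matrix (Fin 3) (Fin 3) ℝ) 2 2 := by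
    rw [Matrix.det_fin_three, p10, p20, p21]
    ring
  have hd0 : (p : Matrix (Fin 3) (Fin 3) ℝ).det ≠ 0 := det_entries_ne_zero p
  rw [hdet] at hd0
  have q2 := right_ne_zero_of_mul hd0
  have q1 := right_ne_zero_of_mul (left_ne_zero_of_mul hd0)
  have q0 := left_ne_zero_of_mul (left_ne_zero_of_mul hd0)
  have c0 : ∀ i, entries (g * p) i 0 = entries g i 0 * (p : Matrix (Fin 3) (Fin 3) ℝ) 0 0 := by
    intro i
    change ((g : Matrix (Fin 3) (Fin 3) ℝ) * (p : Matrix (Fin 3) (Fin 3) ℝ)) i 0 = _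
    rw [Matrix.mul_apply, Fin.sum_univ_three, p10, p20]
    simp [entries]
  have c1 : ∀ i, entries (g * p) i 1 = entries g i 0 * (p : Matrix (Fin 3) (Fin 3) ℝ) 0 1 +
      entries g i 1 * (p : Matrix (Fin 3) (Fin 3) ℝ) 1 1 := by
    intro i
    change ((g : Matrix (Fin 3) (Fin 3) ℝ) * (p : Matrix (Fin 3) (Fin 3) ℝ)) i 1 = _
    rw [Matrix.mul_apply, Fin.sum_univ_three, p21]
    simp [entries]
  have hA : minorA (entries (g * p)) = minorA (entries g) *
      ((p : Matrix (Fin 3) (Fin 3) ℝ) 0 0 * (p : Matrix (Fin 3) (Fin 3) ℝ) 1 1) := by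
    simp only [minorA, c0, c1]
    ring
  have hB : minorB (entries (g * p)) = minorB (entries g) *
      ((p : Matrix (Fin 3) (Fin 3) ℝ) 0 0 * (p : Matrix (Fin 3) (Fin 3) ℝ) 1 1) := by
    simp only [minorB, c0, c1]
    ring
  have hD : (Matrix.of (entries (g * p))).det = (Matrix.of (entries g)).det *
      ((p : Matrix (Fin 3) (Fin 3) ℝ) 0 0 *
      (p : Matrix (Fin 3) (Fin 3) ℝ) 1 1 * (p : Matrix (Fin 3) (Fin 3) ℝ) 2 2) := by
    rw [← hdet]
    exact Matrix.det_mul _ _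
  have hcell : entries (g * p) ∈ bigCell ↔ entries g ∈ bigCell := by
    simp only [bigCell, Set.mem_ofPred_eq, c0, hA, mul_ne_zero_iff]
    tauto
  have hmap : cellMap (entries (g * p)) = cellMap (entries g) := by
    simp only [cellMap, c0, hA, hB, mul_div_mul_right _ _ q0,
      mul_div_mul_right _ _ (mul_ne_zero q0 q1)]
  by_cases hg : entries g ∈ bigCell
  · rw [cellSection, cellSection, cellFun, cellFun, if_pos (hcell.2 hg), if_pos hg, hmap]
    have e1 : minorA (entries (g * p)) / entries (g * p) 2 0 =
        minorA (entries g) / entries g 2 0 * (p : Matrix (Fin 3) (Fin 3) ℝ) 1 1 := by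
      rw [hA, c0]
      have := hg.1
      field_simp
    have e2 : (Matrix.of (entries (g * p))).det / minorA (entries (g * p)) =
        (Matrix.of (entries g)).det / minorA (entries g) *
          (p : Matrix (Fin 3) (Fin 3) ℝ) 2 2 := by
      rw [hA, hD]
      have := hg.2
      field_simp
    have r0 : rho 3 0 = 1 := by simp [rho]; norm_num
    have r1 : rho 3 1 = 0 := by simp [rho]; norm_num
    have r2 : rho 3 2 = -1 := by simp [rho]; norm_num
    rw [cellFactor, e1, e2, c0, sgnPow_mul, sgnPow_mul, sgnPow_mul, cellFactor, inducingFactor,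
      Fin.prod_univ_three, r0, r1, r2, sub_zero, sub_neg_eq_add]
    ring
  · rw [cellSection, cellSection, cellFun, cellFun, if_neg (fun h => hg (hcell.1 h)), if_neg hg,
      mul_zero]

lemma ext0_cellSection_eventuallyEq (φ : ℝ × ℝ × ℝ → ℂ) (g : GL (Fin 3) ℝ) :
    ext0 (cellSection ξ lam φ) =ᶠ[𝓝 (entries g)] cellFun ξ lam φ := by
  have : ∀ᶠ A in 𝓝 (entries g), ext0 (cellSection ξ lam φ) A = cellFun ξ lam φ A :=
    eventually_nhds_entries.2 (Eventually.of_forall fun g' => ext0_entries _ _)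
  exact this

lemma cellSection_mem {φ : ℝ × ℝ × ℝ → ℂ} (hφ : ContDiff ℝ ∞ φ) {R : ℝ}
    (hR : ∀ v, φ v ≠ 0 → ‖v‖ ≤ R) : cellSection ξ lam φ ∈ principalSeries ξ lam := by
  refine ⟨isSmooth_iff.2 fun g => ?_, fun g p hp => cellSection_mul φ g hp⟩
  refine ContDiffAt.congr_of_eventuallyEq ?_ (ext0_cellSection_eventuallyEq φ g)
  have h := contDiffAt_cellFun (ξ := ξ) (lam := lam) (Φ := fun p => φ p.2) (hφ.comp contDiff_snd)
    (fun p hp => hR p.2 hp) 0 g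
  have h2 : ContDiffAt ℝ ∞ (fun A : Mat 3 => ((0 : ℝ), A)) (entries g) :=
    contDiffAt_const.prodMk contDiffAt_id
  exact h.comp (entries g) h2

lemma entries_chart (v : ℝ × ℝ × ℝ) :
    entries (chart v) = ![![v.1, 1, 0], ![v.2.1, v.2.2, 1], ![1, 0, 0]] := rfl

lemma entries_chart_mem (v : ℝ × ℝ × ℝ) : entries (chart v) ∈ bigCell := by
  rw [entries_chart]
  exact ⟨by simp, by simp [minorA]⟩

lemma cellMap_chart (v : ℝ × ℝ × ℝ) : cellMap (entries (chart v)) = v := by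
  simp [cellMap, minorA, minorB, entries_chart]

lemma cellSection_chart (φ : ℝ × ℝ × ℝ → ℂ) (v : ℝ × ℝ × ℝ) :
    cellSection ξ lam φ (chart v) = φ v := by
  rw [cellSection, cellFun, if_pos (entries_chart_mem v), cellMap_chart]
  have h1 : entries (chart v) 2 0 = 1 := rfl
  have h2 : minorA (entries (chart v)) = 1 := by simp [minorA, entries_chart]
  have h3 : (Matrix.of (entries (chart v))).det = 1 := by
    rw [Matrix.det_fin_three]
    simp [entries_chart]
  simp [cellFactor, h1, h2, h3]

lemma exists_eq_chart_mul {g : GL (Fin 3) ℝ} (hg : entries g ∈ bigCell) :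
    ∃ p ∈ borel 3, g = chart (cellMap (entries g)) * p := by
  set v := cellMap (entries g) with hv
  refine ⟨(chart v)⁻¹ * g, ?_, by rw [mul_inv_cancel_left]⟩
  have h20 : (g : Matrix (Fin 3) (Fin 3) ℝ) 2 0 ≠ 0 := hg.1
  have hm : (g : Matrix (Fin 3) (Fin 3) ℝ) 2 0 * (g : Matrix (Fin 3) (Fin 3) ℝ) 0 1 -
      (g : Matrix (Fin 3) (Fin 3) ℝ) 2 1 * (g : Matrix (Fin 3) (Fin 3) ℝ) 0 0 ≠ 0 := hg.2
  -- Row reduction solves `chart v * P = g`; upper triangularity of `P` is what the coordinates in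
  -- `cellMap` are made for.
  set P : Matrix (Fin 3) (Fin 3) ℝ := Matrix.of ![fun j => g 2 j, fun j => g 0 j - v.1 * g 2 j,
    fun j => g 1 j - v.2.1 * g 2 j - v.2.2 * (g 0 j - v.1 * g 2 j)] with hP
  have h : (chart v : Matrix (Fin 3) (Fin 3) ℝ) * P = g := by
    rw [coe_chart]
    ext i j
    fin_cases i <;> simp [Matrix.mul_apply, Fin.sum_univ_three, hP]
  have h' : (((chart v)⁻¹ * g : GL (Fin 3) ℝ) : Matrix (Fin 3) (Fin 3) ℝ) = P := by
    rw [Units.val_mul, ← h, Units.inv_mul_cancel_left]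
  intro i j hij
  rw [h']
  have v1 : v.1 = (g : Matrix (Fin 3) (Fin 3) ℝ) 0 0 / (g : Matrix (Fin 3) (Fin 3) ℝ) 2 0 := rfl
  have v2 : v.2.1 = (g : Matrix (Fin 3) (Fin 3) ℝ) 1 0 / (g : Matrix (Fin 3) (Fin 3) ℝ) 2 0 := rfl
  have v3 : v.2.2 = ((g : Matrix (Fin 3) (Fin 3) ℝ) 2 0 * (g : Matrix (Fin 3) (Fin 3) ℝ) 1 1 -
      (g : Matrix (Fin 3) (Fin 3) ℝ) 2 1 * (g : Matrix (Fin 3) (Fin 3) ℝ) 1 0) /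
      ((g : Matrix (Fin 3) (Fin 3) ℝ) 2 0 * (g : Matrix (Fin 3) (Fin 3) ℝ) 0 1 -
      (g : Matrix (Fin 3) (Fin 3) ℝ) 2 1 * (g : Matrix (Fin 3) (Fin 3) ℝ) 0 0) := rfl
  have k1 : P 1 0 = 0 := by
    simp only [hP, Matrix.of_apply, Matrix.cons_val_one, Matrix.cons_val_zero]
    rw [v1]
    field_simp
    ring
  have k2 : P 2 0 = 0 := by
    change g 1 0 - v.2.1 * g 2 0 - v.2.2 * (g 0 0 - v.1 * g 2 0) = 0
    rw [v1, v2]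
    field_simp
    ring
  have k3 : P 2 1 = 0 := by
    change g 1 1 - v.2.1 * g 2 1 - v.2.2 * (g 0 1 - v.1 * g 2 1) = 0
    have : g 0 1 - v.1 * g 2 1 = ((g : Matrix (Fin 3) (Fin 3) ℝ) 2 0 *
        (g : Matrix (Fin 3) (Fin 3) ℝ) 0 1 - (g : Matrix (Fin 3) (Fin 3) ℝ) 2 1 *
        (g : Matrix (Fin 3) (Fin 3) ℝ) 0 0) / g 2 0 := by
      rw [v1]
      field_simp
    rw [this, v3, div_mul_div_cancel₀ hm, v2]
    field_simp
    ring
  fin_cases i <;> fin_cases j <;> first | exact k1 | exact k2 | exact k3 | exact absurd hij (by decide)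

/-- Sections of the principal series are determined near the base point by their values on the
chart. -/
lemma eventuallyEq_cellSection {f : GL (Fin 3) ℝ → ℂ} (hf : f ∈ principalSeries ξ lam)
    {φ : ℝ × ℝ × ℝ → ℂ} (h : ∀ᶠ v in 𝓝 0, f (chart v) = φ v) :
    f =ᶠ[𝓝 (chart 0)] cellSection ξ lam φ := by
  have h1 : ∀ᶠ g in 𝓝 (chart 0), entries g ∈ bigCell :=
    continuous_entries.continuousAt.eventually (isOpen_bigCell.mem_nhds (entries_chart_mem 0))
  have h2 : Tendsto (fun g => cellMap (entries g)) (𝓝 (chart 0)) (𝓝 0) := by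
    have h3 := (contDiffAt_cellMap (entries_chart_mem 0)).continuousAt.tendsto
    rw [cellMap_chart] at h3
    exact h3.comp continuous_entries.continuousAt
  filter_upwards [h1, h2.eventually h] with g hg hv
  obtain ⟨p, hp, hgp⟩ := exists_eq_chart_mul hg
  rw [hgp, hf.2 _ p hp, cellSection_mul φ _ hp, hv, cellSection_chart]

lemma contDiff_comp_chart {f : GL (Fin 3) ℝ → ℂ} (hf : IsSmooth f) :
    ContDiff ℝ ∞ fun v => f (chart v) := by
  have h1 : ContDiff ℝ ∞ fun v : ℝ × ℝ × ℝ => entries (chart v) := by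
    refine contDiff_pi.2 fun i => contDiff_pi.2 fun j => ?_
    fin_cases i <;> fin_cases j <;> simp [entries_chart] <;> fun_prop
  have h2 : (fun v => f (chart v)) = ext0 f ∘ fun v => entries (chart v) := by
    funext v
    exact (ext0_entries f _).symm
  rw [h2]
  exact contDiff_iff_contDiffAt.2 fun v => (hf.contDiffAt (chart v)).comp v h1.contDiffAt

end BigCell

/-! ### The functional of a symmetry breaking operator -/

section Functional

/-- A smooth cutoff function around the origin of the chart. -/
def cutoffBump : ContDiffBump (0 : ℝ × ℝ × ℝ) := ⟨1, 2, one_pos, one_lt_two⟩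

/-- A function in the chart, cut off around the origin. -/
def cutoff (F : ℝ × ℝ × ℝ → ℂ) : ℝ × ℝ × ℝ → ℂ := fun v => (cutoffBump v : ℂ) * F v

lemma contDiff_cutoffBump : ContDiff ℝ ∞ fun v : ℝ × ℝ × ℝ => (cutoffBump v : ℂ) :=
  contDiff_ofReal_comp cutoffBump.contDiff

lemma norm_le_of_cutoffBump_ne_zero {v : ℝ × ℝ × ℝ} (h : (cutoffBump v : ℂ) ≠ 0) : ‖v‖ ≤ 2 := by
  have h1 : v ∈ Function.support cutoffBump := fun h0 => h (by rw [h0, Complex.ofReal_zero])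
  rw [cutoffBump.support_eq, mem_ball_zero_iff] at h1
  exact h1.le

lemma cutoff_eventuallyEq (F : ℝ × ℝ × ℝ → ℂ) : cutoff F =ᶠ[𝓝 0] F := by
  filter_upwards [cutoffBump.eventuallyEq_one] with v hv
  simp [cutoff, hv]

variable {ξ : Fin 3 → ZMod 2} {lam : Fin 3 → ℂ} {η : Fin 2 → ZMod 2} {ν : Fin 2 → ℂ}

lemma cellSection_cutoff_mem {F : ℝ × ℝ × ℝ → ℂ} (hF : ContDiff ℝ ∞ F) :
    cellSection ξ lam (cutoff F) ∈ principalSeries ξ lam :=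
  cellSection_mem (contDiff_cutoffBump.mul hF) (R := 2) fun _ hv =>
    norm_le_of_cutoffBump_ne_zero (left_ne_zero_of_mul hv)

lemma cellFun_linear (c : ℂ) (φ φ' : ℝ × ℝ × ℝ → ℂ) (A : Mat 3) :
    cellFun ξ lam (φ + c • φ') A = cellFun ξ lam φ A + c * cellFun ξ lam φ' A := by
  simp only [cellFun]
  split_ifs
  · simp only [Pi.add_apply, Pi.smul_apply, smul_eq_mul]
    ring
  · ring

lemma cutoff_linear (c : ℂ) (φ φ' : ℝ × ℝ × ℝ → ℂ) :
    cutoff (φ + c • φ') = cutoff φ + c • cutoff φ' := by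
  funext v
  simp only [cutoff, Pi.add_apply, Pi.smul_apply, smul_eq_mul]
  ring

/-- The value at `1` of the image of a cut-off section is a linear functional on smooth functions;
we extend it to all functions. -/
lemma exists_functional (T : principalSeries ξ lam →ₗ[ℂ] principalSeries η ν) :
    ∃ U : (ℝ × ℝ × ℝ → ℂ) →ₗ[ℂ] ℂ, ∀ F (hF : ContDiff ℝ ∞ F),
      U F = (T ⟨cellSection ξ lam (cutoff F), cellSection_cutoff_mem hF⟩).1 1 := by
  let W : Submodule ℂ (ℝ × ℝ × ℝ → ℂ) :=
    { carrier := {F | ContDiff ℝ ∞ F}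
      add_mem' := fun {F F'} (h : ContDiff ℝ ∞ F) (h' : ContDiff ℝ ∞ F') =>
        (h.add h' : ContDiff ℝ ∞ (F + F'))
      zero_mem' := (contDiff_const : ContDiff ℝ ∞ fun _ : ℝ × ℝ × ℝ => (0 : ℂ))
      smul_mem' := fun c F (h : ContDiff ℝ ∞ F) => (h.const_smul c : ContDiff ℝ ∞ (c • F)) }
  have hlin : ∀ (c : ℂ) (F F' : W), cellSection ξ lam (cutoff (F.1 + c • F'.1)) =
      cellSection ξ lam (cutoff F.1) + c • cellSection ξ lam (cutoff F'.1) := fun c F F' => by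
    funext g
    rw [cutoff_linear]
    exact cellFun_linear c _ _ _
  let S : W →ₗ[ℂ] principalSeries ξ lam :=
    { toFun := fun F => ⟨cellSection ξ lam (cutoff F.1), cellSection_cutoff_mem F.2⟩
      map_add' := fun F F' => Subtype.ext (by
        have := hlin 1 F F'
        rw [one_smul, one_smul] at this
        exact this)
      map_smul' := fun c F => Subtype.ext (by
        have h0 : cellSection ξ lam (cutoff 0) = 0 := by
          funext g
          simp [cellSection, cellFun, cutoff]
        have := hlin c 0 F
        change cellSection ξ lam (cutoff (0 + c • F.1)) = cellSection ξ lam (cutoff 0) + _ at this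
        rw [zero_add, h0, zero_add] at this
        exact this) }
  let E : principalSeries η ν →ₗ[ℂ] ℂ :=
    { toFun := fun f => f.1 1
      map_add' := fun _ _ => rfl
      map_smul' := fun _ _ => rfl }
  obtain ⟨U, hU⟩ := (E.comp (T.comp S)).exists_extend
  refine ⟨U, fun F hF => ?_⟩
  exact congrArg (fun l => l (⟨F, hF⟩ : W)) hU

/-- If `(T f)(1) ≠ 0`, the support condition puts the base point into the support of the section
`f`, which is impossible for a vanishing germ. -/
lemma DSBO_apply_one_eq_zero {T : principalSeries ξ lam →ₗ[ℂ] principalSeries η ν}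
    (hT : T ∈ DSBO (0 : Fin 3) ξ lam η ν) {f : principalSeries ξ lam}
    (hf : f.1 =ᶠ[𝓝 (chart 0)] 0) : (T f).1 1 = 0 := by
  by_contra hne
  have h1 : ((1 : GL (Fin 2) ℝ) : GL (Fin 2) ℝ ⧸ borel 2) ∈ sectionSupport (T f).1 :=
    subset_closure ⟨1, hne, rfl⟩
  have h2 := hT.2.2 f ⟨_, h1, rfl⟩
  have h3 : flagMap (0 : Fin 3) ((1 : GL (Fin 2) ℝ) : GL (Fin 2) ℝ ⧸ borel 2) =
      ((chart 0 : GL (Fin 3) ℝ) : GL (Fin 3) ℝ ⧸ borel 3) := by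
    rw [chart_zero]
    rfl
  rw [h3] at h2
  -- The quotient map is open, so the vanishing near `chart 0` descends to a neighbourhood in the
  -- flag variety; equivariance then transfers it to all representatives.
  have h4 : (fun g : GL (Fin 3) ℝ => (g : GL (Fin 3) ℝ ⧸ borel 3)) '' {g | f.1 g = 0} ∈
      𝓝 ((chart 0 : GL (Fin 3) ℝ) : GL (Fin 3) ℝ ⧸ borel 3) :=
    QuotientGroup.isOpenMap_coe.image_mem_nhds hf
  obtain ⟨_, ⟨g, hg, rfl⟩, ⟨g', hg', hgg'⟩⟩ := mem_closure_iff_nhds.1 h2 _ h4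
  have h5 : g⁻¹ * g' ∈ borel 3 := QuotientGroup.eq.1 hgg'.symm
  refine hg' ?_
  have h6 := f.2.2 g _ h5
  rw [mul_inv_cancel_left] at h6
  have hg0 : f.1 g = 0 := hg
  rw [h6, hg0, mul_zero]

lemma DSBO_apply_one_eq {T : principalSeries ξ lam →ₗ[ℂ] principalSeries η ν}
    (hT : T ∈ DSBO (0 : Fin 3) ξ lam η ν) {U : (ℝ × ℝ × ℝ → ℂ) →ₗ[ℂ] ℂ}
    (hU : ∀ F (hF : ContDiff ℝ ∞ F),
      U F = (T ⟨cellSection ξ lam (cutoff F), cellSection_cutoff_mem hF⟩).1 1)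
    (f : principalSeries ξ lam) {F : ℝ × ℝ × ℝ → ℂ} (hF : ContDiff ℝ ∞ F)
    (h : ∀ᶠ v in 𝓝 0, f.1 (chart v) = F v) : (T f).1 1 = U F := by
  rw [hU F hF, ← sub_eq_zero]
  have h1 := eventuallyEq_cellSection f.2 (φ := cutoff F) (by
    filter_upwards [h, cutoff_eventuallyEq F] with v h1 h2
    rw [h1, h2])
  have h2 : (f - ⟨cellSection ξ lam (cutoff F), cellSection_cutoff_mem hF⟩ :
      principalSeries ξ lam).1 =ᶠ[𝓝 (chart 0)] 0 := by
    refine Eventually.mono h1 fun g hg => ?_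
    change f.1 g - cellSection ξ lam (cutoff F) g = 0
    rw [hg, sub_self]
  have h3 := DSBO_apply_one_eq_zero hT h2
  rw [map_sub] at h3
  exact h3

/-- Equivariance of the functional under the upper triangular subgroup of `GL 2 ℝ`. -/
lemma DSBO_apply_one_translate {T : principalSeries ξ lam →ₗ[ℂ] principalSeries η ν}
    (hT : T ∈ DSBO (0 : Fin 3) ξ lam η ν) {U : (ℝ × ℝ × ℝ → ℂ) →ₗ[ℂ] ℂ}
    (hU : ∀ F (hF : ContDiff ℝ ∞ F),
      U F = (T ⟨cellSection ξ lam (cutoff F), cellSection_cutoff_mem hF⟩).1 1)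
    {b : GL (Fin 2) ℝ} (hb : b ∈ borel 2) {F F' : ℝ × ℝ × ℝ → ℂ} (hF : ContDiff ℝ ∞ F)
    (hF' : ContDiff ℝ ∞ F')
    (h : ∀ᶠ v in 𝓝 0, cellSection ξ lam (cutoff F) (embed 2 b * chart v) = F' v) :
    U F' = inducingFactor η ν b * U F := by
  set f : principalSeries ξ lam := ⟨cellSection ξ lam (cutoff F), cellSection_cutoff_mem hF⟩ with hf
  have h1 := DSBO_apply_one_eq hT hU (leftRegular ξ lam (embed 2 b⁻¹) f) hF' (by
    refine Eventually.mono h fun v hv => ?_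
    rw [← hv]
    change cellSection ξ lam (cutoff F) ((embed 2 b⁻¹)⁻¹ * chart v) = _
    -- The translate by `b⁻¹` is used because its image under `T` takes the value `(T f)(b)` at `1`.
    rw [map_inv, inv_inv])
  rw [hT.2.1] at h1
  change (T f).1 (b⁻¹⁻¹ * 1) = _ at h1
  have h2 := (T f).2.2 1 b hb
  rw [inv_inv, mul_one] at h1
  rw [one_mul, h1, ← hU F hF] at h2
  exact h2

/-- Continuity of `T` bounds the value at `1` by finitely many derivatives on a compact set `K`.
Joint smoothness in `(t, A)` and compactness of `[0, 1] × K` make these uniform in `t`. -/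
lemma exists_bound_functional {T : principalSeries ξ lam →ₗ[ℂ] principalSeries η ν}
    (hT : T ∈ DSBO (0 : Fin 3) ξ lam η ν) {U : (ℝ × ℝ × ℝ → ℂ) →ₗ[ℂ] ℂ}
    (hU : ∀ F (hF : ContDiff ℝ ∞ F),
      U F = (T ⟨cellSection ξ lam (cutoff F), cellSection_cutoff_mem hF⟩).1 1)
    {Γ : ℝ × ℝ × ℝ × ℝ → ℂ} (hΓ : ContDiff ℝ ∞ Γ) :
    ∃ C, ∀ t ∈ Set.Icc (0 : ℝ) 1, ‖U fun v => Γ (t, v)‖ ≤ C := by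
  obtain ⟨K, hK, N, C, -, hb⟩ := hT.1 {1} isCompact_singleton 0
  have hΓt : ∀ t, ContDiff ℝ ∞ fun v => Γ (t, v) := fun t =>
    hΓ.comp (contDiff_const.prodMk contDiff_id)
  set Φ : ℝ × ℝ × ℝ × ℝ → ℂ := fun p => (cutoffBump p.2 : ℂ) * Γ p with hΦ
  have hΦs : ContDiff ℝ ∞ Φ := (contDiff_cutoffBump.comp contDiff_snd).mul hΓ
  set Ψ : ℝ × Mat 3 → ℂ := fun q => cellFun ξ lam (fun v => Φ (q.1, v)) q.2 with hΨ
  have hΨs : ∀ s g, ContDiffAt ℝ ∞ Ψ (s, entries g) := fun s g =>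
    contDiffAt_cellFun hΦs (R := 2)
      (fun p hp => norm_le_of_cutoffBump_ne_zero (left_ne_zero_of_mul hp)) s g
  have hcpt : IsCompact (Set.Icc (0 : ℝ) 1 ×ˢ (entries '' K)) :=
    isCompact_Icc.prod (hK.image continuous_entries)
  have hbd : ∀ j : ℕ, ∃ C, ∀ q ∈ Set.Icc (0 : ℝ) 1 ×ˢ (entries '' K),
      ‖iteratedFDeriv ℝ j Ψ q‖ ≤ C := fun j => by
    refine hcpt.exists_bound_of_continuousOn fun q hq => ContinuousAt.continuousWithinAt ?_
    obtain ⟨g, -, hg⟩ := hq.2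
    have h := hΨs q.1 g
    rw [hg] at h
    exact (h.iteratedFDeriv_right (m := 0) (i := j) (by
      rw [zero_add]; exact_mod_cast le_top)).continuousAt
  choose C' hC' using hbd
  set l := ContinuousLinearMap.inr ℝ ℝ (Mat 3) with hl
  set B : ℝ := ∑ j ∈ Finset.range (N + 1), |C' j| * ‖l‖ ^ j with hB
  have hB0 : 0 ≤ B := Finset.sum_nonneg fun j _ => by positivity
  refine ⟨C * B, fun t ht => ?_⟩
  rw [hU _ (hΓt t)]
  have key := hb ⟨cellSection ξ lam (cutoff fun v => Γ (t, v)), cellSection_cutoff_mem (hΓt t)⟩ B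
    hB0 (fun j hj g hg => ?_) 1 rfl
  · rw [norm_iteratedFDeriv_zero, toMat_coe] at key
    exact key
  · change ‖iteratedFDeriv ℝ j (ext0 (cellSection ξ lam (cutoff fun v => Γ (t, v))))
      (entries g)‖ ≤ B
    rw [((ext0_cellSection_eventuallyEq _ g).iteratedFDeriv ℝ j).eq_of_nhds]
    have e : cellFun ξ lam (cutoff fun v => Γ (t, v)) =
        fun A => Ψ (l A + ((t, 0) : ℝ × Mat 3)) := by
      funext A
      simp [hΨ, hΦ, hl]
      rfl
    have e2 : l (entries g) + ((t, 0) : ℝ × Mat 3) = (t, entries g) := by simp [hl]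
    have h1 := hΨs t g
    rw [← e2] at h1
    rw [e]
    refine (norm_iteratedFDeriv_comp_affine_le l (t, 0) h1 j).trans ?_
    rw [e2]
    have h2 := (hC' j (t, entries g) ⟨ht, g, hg, rfl⟩).trans (le_abs_self _)
    refine (mul_le_mul_of_nonneg_right h2 (by positivity)).trans ?_
    exact Finset.single_le_sum (f := fun j => |C' j| * ‖l‖ ^ j) (fun j _ => by positivity)
      (Finset.mem_range_succ_iff.2 hj)

/-! ### The action of the Borel subgroup of `GL 2` in the chart. -/

lemma sgnPow_ne_zero (ζ : ZMod 2) (s : ℂ) {x : ℝ} (hx : x ≠ 0) : sgnPow ζ s x ≠ 0 := fun h0 => by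
  have h := sgnPow_mul ζ s x x⁻¹
  rw [mul_inv_cancel₀ hx, h0, zero_mul, sgnPow_one] at h
  exact one_ne_zero h

/-- The diagonal matrix `diag(a, b)`. -/
def diagTwo (a b : ℝˣ) : GL (Fin 2) ℝ :=
  Matrix.GeneralLinearGroup.mkOfDetNeZero !![(a : ℝ), 0; 0, b] (by simp [Matrix.det_fin_two])

lemma entries_embed_diagTwo_mul_chart (a b : ℝˣ) (v : ℝ × ℝ × ℝ) :
    entries (embed 2 (diagTwo a b) * chart v) =
      ![![a * v.1, a, 0], ![b * v.2.1, b * v.2.2, b], ![1, 0, 0]] := by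
  change ((embed 2 (diagTwo a b) : Matrix (Fin 3) (Fin 3) ℝ) *
    (chart v : Matrix (Fin 3) (Fin 3) ℝ)) = _
  rw [coe_embed, coe_chart]
  have h : (diagTwo a b : Matrix (Fin 2) (Fin 2) ℝ) = !![(a : ℝ), 0; 0, b] := rfl
  rw [h]
  funext i j
  fin_cases i <;> fin_cases j <;> simp [Matrix.mul_apply, Fin.sum_univ_three]

lemma cellSection_diagTwo_mul_chart (φ : ℝ × ℝ × ℝ → ℂ) (a b : ℝˣ) (v : ℝ × ℝ × ℝ) :
    cellSection ξ lam φ (embed 2 (diagTwo a b) * chart v) =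
      sgnPow (ξ 1) (-lam 1) a * sgnPow (ξ 2) (-lam 2 + 1) b *
        φ (a * v.1, b * v.2.1, b / a * v.2.2) := by
  have hA : minorA ![![a * v.1, a, 0], ![b * v.2.1, b * v.2.2, b], ![1, 0, 0]] = a := by
    simp [minorA]
  have hB : minorB ![![a * v.1, a, 0], ![b * v.2.1, b * v.2.2, b], ![1, 0, 0]] = b * v.2.2 := by
    simp [minorB]
  have h20 : (![![a * v.1, a, 0], ![b * v.2.1, b * v.2.2, b], ![1, 0, 0]] : Mat 3) 2 0 = 1 := rfl
  have hD : (Matrix.of ![![a * v.1, (a : ℝ), 0], ![b * v.2.1, b * v.2.2, (b : ℝ)],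
      ![1, 0, 0]]).det = a * b := by
    rw [Matrix.det_fin_three]
    simp
  rw [cellSection, cellFun, entries_embed_diagTwo_mul_chart, if_pos ⟨by simp, by simp [hA]⟩,
    cellFactor, cellMap, hA, hB, h20, hD, sgnPow_one, one_mul, div_one,
    mul_div_cancel_left₀ _ a.ne_zero]
  simp [div_mul_eq_mul_div]

lemma inducingFactor_diagTwo (a b : ℝˣ) : inducingFactor η ν (diagTwo a b) =
    sgnPow (η 0) (-ν 0 - 1 / 2) a * sgnPow (η 1) (-ν 1 + 1 / 2) b := by
  have r0 : rho 2 0 = 1 / 2 := by simp [rho]; norm_num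
  have r1 : rho 2 1 = -(1 / 2) := by simp [rho]; norm_num
  rw [inducingFactor, Fin.prod_univ_two, r0, r1, sub_neg_eq_add]
  rfl

lemma diagTwo_mem (a b : ℝˣ) : diagTwo a b ∈ borel 2 := by
  intro i j hij
  change (!![(a : ℝ), 0; 0, b] : Matrix (Fin 2) (Fin 2) ℝ) i j = 0
  fin_cases i <;> fin_cases j <;> simp at hij ⊢

lemma entries_embed_elemGL_mul_chart (v : ℝ × ℝ × ℝ) :
    entries (embed 2 (elemGL (i := (0 : Fin 2)) (j := 1) (by decide) 1) * chart v) =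
      ![![v.1 + v.2.1, 1 + v.2.2, 1], ![v.2.1, v.2.2, 1], ![1, 0, 0]] := by
  change ((embed 2 (elemGL (i := (0 : Fin 2)) (j := 1) (by decide) 1) :
    Matrix (Fin 3) (Fin 3) ℝ) * (chart v : Matrix (Fin 3) (Fin 3) ℝ)) = _
  rw [coe_embed, coe_chart, coe_elemGL]
  funext i j
  fin_cases i <;> fin_cases j <;> simp [Matrix.mul_apply, Fin.sum_univ_three, Matrix.single]

lemma cellSection_elemGL_mul_chart (φ : ℝ × ℝ × ℝ → ℂ) {v : ℝ × ℝ × ℝ} (hv : 1 + v.2.2 ≠ 0) :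
    cellSection ξ lam φ (embed 2 (elemGL (i := (0 : Fin 2)) (j := 1) (by decide) 1) * chart v) =
      sgnPow (ξ 1) (-lam 1) (1 + v.2.2) * sgnPow (ξ 2) (-lam 2 + 1) (1 + v.2.2)⁻¹ *
        φ (v.1 + v.2.1, v.2.1, v.2.2 / (1 + v.2.2)) := by
  have hA : minorA ![![v.1 + v.2.1, 1 + v.2.2, 1], ![v.2.1, v.2.2, 1], ![1, 0, 0]] =
      1 + v.2.2 := by
    simp [minorA]
  have hB : minorB ![![v.1 + v.2.1, 1 + v.2.2, 1], ![v.2.1, v.2.2, 1], ![1, 0, 0]] = v.2.2 := by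
    simp [minorB]
  have h20 : (![![v.1 + v.2.1, 1 + v.2.2, 1], ![v.2.1, v.2.2, 1], ![1, 0, 0]] : Mat 3) 2 0 = 1 :=
    rfl
  have hD : (Matrix.of ![![v.1 + v.2.1, 1 + v.2.2, 1], ![v.2.1, v.2.2, 1],
      ![1, 0, 0]]).det = 1 := by
    rw [Matrix.det_fin_three]
    simp
  rw [cellSection, cellFun, entries_embed_elemGL_mul_chart, if_pos ⟨by simp, by rwa [hA]⟩,
    cellFactor, cellMap, hA, hB, h20, hD, sgnPow_one, one_mul, div_one, one_div]
  simp

lemma inducingFactor_elemGL :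
    inducingFactor η ν (elemGL (i := (0 : Fin 2)) (j := 1) (by decide) 1) = 1 := by
  rw [inducingFactor, Fin.prod_univ_two, coe_elemGL]
  simp [Matrix.single]

lemma elemGL_mem : elemGL (i := (0 : Fin 2)) (j := 1) (by decide) 1 ∈ borel 2 := by
  intro i j hij
  rw [coe_elemGL]
  fin_cases i <;> fin_cases j <;> simp [Matrix.single] at hij ⊢

/-- A smooth function without zeros that agrees with `1 + z` near `0`. -/
lemma exists_one_add_extension : ∃ w : ℝ → ℝ, ContDiff ℝ ∞ w ∧ (∀ z, w z ≠ 0) ∧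
    ∀ᶠ z in 𝓝 0, w z = 1 + z := by
  let χ : ContDiffBump (0 : ℝ) := ⟨1 / 4, 1 / 2, by norm_num, by norm_num⟩
  refine ⟨fun z => 1 + χ z * z, contDiff_const.add (χ.contDiff.mul contDiff_id), fun z => ?_, ?_⟩
  · have h1 : |χ z * z| ≤ 1 / 2 := by
      by_cases hz : χ z = 0
      · rw [hz, zero_mul, abs_zero]
        norm_num
      · have h2 : z ∈ Function.support χ := hz
        rw [χ.support_eq, mem_ball_zero_iff, Real.norm_eq_abs] at h2
        rw [abs_mul, abs_of_nonneg χ.nonneg]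
        calc χ z * |z| ≤ 1 * |z| := mul_le_mul_of_nonneg_right χ.le_one (abs_nonneg _)
          _ ≤ 1 / 2 := by rw [one_mul]; exact h2.le
    have := neg_le_of_abs_le h1
    intro h0
    linarith
  · filter_upwards [χ.eventuallyEq_one] with z hz
    simp [hz]

variable {n₁ n₂ : ℕ}

lemma isHomogeneous_functional (hn₁ : (n₁ : ℂ) = lam 2 - ν 1 - 1 / 2)
    (hn₂ : (n₂ : ℂ) = lam 1 + lam 2 - ν 0 - ν 1 - 1)
    (hη₁ : η 0 = ξ 1 + ((n₁ + n₂ : ℕ) : ZMod 2)) (hη₂ : η 1 = ξ 2 + (n₁ : ZMod 2))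
    {T : principalSeries ξ lam →ₗ[ℂ] principalSeries η ν}
    (hT : T ∈ DSBO (0 : Fin 3) ξ lam η ν) {U : (ℝ × ℝ × ℝ → ℂ) →ₗ[ℂ] ℂ}
    (hU : ∀ F (hF : ContDiff ℝ ∞ F),
      U F = (T ⟨cellSection ξ lam (cutoff F), cellSection_cutoff_mem hF⟩).1 1) :
    IsHomogeneous n₁ n₂ U where
  bounded Γ hΓ := exists_bound_functional hT hU hΓ
  scale s t hs ht F hF := by
    set a := Units.mk0 s hs with ha
    -- With `a = s` and `b = st`, the matrix `diag(a, b)` acts on the chart by `(sx, sty, tz)`.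
    set b := Units.mk0 (s * t) (mul_ne_zero hs ht) with hb
    set c := sgnPow (ξ 1) (-lam 1) s * sgnPow (ξ 2) (-lam 2 + 1) (s * t) with hc
    have hc0 : c ≠ 0 := mul_ne_zero (sgnPow_ne_zero _ _ hs) (sgnPow_ne_zero _ _ (mul_ne_zero hs ht))
    have hδ : ContDiff ℝ ∞ fun v : ℝ × ℝ × ℝ => F (s * v.1, s * t * v.2.1, t * v.2.2) :=
      hF.comp (by fun_prop)
    have h1 := DSBO_apply_one_translate hT hU (diagTwo_mem a b) hF
      (F' := c • fun v => F (s * v.1, s * t * v.2.1, t * v.2.2)) (hδ.const_smul c) (by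
        have h2 : Tendsto (fun v : ℝ × ℝ × ℝ => (s * v.1, s * t * v.2.1, t * v.2.2)) (𝓝 0)
            (𝓝 0) := by
          have h3 : Continuous fun v : ℝ × ℝ × ℝ => (s * v.1, s * t * v.2.1, t * v.2.2) := by
            fun_prop
          exact h3.tendsto' 0 0 (by simp)
        filter_upwards [h2.eventually (cutoff_eventuallyEq F)] with v hv
        rw [cellSection_diagTwo_mul_chart]
        simp only [ha, hb, Units.val_mk0, mul_div_cancel_left₀ t hs, Pi.smul_apply, smul_eq_mul]
        rw [hv])
    rw [map_smul, smul_eq_mul, inducingFactor_diagTwo] at h1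
    simp only [ha, hb, Units.val_mk0] at h1
    have k1 : sgnPow (η 1) (-ν 1 + 1 / 2) (s * t) =
        ((s * t : ℝ) : ℂ) ^ n₁ * sgnPow (ξ 2) (-lam 2 + 1) (s * t) := by
      rw [← sgnPow_add_natCast _ _ _ (mul_ne_zero hs ht), hη₂]
      congr 1
      linear_combination -hn₁
    -- Multiplying by `s ^ n₁` avoids the exponent `n₂ - n₁`, which may be negative.
    have k2 : (s : ℂ) ^ n₁ * sgnPow (η 0) (-ν 0 - 1 / 2) s =
        (s : ℂ) ^ n₂ * sgnPow (ξ 1) (-lam 1) s := by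
      rw [← sgnPow_add_natCast _ _ _ hs, ← sgnPow_add_natCast _ _ _ hs, hη₁]
      congr 1
      · push_cast
        linear_combination natCast_add_self_zmod_two n₁
      · linear_combination hn₁ - hn₂
    apply mul_left_cancel₀ hc0
    rw [h1, k1, hc]
    push_cast
    rw [mul_pow]
    linear_combination ((t : ℂ) ^ n₁ * sgnPow (ξ 2) (-lam 2 + 1) (s * t) * U F) * k2
  shear p q r := by
    -- The shear has denominator `1 + z`; its zero-free replacement `w` gives a globally smooth
    -- multiplier with the same germ. The factor `(w z)⁻¹ ^ r` in `H` comes from `z ↦ z / (1 + z)`.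
    obtain ⟨w, hw, hw0, hw1⟩ := exists_one_add_extension
    have h00 : w 0 = 1 := by simpa using hw1.self_of_nhds
    set H : ℝ → ℂ := fun z => sgnPow (ξ 1) (-lam 1) (w z) *
      sgnPow (ξ 2) (-lam 2 + 1) (w z)⁻¹ * (((w z)⁻¹ : ℝ) : ℂ) ^ r with hH
    have hwi : ContDiff ℝ ∞ fun z => (w z)⁻¹ := hw.inv hw0
    have hHs : ContDiff ℝ ∞ H := by
      refine ContDiff.mul (ContDiff.mul ?_ ?_) ((contDiff_ofReal_comp hwi).pow r)
      · exact contDiff_iff_contDiffAt.2 fun z =>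
          (contDiffAt_sgnPow _ _ (hw0 z)).comp z hw.contDiffAt
      · exact contDiff_iff_contDiffAt.2 fun z =>
          ContDiffAt.comp (g := sgnPow (ξ 2) (-lam 2 + 1)) (f := fun z => (w z)⁻¹) z
            (contDiffAt_sgnPow _ _ (inv_ne_zero (hw0 z))) hwi.contDiffAt
    refine ⟨H, hHs, by simp [hH, h00], ?_⟩
    have hF : ContDiff ℝ ∞ (monoMul p q r 1) := contDiff_monoMul p q r contDiff_const
    have hx : ContDiff ℝ ∞ fun v : ℝ × ℝ × ℝ => (v.1 : ℂ) := contDiff_ofReal_comp contDiff_fst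
    have hy : ContDiff ℝ ∞ fun v : ℝ × ℝ × ℝ => (v.2.1 : ℂ) :=
      contDiff_ofReal_comp (contDiff_fst.comp contDiff_snd)
    have hz : ContDiff ℝ ∞ fun v : ℝ × ℝ × ℝ => (v.2.2 : ℂ) :=
      contDiff_ofReal_comp (contDiff_snd.comp contDiff_snd)
    have h1 := DSBO_apply_one_translate hT hU elemGL_mem hF
      (F' := fun v => ((v.1 : ℂ) + v.2.1) ^ p * (v.2.1 : ℂ) ^ q * (v.2.2 : ℂ) ^ r * H v.2.2)
      (((((hx.add hy).pow p).mul (hy.pow q)).mul (hz.pow r)).mul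
        (hHs.comp (contDiff_snd.comp contDiff_snd))) (by
        have h2 : Tendsto (fun v : ℝ × ℝ × ℝ => (v.1 + v.2.1, v.2.1, v.2.2 / w v.2.2)) (𝓝 0)
            (𝓝 0) := by
          have hwc := hw.continuous
          have h3 : Continuous fun v : ℝ × ℝ × ℝ => (v.1 + v.2.1, v.2.1, v.2.2 / w v.2.2) :=
            (by fun_prop : Continuous fun v : ℝ × ℝ × ℝ => v.1 + v.2.1).prodMk
              ((by fun_prop : Continuous fun v : ℝ × ℝ × ℝ => v.2.1).prodMk
                ((by fun_prop : Continuous fun v : ℝ × ℝ × ℝ => v.2.2).div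
                  (by fun_prop) fun v => hw0 _))
          exact h3.tendsto' 0 0 (by simp)
        have h4 : Tendsto (fun v : ℝ × ℝ × ℝ => v.2.2) (𝓝 0) (𝓝 0) := by
          have h3 : Continuous fun v : ℝ × ℝ × ℝ => v.2.2 := by fun_prop
          exact h3.tendsto' 0 0 (by simp)
        filter_upwards [h2.eventually (cutoff_eventuallyEq (monoMul p q r 1)),
          h4.eventually hw1] with v hv hv1
        have hv0 : 1 + v.2.2 ≠ 0 := hv1 ▸ hw0 v.2.2
        rw [cellSection_elemGL_mul_chart _ hv0, ← hv1, hv]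
        simp only [monoMul, hH, Pi.one_apply]
        push_cast
        rw [div_eq_mul_inv, mul_pow]
        ring)
    rw [h1, inducingFactor_elemGL, one_mul]

/-- A symmetry breaking operator is determined by its value on one test section. -/
theorem DSBO_eq_zero (hn₁ : (n₁ : ℂ) = lam 2 - ν 1 - 1 / 2)
    (hn₂ : (n₂ : ℂ) = lam 1 + lam 2 - ν 0 - ν 1 - 1)
    (hη₁ : η 0 = ξ 1 + ((n₁ + n₂ : ℕ) : ZMod 2)) (hη₂ : η 1 = ξ 2 + (n₁ : ZMod 2))
    {T : principalSeries ξ lam →ₗ[ℂ] principalSeries η ν}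
    (hT : T ∈ DSBO (0 : Fin 3) ξ lam η ν) {f₀ : principalSeries ξ lam}
    (hf₀ : IsMonomial n₂ n₁ 1 f₀.1) (h0 : (T f₀).1 1 = 0) : T = 0 := by
  obtain ⟨U, hU⟩ := exists_functional T
  have hUh := isHomogeneous_functional hn₁ hn₂ hη₁ hη₂ hT hU
  have h1 : U (monoMul n₂ 0 n₁ 1) = 0 := by
    have hm : ContDiff ℝ ∞ (monoMul n₂ 0 n₁ 1) := contDiff_monoMul n₂ 0 n₁ contDiff_const
    rw [← DSBO_apply_one_eq hT hU f₀ hm ?_, h0]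
    filter_upwards [hf₀.eq] with v hv
    rw [hv]
    simp [monoMul]
  have h2 : ∀ f : principalSeries ξ lam, (T f).1 1 = 0 := fun f => by
    have hs := contDiff_comp_chart f.2.1
    rw [DSBO_apply_one_eq hT hU f hs (Eventually.of_forall fun v => rfl), hUh.eq_zero h1 hs]
  refine LinearMap.ext fun f => Subtype.ext (funext fun h => ?_)
  -- The value of `T f` at `h` is the value at `1` for a translate of `f`.
  have h3 := h2 (leftRegular ξ lam (embed 2 h⁻¹) f)
  rw [hT.2.1] at h3
  change (T f).1 (h⁻¹⁻¹ * 1) = 0 at h3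
  rw [inv_inv, mul_one] at h3
  exact h3

lemma exists_isMonomial (a b : ℕ) : ∃ f : principalSeries ξ lam, IsMonomial a b 1 f.1 := by
  have hF := contDiff_monoMul a 0 b (contDiff_const (c := (1 : ℂ)) (𝕜 := ℝ) (n := ∞))
  refine ⟨⟨_, cellSection_cutoff_mem hF⟩, (cellSection_cutoff_mem hF).1, ?_⟩
  filter_upwards [cutoff_eventuallyEq (monoMul a 0 b fun _ => 1)] with v hv
  rw [cellSection_chart, hv]
  simp [monoMul]

lemma exists_basis_of_forall_smul_eq {V : Type*} [AddCommMonoid V] [Module ℂ V] {x : V}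
    (l : V →ₗ[ℂ] ℂ) (hx : l x ≠ 0) (h : ∀ y : V, (l y / l x) • x = y) :
    ∃ b : Module.Basis (Fin 1) ℂ V, b 0 = x := by
  let e : V ≃ₗ[ℂ] (Fin 1 → ℂ) :=
    { toFun := fun y _ => l y / l x
      invFun := fun c => c 0 • x
      map_add' := fun y z => by
        funext _
        simp [add_div]
      map_smul' := fun c y => by
        funext _
        simp [mul_div_assoc]
      left_inv := h
      right_inv := fun c => by
        funext i
        rw [Subsingleton.elim i 0]
        simp [hx] }
  refine ⟨Module.Basis.ofEquivFun e, ?_⟩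
  rw [Module.Basis.coe_ofEquivFun]
  change (Pi.single (0 : Fin 1) (1 : ℂ) : Fin 1 → ℂ) 0 • x = x
  rw [Pi.single_eq_same, one_smul]

/-- A symmetry breaking operator that does not annihilate monomial sections is a basis. -/
lemma exists_basis_DSBO (hn₁ : (n₁ : ℂ) = lam 2 - ν 1 - 1 / 2)
    (hn₂ : (n₂ : ℂ) = lam 1 + lam 2 - ν 0 - ν 1 - 1)
    (hη₁ : η 0 = ξ 1 + ((n₁ + n₂ : ℕ) : ZMod 2)) (hη₂ : η 1 = ξ 2 + (n₁ : ZMod 2))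
    (T : DSBO (0 : Fin 3) ξ lam η ν)
    (hT : ∀ f : principalSeries ξ lam, IsMonomial n₂ n₁ 1 f.1 → (T.1 f).1 1 ≠ 0) :
    ∃ b : Module.Basis (Fin 1) ℂ (DSBO (0 : Fin 3) ξ lam η ν), b 0 = T := by
  obtain ⟨f₀, hf₀⟩ := exists_isMonomial (ξ := ξ) (lam := lam) n₂ n₁
  have hne := hT f₀ hf₀
  let l : DSBO (0 : Fin 3) ξ lam η ν →ₗ[ℂ] ℂ :=
    { toFun := fun S => (S.1 f₀).1 1
      map_add' := fun _ _ => rfl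
      map_smul' := fun _ _ => rfl }
  refine exists_basis_of_forall_smul_eq l hne fun S => ?_
  -- With this `c` the operator `S - c T` kills the test section at `1`, hence is zero.
  set c := l S / l T with hc
  have hm : S.1 + (-c) • T.1 ∈ DSBO (0 : Fin 3) ξ lam η ν :=
    Submodule.add_mem _ S.2 (Submodule.smul_mem _ (-c) T.2)
  have h := DSBO_eq_zero hn₁ hn₂ hη₁ hη₂ hm hf₀ (by
    change l S + -c * l T = 0
    have hl : l T ≠ 0 := hne
    rw [hc, neg_mul, div_mul_cancel₀ _ hl, add_neg_cancel])
  refine Subtype.ext (LinearMap.ext fun f => Subtype.ext (funext fun g => ?_))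
  have hg : (S.1 f).1 g + -c * (T.1 f).1 g = 0 :=
    congrFun (congrArg Subtype.val (LinearMap.congr_fun h f)) g
  change c * (T.1 f).1 g = (S.1 f).1 g
  linear_combination -hg

end Functional

end SymBreak

end

/-! ### The proposition: existence combined with uniqueness. -/

theorem proposition5p8
    (ξ : Fin 3 → ZMod 2) (lam : Fin 3 → ℂ) (η : Fin 2 → ZMod 2) (ν : Fin 2 → ℂ)
    (n₁ n₂ : ℕ)
    (hn₁ : (n₁ : ℂ) = lam 2 - ν 1 - 1 / 2)
    (hn₂ : (n₂ : ℂ) = lam 1 + lam 2 - ν 0 - ν 1 - 1)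
    (hη₁ : η 0 = ξ 1 + ((n₁ + n₂ : ℕ) : ZMod 2))
    (hη₂ : η 1 = ξ 2 + (n₁ : ZMod 2)) :
    (n₁ ≤ n₂ →
      ∃ b : Module.Basis (Fin 1) ℂ (SymBreak.DSBO (0 : Fin 3) ξ lam η ν),
        ∀ f : SymBreak.principalSeries ξ lam,
          ((b 0).1 f).1 =
            (SymBreak.rest (0 : Fin 3) ∘
              SymBreak.calDPow (1 : Fin 3) (lam - (n₁ : ℂ) • Pi.single 2 1) (n₂ - n₁) ∘
              SymBreak.calDPow (2 : Fin 3) lam n₁) f.1) ∧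
    (n₂ < n₁ → ∀ k₀ : ℕ, k₀ ≤ n₂ → lam 2 - lam 1 - (n₁ : ℂ) + (k₀ : ℂ) = 0 →
      ∃ b : Module.Basis (Fin 1) ℂ (SymBreak.DSBO (0 : Fin 3) ξ lam η ν),
        ∀ f : SymBreak.principalSeries ξ lam,
          ((b 0).1 f).1 =
            ((SymBreak.eps (1 : Fin 2) (0 : Fin 2))^[n₁ - n₂ + k₀] ∘
              SymBreak.rest (0 : Fin 3) ∘
              SymBreak.calDPow (1 : Fin 3)
                (lam - ((n₂ - k₀ : ℕ) : ℂ) • Pi.single 2 1) k₀ ∘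
              SymBreak.calDPow (2 : Fin 3) lam (n₂ - k₀)) f.1) := by
  refine ⟨fun h => ?_, fun h k₀ hk₀ hlam => ?_⟩
  · obtain ⟨T, hT, hT1⟩ := SymBreak.exists_DSBO_of_le hn₁ hn₂ hη₁ hη₂ h
    obtain ⟨b, hb⟩ := SymBreak.exists_basis_DSBO hn₁ hn₂ hη₁ hη₂ T hT1
    exact ⟨b, fun f => by rw [hb]; exact hT f⟩
  · obtain ⟨T, hT, hT1⟩ := SymBreak.exists_DSBO_of_lt hn₁ hn₂ hη₁ hη₂ h hk₀ hlam
    obtain ⟨b, hb⟩ := SymBreak.exists_basis_DSBO hn₁ hn₂ hη₁ hη₂ T hT1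
    exact ⟨b, fun f => by rw [hb]; exact hT f⟩
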